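/- Let $\kappa>0$ and let $\Lambda=[-1/2,1/2)^2$ be the two-dimensional unit torus. For $k\in\mathbb Z^2$ put $\lambda_k=\kappa+2\pi^2|k|^2$ and $u_k(x)=e^{2\pi i k\cdot x}$ (the eigenvalues and eigenfunctions of $\kappa-\Delta/2$ on $\Lambda$). Let $X=(X_k)_{k\in\mathbb Z^2}$ be independent standard complex Gaussian random variables ($\mathbb E X_k=0$, $\mathbb E X_k^2=0$, $\mathbb E|X_k|^2=1$), with law $\mathbb P$. A cutoff is a function $\vartheta:\mathbb R^2\to[0,\infty)$ of rapid decay that is continuous at $0$ and satisfies $\vartheta(0)=1$. For a cutoff $\vartheta$ and $N>0$ let $$\phi_N=\sum_{k\in\mathbb Z^2}\frac{X_k}{\sqrt{\lambda_k}}\sqrt{\vartheta(k/N)}\,u_k .$$ Let $v:\mathbb R^2\to\mathbb R$ be even, smooth, compactly supported, with $\int v=1$ and with nonnegative Fourier transform, and for $\epsilon>0$ let $v^\epsilon(x)=\sum_{n\in\mathbb Z^2}\epsilon^{-2}v((x-n)/\epsilon)$. With ${:}\,\cdot\,{:}$ denoting Wick ordering with respect to $\mathbb P$, put $$V_N^\epsilon=\frac12\int_\Lambda\!\int_\Lambda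 v^\epsilon(x-\tilde x)\,{:}|\phi_N(x)|^2|\phi_N(\tilde x)|^2{:}\,dx\,d\tilde x,\qquad V_N=\frac12\int_\Lambda{:}|\phi_N(x)|^4{:}\,dx .$$ **Proposition 4.1.** As $N\to\infty$, $V^\epsilon_N$ (for every $\epsilon>0$) and $V_N$ converge in $L^2(\mathbb P)$ to random variables $V^\epsilon$ and $V$ that do not depend on the cutoff $\vartheta$. There are constants $c>0$ and $C>0$, depending only on $\kappa$ and $v$, such that for all $\epsilon>0$ and $t\ge1$ $$\mathbb P\bigl(e^{-V^\epsilon}>t\bigr)\le C\exp\bigl(-e^{c\sqrt{\log t}}\bigr),\qquad \mathbb P\bigl(e^{-V}>t\bigr)\le C\exp\bigl(-e^{c\sqrt{\log t}}\bigr).$$ In particular, the family $(e^{-V^\epsilon})_{\epsilon>0}$ is uniformly integrable. -/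

import Mathlib

open MeasureTheory ProbabilityTheory Filter Topology
open scoped FourierTransform ContDiff ComplexConjugate

noncomputable section

namespace Phi42

/-- The plane `ℝ²` with its Euclidean norm. -/
abbrev Plane : Type := EuclideanSpace ℝ (Fin 2)

/-- The index set `ℤ²` of the Fourier modes. -/
abbrev Lattice : Type := Fin 2 → ℤ

/-- The inclusion of `ℤ²` in `ℝ²`. -/
def toPlane (k : Lattice) : Plane := WithLp.toLp 2 (fun i => (k i : ℝ))

/-- The fundamental domain `[-1/2, 1/2)²` of the unit torus. -/
def torus : Set Plane := {x | ∀ i, x i ∈ Set.Ico (-(1 / 2) : ℝ) (1 / 2)}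

/-- The eigenvalue `κ + 2 π² |k|²` of `κ - Δ / 2` on the torus. -/
def eigenvalue (κ : ℝ) (k : Lattice) : ℝ := κ + 2 * Real.pi ^ 2 * ‖toPlane k‖ ^ 2

/-- The normalized eigenfunction `x ↦ exp (2 π i k · x)` of `κ - Δ / 2` on the torus. -/
def eigenfunction (k : Lattice) (x : Plane) : ℂ :=
  Complex.exp (2 * Real.pi * Complex.I * (inner ℝ (toPlane k) x : ℝ))

/-- The law of a standard complex Gaussian `Z`: the real and the imaginary part are independent
centred Gaussians of variance `1 / 2`, so that `E Z = 0`, `E Z² = 0` and `E |Z|² = 1`. -/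
def stdComplexGaussian : Measure ℂ :=
  ((gaussianReal 0 2⁻¹).prod (gaussianReal 0 2⁻¹)).map Complex.measurableEquivRealProd.symm

instance : IsProbabilityMeasure stdComplexGaussian :=
  Measure.isProbabilityMeasure_map Complex.measurableEquivRealProd.symm.measurable.aemeasurable

/-- The sample space; a sample point `X` is the family of the coefficients `X k`. -/
abbrev Sample : Type := Lattice → ℂ

/-- The probability measure: under `law` the coordinates `X k` are independent standard complex
Gaussians. -/
def law : Measure Sample := Measure.infinitePi (fun _ : Lattice => stdComplexGaussian)

/-- An admissible Fourier cutoff: nonnegative, equal to one and continuous at the origin, and of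
rapid decay. -/
structure IsCutoff (θ : Plane → ℝ) : Prop where
  nonneg : ∀ ξ, 0 ≤ θ ξ
  at_zero : θ 0 = 1
  continuousAt_zero : ContinuousAt θ 0
  decay : ∀ m : ℕ, ∃ C : ℝ, ∀ ξ, ‖ξ‖ ^ m * θ ξ ≤ C

/-- The regularized free field `φ_N (x) = ∑ₖ X_k λ_k^{-1/2} θ(k/N)^{1/2} u_k(x)`; the series
converges absolutely for almost every `X`. -/
def field (κ : ℝ) (θ : Plane → ℝ) (N : ℝ) (x : Plane) (X : Sample) : ℂ :=
  ∑' k : Lattice, X k / (√(eigenvalue κ k) : ℂ) * (√(θ (N⁻¹ • toPlane k)) : ℂ) * eigenfunction k x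

/-- The Wick-ordered monomial `:ξ₁ ⋯ ξₙ:` of a centred (complex) Gaussian vector, namely the sum
over all partial pairings `Π` of the index set of
`∏_{i unpaired} ξ_i * ∏_{{i, j} ∈ Π} (- E[ξ_i ξ_j])`.
A partial pairing is encoded by the involution `σ` that exchanges the members of each pair. -/
def wick {Ω : Type*} [MeasurableSpace Ω] (P : Measure Ω) {n : ℕ} (ξ : Fin n → Ω → ℂ) (s : Ω) : ℂ :=
  ∑ σ : Equiv.Perm (Fin n) with σ * σ = 1,
    (∏ i : Fin n with σ i = i, ξ i s) *
      ∏ i : Fin n with i < σ i, (-∫ s', ξ i s' * ξ (σ i) s' ∂P)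

/-- `:|φ_N(x)|² |φ_N(y)|²:`, a real quantity. -/
def wickSquares (κ : ℝ) (θ : Plane → ℝ) (N : ℝ) (x y : Plane) (X : Sample) : ℝ :=
  (wick law ![field κ θ N x, fun X => conj (field κ θ N x X),
    field κ θ N y, fun X => conj (field κ θ N y X)] X).re

/-- The admissible two-body potentials: even, smooth, compactly supported, of positive type
(the Fourier transform is nonnegative), with integral one. -/
structure IsPotential (v : Plane → ℝ) : Prop where
  even : ∀ x, v (-x) = v x
  smooth : ContDiff ℝ ∞ v
  compactSupport : HasCompactSupport v
  positiveType : ∀ ξ, ∃ r : ℝ, 0 ≤ r ∧ 𝓕 (fun x => (v x : ℂ)) ξ = (r : ℂ)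
  integral_eq_one : ∫ x, v x = 1

/-- The rescaled periodized potential `v^ε(x) = ∑ₙ ε⁻² v((x - n)/ε)`. -/
def rescaled (v : Plane → ℝ) (ε : ℝ) (x : Plane) : ℝ :=
  ∑' n : Lattice, (ε ^ 2)⁻¹ * v (ε⁻¹ • (x - toPlane n))

/-- The truncated nonlocal interaction
`V^ε_N = 1/2 ∫∫ v^ε(x - y) :|φ_N(x)|² |φ_N(y)|²: dx dy`. -/
def truncatedNonlocal (κ : ℝ) (v : Plane → ℝ) (ε : ℝ) (θ : Plane → ℝ) (N : ℝ) (X : Sample) : ℝ :=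
  1 / 2 * ∫ x in torus, ∫ y in torus, rescaled v ε (x - y) * wickSquares κ θ N x y X

/-- The truncated local interaction `V_N = 1/2 ∫ :|φ_N(x)|⁴: dx`. -/
def truncatedLocal (κ : ℝ) (θ : Plane → ℝ) (N : ℝ) (X : Sample) : ℝ :=
  1 / 2 * ∫ x in torus, wickSquares κ θ N x x X

/-- `V` is (a version of) the nonlocal interaction `V^ε`: the limit in `L²` of the truncated
interactions, whatever the cutoff. -/
def IsNonlocalInteraction (κ : ℝ) (v : Plane → ℝ) (ε : ℝ) (V : Sample → ℝ) : Prop :=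
  MemLp V 2 law ∧ ∀ θ, IsCutoff θ →
    Tendsto (fun N : ℝ => eLpNorm (fun X => truncatedNonlocal κ v ε θ N X - V X) 2 law)
      atTop (𝓝 0)

/-- `V` is (a version of) the local interaction `1/2 ∫ :|φ(x)|⁴: dx`: the limit in `L²` of the
truncated interactions, whatever the cutoff. -/
def IsLocalInteraction (κ : ℝ) (V : Sample → ℝ) : Prop :=
  MemLp V 2 law ∧ ∀ θ, IsCutoff θ →
    Tendsto (fun N : ℝ => eLpNorm (fun X => truncatedLocal κ θ N X - V X) 2 law)
      atTop (𝓝 0)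

end Phi42

end

/-!
In Fourier variables the truncated interactions are series of Wick monomials
`:X_{k₁} conj X_{k₂} X_{k₃} conj X_{k₄}:` over the quadruples of modes of total momentum zero. Their
coefficients are dominated by `∏ λ_k^{-1/2}`, which is square summable on such quadruples in
dimension two. Hence they converge in `L²`, to a limit in which the cutoff has disappeared.

The tail estimate is Nelson's argument. The interaction `V_n` whose modes are in the box of size `n`
is at least `-A (1 + log n)²`, because up to the exchange terms it is a sum of squares and the
variance of the field grows like `log n`. On the other hand the variance of `V - V_n` is at most
`R n^{-1/4}`, so its moments of order `2m` are at most `16ᵐ (4m)! (R n^{-1/4})ᵐ`. If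
`V < -L` with `L` of the order of `(log n)²`, then `|V - V_n| > 1`, and the optimal `m` bounds the
probability of this event by a double exponential in `√L`.

The moment bound avoids chaos decompositions. If `W` is an independent copy of `X`, the families
`(X + W) / √2` and `conj (X - W) / √2` together are again independent standard complex Gaussians,
and a Wick monomial in `X` is, up to a constant, the mean over `W` of a holomorphic monomial in
them. Monomials in complex Gaussians are orthogonal with explicit norms, and powers of holomorphic
polynomials are holomorphic, so that all even moments reduce to second moments; Jensen's inequality
carries the bound over to the Wick polynomial.
-/

noncomputable section

namespace Phi42

/-! ### The standard complex Gaussian -/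

instance : IsGaussian stdComplexGaussian := by
  have h : stdComplexGaussian = ((gaussianReal 0 2⁻¹).prod (gaussianReal 0 2⁻¹)).map
      Complex.equivRealProdCLM.symm := rfl
  rw [h]
  infer_instance

lemma gaussianPDFReal_half_mul_gaussianPDFReal_half (z : ℂ) :
    gaussianPDFReal 0 2⁻¹ z.re * gaussianPDFReal 0 2⁻¹ z.im =
      Real.pi⁻¹ * Real.exp (-‖z‖ ^ 2) := by
  have h_var : (2 : ℝ) * ((2⁻¹ : NNReal) : ℝ) = 1 := by norm_num
  have h_norm : 2 * Real.pi * ((2⁻¹ : NNReal) : ℝ) = Real.pi := by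
    push_cast
    ring
  simp only [gaussianPDFReal, sub_zero]
  rw [h_var, h_norm, div_one, div_one, mul_mul_mul_comm, ← Real.exp_add, ← mul_inv,
    Real.mul_self_sqrt Real.pi_pos.le, ← Complex.normSq_eq_norm_sq, Complex.normSq_apply]
  congr 2
  ring

lemma stdComplexGaussian_eq_withDensity :
    stdComplexGaussian =
      volume.withDensity (fun z : ℂ => ENNReal.ofReal (Real.pi⁻¹ * Real.exp (-‖z‖ ^ 2))) := by
  unfold stdComplexGaussian
  rw [gaussianReal_of_var_ne_zero _ (by norm_num : (2⁻¹ : NNReal) ≠ 0),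
    prod_withDensity (measurable_gaussianPDF _ _) (measurable_gaussianPDF _ _)]
  ext s hs
  rw [Measure.map_apply Complex.measurableEquivRealProd.symm.measurable hs,
    withDensity_apply _ (Complex.measurableEquivRealProd.symm.measurable hs),
    withDensity_apply _ hs, ← (Complex.volume_preserving_equiv_real_prod.symm
      Complex.measurableEquivRealProd).setLIntegral_comp_preimage hs (by fun_prop)]
  refine lintegral_congr fun p => ?_
  rw [gaussianPDF, gaussianPDF, ← ENNReal.ofReal_mul (gaussianPDFReal_nonneg _ _ _),
    ← gaussianPDFReal_half_mul_gaussianPDFReal_half]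
  rfl

lemma stdComplexGaussian_map_isometry (e : ℂ ≃ₗᵢ[ℝ] ℂ) :
    stdComplexGaussian.map e = stdComplexGaussian := by
  have he : Measurable e := e.continuous.measurable
  rw [stdComplexGaussian_eq_withDensity]
  ext s hs
  rw [Measure.map_apply he hs, withDensity_apply _ (he hs), withDensity_apply _ hs,
    ← e.measurePreserving.setLIntegral_comp_preimage hs (by fun_prop)]
  simp only [LinearIsometryEquiv.norm_map]

lemma integral_stdComplexGaussian {E : Type*} [NormedAddCommGroup E] [NormedSpace ℝ E]
    (f : ℂ → E) : ∫ z, f z ∂stdComplexGaussian =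
      ∫ z : ℂ, (Real.pi⁻¹ * Real.exp (-‖z‖ ^ 2)) • f z := by
  rw [stdComplexGaussian_eq_withDensity, integral_withDensity_eq_integral_toReal_smul
    (by fun_prop) (by simp)]
  refine integral_congr_ae (ae_of_all _ fun z => ?_)
  simp only
  rw [ENNReal.toReal_ofReal (by positivity)]

lemma integral_norm_pow_stdComplexGaussian (a : ℕ) :
    ∫ z : ℂ, ‖z‖ ^ (2 * a) ∂stdComplexGaussian = a.factorial := by
  have h_gamma := Complex.integral_rpow_mul_exp_neg_rpow (p := 2) (q := 2 * a) (by norm_num)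
    (by linarith [a.cast_nonneg (α := ℝ)])
  rw [show ((2 * a + 2) / 2 : ℝ) = a + 1 by ring, Real.Gamma_nat_eq_factorial] at h_gamma
  have h_integrand : ∀ z : ℂ, (Real.pi⁻¹ * Real.exp (-‖z‖ ^ 2)) • ‖z‖ ^ (2 * a) =
      Real.pi⁻¹ * (‖z‖ ^ (2 * a : ℝ) * Real.exp (-‖z‖ ^ (2 : ℝ))) := by
    intro z
    rw [show (2 * a : ℝ) = ((2 * a : ℕ) : ℝ) by push_cast; ring, Real.rpow_natCast,
      Real.rpow_two, smul_eq_mul]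
    ring
  simp_rw [integral_stdComplexGaussian, h_integrand]
  rw [integral_const_mul, h_gamma]
  field_simp

lemma integral_pow_mul_conj_pow_rotation (a b : ℕ) (u : Circle) :
    ∫ z : ℂ, z ^ a * conj z ^ b ∂stdComplexGaussian =
      ((u : ℂ) ^ a * conj (u : ℂ) ^ b) * ∫ z : ℂ, z ^ a * conj z ^ b ∂stdComplexGaussian := by
  conv_lhs => rw [← stdComplexGaussian_map_isometry (rotation u)]
  rw [integral_map (rotation u).continuous.measurable.aemeasurable (by fun_prop),
    ← integral_const_mul]
  refine integral_congr_ae (ae_of_all _ fun z => ?_)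
  simp only [rotation_apply, map_mul]
  ring

lemma exists_circle_pow_mul_conj_pow_eq_neg_one {a b : ℕ} (h : a ≠ b) :
    ∃ u : Circle, (u : ℂ) ^ a * conj (u : ℂ) ^ b = -1 := by
  have hab : (a : ℂ) - b ≠ 0 := sub_ne_zero.mpr (by exact_mod_cast h)
  refine ⟨Circle.exp (Real.pi / (a - b)), ?_⟩
  rw [Circle.coe_exp, ← Complex.exp_conj, ← Complex.exp_nat_mul, ← Complex.exp_nat_mul,
    ← Complex.exp_add, ← Complex.exp_pi_mul_I]
  simp only [map_mul, Complex.conj_ofReal, Complex.conj_I]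
  push_cast
  congr 1
  field_simp
  ring

lemma integral_pow_mul_conj_pow (a b : ℕ) :
    ∫ z : ℂ, z ^ a * conj z ^ b ∂stdComplexGaussian = if a = b then (a.factorial : ℂ) else 0 := by
  split_ifs with h
  · subst h
    rw [← Complex.ofReal_natCast, ← integral_norm_pow_stdComplexGaussian, ← integral_complex_ofReal]
    refine integral_congr_ae (ae_of_all _ fun z => ?_)
    simp only
    rw [← mul_pow, Complex.mul_conj, Complex.normSq_eq_norm_sq, pow_mul]
    norm_cast
  · obtain ⟨u, hu⟩ := exists_circle_pow_mul_conj_pow_eq_neg_one h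
    have h_neg := integral_pow_mul_conj_pow_rotation a b u
    rw [hu, neg_one_mul] at h_neg
    exact self_eq_neg.mp h_neg

/-- The map `(x, w) ↦ ((x + w) / √2, conj (x - w) / √2)`. It preserves the law of a pair of
independent standard complex Gaussians and turns the averages over `w` of holomorphic polynomials
into Wick polynomials in `x` and `conj x`. -/
def mixPair (p : ℂ × ℂ) : ℂ × ℂ :=
  ((√2 : ℂ)⁻¹ * (p.1 + p.2), (√2 : ℂ)⁻¹ * conj (p.1 - p.2))

lemma measurable_mixPair : Measurable mixPair := by
  unfold mixPair
  fun_prop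

lemma mixPair_eq_comp_rotation :
    mixPair = Prod.map id (fun z => -conj z) ∘
      (ContinuousLinearMap.rotation (Real.pi / 4) : ℂ × ℂ → ℂ × ℂ) := by
  have h_sqrt : (√2 : ℂ)⁻¹ = √2 / 2 := by
    rw [← Complex.ofReal_inv, ← Real.sqrt_div_self]
    push_cast
    rfl
  funext p
  simp only [mixPair, ContinuousLinearMap.rotation_apply, Function.comp, Prod.map, id,
    Real.cos_pi_div_four, Real.sin_pi_div_four, h_sqrt, Complex.real_smul]
  ext1
  · push_cast
    ring
  · simp only [map_sub, map_add, map_mul, Complex.conj_ofReal, Complex.ofReal_neg, map_neg]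
    push_cast
    ring

lemma measurePreserving_mixPair : MeasurePreserving mixPair
    (stdComplexGaussian.prod stdComplexGaussian) (stdComplexGaussian.prod stdComplexGaussian) := by
  have h_centred : ∫ z, z ∂stdComplexGaussian = 0 := by
    simpa using integral_pow_mul_conj_pow 1 0
  have h_rotation : MeasurePreserving (ContinuousLinearMap.rotation (Real.pi / 4) : ℂ × ℂ → ℂ × ℂ)
      (stdComplexGaussian.prod stdComplexGaussian) (stdComplexGaussian.prod stdComplexGaussian) :=
    ⟨by fun_prop, IsGaussian.map_rotation_eq_self (by simpa using h_centred) (Real.pi / 4)⟩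
  have h_conj : MeasurePreserving (fun z => -conj z) stdComplexGaussian stdComplexGaussian :=
    ⟨by fun_prop,
      stdComplexGaussian_map_isometry (Complex.conjLIE.trans (LinearIsometryEquiv.neg ℝ))⟩
  rw [mixPair_eq_comp_rotation]
  exact ((MeasurePreserving.id _).prod h_conj).comp h_rotation

/-! ### Families of independent complex Gaussians -/

/-- The law of a family of independent standard complex Gaussians indexed by `ι`. For the index
set `ℤ²` it is `law`. -/
def gaussianFamily (ι : Type*) : Measure (ι → ℂ) :=
  Measure.infinitePi (fun _ : ι => stdComplexGaussian)

instance (ι : Type*) : IsProbabilityMeasure (gaussianFamily ι) := by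
  unfold gaussianFamily
  infer_instance

instance : IsProbabilityMeasure law := by
  unfold law
  infer_instance

lemma law_eq_gaussianFamily : law = gaussianFamily Lattice := rfl

lemma integral_infinitePi_finset_prod {ι 𝕜 : Type*} {α : ι → Type*} [∀ i, MeasurableSpace (α i)]
    [RCLike 𝕜] (μ : ∀ i, Measure (α i)) [∀ i, IsProbabilityMeasure (μ i)] (T : Finset ι)
    {g : ∀ i, α i → 𝕜} (hg : ∀ i, Measurable (g i)) :
    ∫ Z, ∏ i ∈ T, g i (Z i) ∂Measure.infinitePi μ = ∏ i ∈ T, ∫ z, g i z ∂μ i := by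
  have h_restrict : (fun Z : ∀ i, α i => ∏ i ∈ T, g i (Z i)) =
      fun Z => (fun y : ∀ i : T, α i => ∏ i : T, g i (y i)) (T.restrict Z) :=
    funext fun Z => (Finset.prod_coe_sort T fun i => g i (Z i)).symm
  rw [h_restrict]
  refine (integral_restrict_infinitePi μ (s := T) (f := fun y : ∀ i : T, α i => ∏ i : T, g i (y i))
    (Measurable.aestronglyMeasurable (by fun_prop))).trans ?_
  rw [integral_fintype_prod_eq_prod (fun i : T => g i)]
  exact Finset.prod_coe_sort T fun i => ∫ z, g i z ∂μ i

lemma measurePreserving_eval_gaussianFamily {ι : Type*} (i : ι) :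
    MeasurePreserving (fun Z : ι → ℂ => Z i) (gaussianFamily ι) stdComplexGaussian :=
  measurePreserving_eval_infinitePi (fun _ : ι => stdComplexGaussian) i

/-- The number of times the value `i` is taken by `k`. -/
def multiplicity {J ι : Type*} [Fintype J] [DecidableEq ι] (k : J → ι) (i : ι) : ℕ :=
  (Finset.univ.filter fun j => k j = i).card

section Multiplicity

variable {J L ι : Type*} [Fintype J] [Fintype L] [DecidableEq ι]

lemma prod_comp_eq_prod_pow_multiplicity {M : Type*} [CommMonoid M] {k : J → ι} {T : Finset ι}
    (hT : ∀ j, k j ∈ T) (f : ι → M) : ∏ j, f (k j) = ∏ i ∈ T, f i ^ multiplicity k i := by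
  rw [← Finset.prod_fiberwise_of_maps_to (s := Finset.univ) (t := T) fun j _ => hT j]
  refine Finset.prod_congr rfl fun i _ => ?_
  exact Finset.prod_eq_pow_card fun j hj => by rw [(Finset.mem_filter.mp hj).2]

lemma multiplicity_comp_perm (k : J → ι) (τ : Equiv.Perm J) :
    multiplicity (k ∘ τ) = multiplicity k := by
  funext i
  exact Finset.card_bij' (fun j _ => τ j) (fun j _ => τ.symm j) (by simp) (by simp) (by simp)
    (by simp)

lemma exists_perm_of_multiplicity_eq {k l : J → ι} (h : multiplicity k = multiplicity l) :
    ∃ τ : Equiv.Perm J, k ∘ τ = l := by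
  have e : ∀ i, {j // l j = i} ≃ {j // k j = i} := fun i => Fintype.equivOfCardEq (by
    rw [Fintype.card_subtype, Fintype.card_subtype]
    exact (congrFun h i).symm)
  refine ⟨(Equiv.sigmaFiberEquiv l).symm.trans
    ((Equiv.sigmaCongrRight e).trans (Equiv.sigmaFiberEquiv k)), ?_⟩
  funext j
  exact (e (l j) ⟨j, rfl⟩).2

lemma multiplicity_eq_zero_of_notMem {k : J → ι} {T : Finset ι} (hk : ∀ j, k j ∈ T) {i : ι}
    (hi : i ∉ T) : multiplicity k i = 0 :=
  Finset.card_eq_zero.mpr (Finset.filter_eq_empty_iff.mpr fun j _ hj => hi (hj ▸ hk j))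

lemma sum_multiplicity {k : J → ι} {T : Finset ι} (hk : ∀ j, k j ∈ T) :
    ∑ i ∈ T, multiplicity k i = Fintype.card J := by
  rw [← Finset.card_univ]
  exact (Finset.card_eq_sum_card_fiberwise fun j _ => hk j).symm

lemma card_perm_comp_eq [DecidableEq J] {k l : J → ι} {T : Finset ι} (hk : ∀ j, k j ∈ T)
    (hl : ∀ j, l j ∈ T) :
    (Finset.univ.filter fun σ : Equiv.Perm J => k ∘ σ = l).card =
      ∏ i ∈ T, if multiplicity k i = multiplicity l i then (multiplicity k i).factorial else 0 := by
  by_cases h : ∃ τ : Equiv.Perm J, k ∘ τ = l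
  · obtain ⟨τ, rfl⟩ := h
    have h_translate : (Finset.univ.filter fun σ : Equiv.Perm J => k ∘ σ = k ∘ τ).card =
        (Finset.univ.filter fun σ : Equiv.Perm J => k ∘ σ = k).card := by
      refine Finset.card_equiv (Equiv.mulRight τ⁻¹) fun σ => ?_
      simp only [Finset.mem_filter, Finset.mem_univ, true_and, Equiv.coe_mulRight,
        Equiv.Perm.coe_mul, ← Function.comp_assoc]
      exact (Equiv.comp_symm_eq τ k (k ∘ σ)).symm
    have h_stabilizer : (Finset.univ.filter fun σ : Equiv.Perm J => k ∘ σ = k).card =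
        ∏ i ∈ Finset.univ.image k, (multiplicity k i).factorial := by
      simpa only [Fintype.card_subtype] using! DomMulAct.stabilizer_card' k
    simp only [multiplicity_comp_perm, if_true]
    rw [h_translate, h_stabilizer]
    refine Finset.prod_subset (Finset.image_subset_iff.mpr fun j _ => hk j) fun i _ hi => ?_
    rw [multiplicity_eq_zero_of_notMem (by simp) hi, Nat.factorial_zero]
  · rw [Finset.card_eq_zero.mpr (Finset.filter_eq_empty_iff.mpr fun σ _ hσ => h ⟨σ, hσ⟩), eq_comm,
      Finset.prod_eq_zero_iff]
    by_contra! h_ne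
    refine h (exists_perm_of_multiplicity_eq (funext fun i => ?_))
    by_cases hi : i ∈ T
    · by_contra h_mult
      exact h_ne i hi (if_neg h_mult)
    · rw [multiplicity_eq_zero_of_notMem hk hi, multiplicity_eq_zero_of_notMem hl hi]

lemma integral_prod_mul_conj_prod_eq_prod {k : J → ι} {l : L → ι} {T : Finset ι}
    (hk : ∀ j, k j ∈ T) (hl : ∀ j, l j ∈ T) :
    ∫ Z, (∏ j, Z (k j)) * conj (∏ j, Z (l j)) ∂gaussianFamily ι =
      ∏ i ∈ T, if multiplicity k i = multiplicity l i then ((multiplicity k i).factorial : ℂ)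
        else 0 := by
  simp_rw [← integral_pow_mul_conj_pow]
  rw [← integral_infinitePi_finset_prod (fun _ : ι => stdComplexGaussian) T
    (g := fun i z => z ^ multiplicity k i * conj z ^ multiplicity l i) fun i => by fun_prop]
  refine integral_congr_ae (ae_of_all _ fun Z => ?_)
  simp only
  rw [prod_comp_eq_prod_pow_multiplicity hk, prod_comp_eq_prod_pow_multiplicity hl, map_prod,
    ← Finset.prod_mul_distrib]
  simp only [map_pow]

lemma integral_prod_mul_conj_prod [DecidableEq J] (k l : J → ι) :
    ∫ Z, (∏ j, Z (k j)) * conj (∏ j, Z (l j)) ∂gaussianFamily ι =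
      ((Finset.univ.filter fun σ : Equiv.Perm J => k ∘ σ = l).card : ℂ) := by
  have hk : ∀ j, k j ∈ Finset.univ.image k ∪ Finset.univ.image l := by simp
  have hl : ∀ j, l j ∈ Finset.univ.image k ∪ Finset.univ.image l := by simp
  rw [integral_prod_mul_conj_prod_eq_prod hk hl, card_perm_comp_eq hk hl]
  push_cast
  rfl

end Multiplicity

lemma integral_prod_mul_conj_prod_of_card_ne {J L ι : Type*} [Fintype J] [Fintype L]
    (k : J → ι) (l : L → ι) (h : Fintype.card J ≠ Fintype.card L) :
    ∫ Z, (∏ j, Z (k j)) * conj (∏ j, Z (l j)) ∂gaussianFamily ι = 0 := by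
  classical
  have hk : ∀ j, k j ∈ Finset.univ.image k ∪ Finset.univ.image l := by simp
  have hl : ∀ j, l j ∈ Finset.univ.image k ∪ Finset.univ.image l := by simp
  rw [integral_prod_mul_conj_prod_eq_prod hk hl, Finset.prod_eq_zero_iff]
  by_contra! h_ne
  refine h ?_
  rw [← sum_multiplicity hk, ← sum_multiplicity hl]
  refine Finset.sum_congr rfl fun i hi => ?_
  by_contra h_mult
  exact h_ne i hi (if_neg h_mult)

/-! ### Hypercontractivity for holomorphic polynomials -/

/-- `f` has moments of all orders. These functions form a `conj`-invariant algebra, which makes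
all the integrability side conditions below formal. -/
def HasMoments {Ω 𝕜 : Type*} [MeasurableSpace Ω] [RCLike 𝕜] (f : Ω → 𝕜) (P : Measure Ω) : Prop :=
  ∀ p : ENNReal, p ≠ ⊤ → MemLp f p P

namespace HasMoments

variable {Ω 𝕜 : Type*} [MeasurableSpace Ω] [RCLike 𝕜] {P : Measure Ω} {f g : Ω → 𝕜}

lemma const [IsFiniteMeasure P] (c : 𝕜) : HasMoments (fun _ : Ω => c) P := fun _ _ => memLp_const c

lemma add (hf : HasMoments f P) (hg : HasMoments g P) : HasMoments (fun x => f x + g x) P :=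
  fun p hp => (hf p hp).add (hg p hp)

lemma sub (hf : HasMoments f P) (hg : HasMoments g P) : HasMoments (fun x => f x - g x) P :=
  fun p hp => (hf p hp).sub (hg p hp)

lemma mul (hf : HasMoments f P) (hg : HasMoments g P) : HasMoments (fun x => f x * g x) P := by
  intro p hp
  have : ENNReal.HolderTriple (2 * p) (2 * p) p := ⟨by
    rw [ENNReal.mul_inv (by simp) (by simp), ← add_mul, ENNReal.inv_two_add_inv_two, one_mul]⟩
  have h_two_mul : 2 * p ≠ ⊤ := ENNReal.mul_ne_top (by simp) hp
  exact (hg (2 * p) h_two_mul).mul (hf (2 * p) h_two_mul)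

lemma star (hf : HasMoments f P) : HasMoments (fun x => conj (f x)) P :=
  fun p hp => (hf p hp).star

lemma finsetProd [IsFiniteMeasure P] {J : Type*} (s : Finset J) {F : J → Ω → 𝕜}
    (hF : ∀ j, HasMoments (F j) P) : HasMoments (fun x => ∏ j ∈ s, F j x) P := by
  classical
  induction s using Finset.induction_on with
  | empty => simpa using const 1
  | insert a s ha ih => simpa [Finset.prod_insert ha] using (hF a).mul ih

lemma finsetSum {J : Type*} (s : Finset J) {F : J → Ω → 𝕜}
    (hF : ∀ j, HasMoments (F j) P) : HasMoments (fun x => ∑ j ∈ s, F j x) P :=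
  fun p hp => memLp_finsetSum s fun j _ => hF j p hp

lemma integrable (hf : HasMoments f P) : Integrable f P :=
  memLp_one_iff_integrable.mp (hf 1 (by simp))

lemma integrable_norm_pow [IsFiniteMeasure P] (hf : HasMoments f P) (n : ℕ) :
    Integrable (fun x => ‖f x‖ ^ n) P := (hf n (by simp)).integrable_norm_pow'

lemma integral_sum_mul_sum {A B : Type*} [Fintype A] [Fintype B] {F : A → Ω → 𝕜} {G : B → Ω → 𝕜}
    (hF : ∀ a, HasMoments (F a) P) (hG : ∀ b, HasMoments (G b) P) (c : A → 𝕜) (d : B → 𝕜) :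
    ∫ x, (∑ a, c a * F a x) * (∑ b, d b * G b x) ∂P =
      ∑ a, ∑ b, c a * d b * ∫ x, F a x * G b x ∂P := by
  have h_integrable : ∀ a b, Integrable (fun x => c a * d b * (F a x * G b x)) P := fun a b =>
    ((hF a).mul (hG b)).integrable.const_mul _
  have h_expand : ∀ x, (∑ a, c a * F a x) * (∑ b, d b * G b x) =
      ∑ a, ∑ b, c a * d b * (F a x * G b x) := fun x => by
    rw [Finset.sum_mul_sum]
    exact Finset.sum_congr rfl fun a _ => Finset.sum_congr rfl fun b _ => mul_mul_mul_comm _ _ _ _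
  simp_rw [h_expand]
  rw [integral_finsetSum _ fun a _ => integrable_finsetSum _ fun b _ => h_integrable a b]
  refine Finset.sum_congr rfl fun a _ => ?_
  rw [integral_finsetSum _ fun b _ => h_integrable a b]
  exact Finset.sum_congr rfl fun b _ => integral_const_mul _ _

lemma comp_measurePreserving {Ω' : Type*} [MeasurableSpace Ω'] {P' : Measure Ω'} {T : Ω' → Ω}
    (hf : HasMoments f P) (hT : MeasurePreserving T P' P) : HasMoments (fun x => f (T x)) P' :=
  fun p hp => (hf p hp).comp_measurePreserving hT

end HasMoments

lemma hasMoments_eval {ι : Type*} (i : ι) :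
    HasMoments (fun Z : ι → ℂ => Z i) (gaussianFamily ι) :=
  HasMoments.comp_measurePreserving (f := fun z : ℂ => z)
    (fun p hp => IsGaussian.memLp_id stdComplexGaussian p hp)
    (measurePreserving_eval_gaussianFamily i)

lemma hasMoments_monomial {J ι : Type*} [Fintype J] (k : J → ι) :
    HasMoments (fun Z : ι → ℂ => ∏ j, Z (k j)) (gaussianFamily ι) :=
  HasMoments.finsetProd _ fun j => hasMoments_eval (k j)

lemma sum_sum_ite_mul_le_of_biUnique {A : Type*} [Fintype A] {R : A → A → Prop}
    [∀ a b, Decidable (R a b)] (hR : Relator.BiUnique R) (c : A → ℝ) :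
    ∑ a, ∑ b, (if R a b then c a * c b else 0) ≤ ∑ a, c a ^ 2 := by
  have h_row : ∀ a, ∑ b, (if R a b then c a ^ 2 else 0) ≤ c a ^ 2 := fun a => by
    rw [← Finset.sum_filter, Finset.sum_const, nsmul_eq_mul]
    refine mul_le_of_le_one_left (sq_nonneg _) (mod_cast Finset.card_le_one.mpr ?_)
    exact fun b hb b' hb' => hR.2 (Finset.mem_filter.mp hb).2 (Finset.mem_filter.mp hb').2
  have h_col : ∀ b, ∑ a, (if R a b then c b ^ 2 else 0) ≤ c b ^ 2 := fun b => by
    rw [← Finset.sum_filter, Finset.sum_const, nsmul_eq_mul]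
    refine mul_le_of_le_one_left (sq_nonneg _) (mod_cast Finset.card_le_one.mpr ?_)
    exact fun a ha a' ha' => hR.1 (Finset.mem_filter.mp ha).2 (Finset.mem_filter.mp ha').2
  calc ∑ a, ∑ b, (if R a b then c a * c b else 0)
      ≤ ∑ a, ∑ b,
          (2⁻¹ * (if R a b then c a ^ 2 else 0) + 2⁻¹ * (if R a b then c b ^ 2 else 0)) := by
        gcongr with a _ b _
        split_ifs
        · nlinarith [sq_nonneg (c a - c b)]
        · simp
    _ = 2⁻¹ * ∑ a, ∑ b, (if R a b then c a ^ 2 else 0) +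
        2⁻¹ * ∑ b, ∑ a, (if R a b then c b ^ 2 else 0) := by
      simp_rw [Finset.sum_add_distrib, ← Finset.mul_sum]
      congr 2
      exact Finset.sum_comm
    _ ≤ 2⁻¹ * ∑ a, c a ^ 2 + 2⁻¹ * ∑ b, c b ^ 2 := by
      gcongr with a _ b _
      · exact h_row a
      · exact h_col b
    _ = ∑ a, c a ^ 2 := by ring

section Holomorphic

variable {J ι A : Type*} [Fintype J] [Fintype A] {t : A → J → ι}

lemma sum_sum_mul_card_perm_le [DecidableEq J] [DecidableEq ι] (ht : Function.Injective t)
    (c : A → ℝ) :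
    ∑ a, ∑ b, c a * c b *
        ((Finset.univ.filter fun σ : Equiv.Perm J => t a ∘ σ = t b).card : ℝ) ≤
      (Fintype.card J).factorial * ∑ a, c a ^ 2 := by
  have h_biUnique : ∀ σ : Equiv.Perm J, Relator.BiUnique fun a b => t a ∘ σ = t b := fun σ =>
    ⟨fun a b a' h h' => ht (σ.surjective.injective_comp_right (h.trans h'.symm)),
      fun a b b' h h' => ht (h.symm.trans h')⟩
  calc ∑ a, ∑ b, c a * c b *
        ((Finset.univ.filter fun σ : Equiv.Perm J => t a ∘ σ = t b).card : ℝ)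
      = ∑ a, ∑ b, ∑ σ : Equiv.Perm J, (if t a ∘ σ = t b then c a * c b else 0) := by
        refine Finset.sum_congr rfl fun a _ => Finset.sum_congr rfl fun b _ => ?_
        rw [← Finset.sum_filter, Finset.sum_const, nsmul_eq_mul, mul_comm]
    _ = ∑ σ : Equiv.Perm J, ∑ a, ∑ b, (if t a ∘ σ = t b then c a * c b else 0) := by
        simp_rw [Finset.sum_comm (s := Finset.univ (α := A)) (t := Finset.univ (α := Equiv.Perm J))]
    _ ≤ ∑ _σ : Equiv.Perm J, ∑ a, c a ^ 2 :=
        Finset.sum_le_sum fun σ _ => sum_sum_ite_mul_le_of_biUnique (h_biUnique σ) c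
    _ = (Fintype.card J).factorial * ∑ a, c a ^ 2 := by
      rw [Finset.sum_const, Finset.card_univ, Fintype.card_perm, nsmul_eq_mul]

lemma integral_norm_sq_holomorphic_eq [DecidableEq J] [DecidableEq ι] (c : A → ℂ)
    (t : A → J → ι) :
    ((∫ Z, ‖∑ a, c a * ∏ j, Z (t a j)‖ ^ 2 ∂gaussianFamily ι : ℝ) : ℂ) =
      ∑ a, ∑ b, c a * conj (c b) *
        ((Finset.univ.filter fun σ : Equiv.Perm J => t a ∘ σ = t b).card : ℂ) := by
  have h_expand : ∀ Z : ι → ℂ, ((‖∑ a, c a * ∏ j, Z (t a j)‖ ^ 2 : ℝ) : ℂ) =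
      (∑ a, c a * ∏ j, Z (t a j)) * ∑ b, conj (c b) * conj (∏ j, Z (t b j)) := by
    intro Z
    rw [← Complex.normSq_eq_norm_sq, ← Complex.mul_conj, map_sum]
    simp_rw [map_mul]
  rw [← integral_complex_ofReal]
  simp_rw [h_expand]
  rw [HasMoments.integral_sum_mul_sum (fun a => hasMoments_monomial (t a))
    fun b => (hasMoments_monomial (t b)).star]
  simp_rw [integral_prod_mul_conj_prod]

lemma integral_norm_sq_holomorphic_le (c : A → ℂ) (ht : Function.Injective t) :
    ∫ Z, ‖∑ a, c a * ∏ j, Z (t a j)‖ ^ 2 ∂gaussianFamily ι ≤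
      (Fintype.card J).factorial * ∑ a, ‖c a‖ ^ 2 := by
  classical
  refine le_trans ?_ (sum_sum_mul_card_perm_le ht fun a => ‖c a‖)
  calc ∫ Z, ‖∑ a, c a * ∏ j, Z (t a j)‖ ^ 2 ∂gaussianFamily ι
      ≤ ‖((∫ Z, ‖∑ a, c a * ∏ j, Z (t a j)‖ ^ 2 ∂gaussianFamily ι : ℝ) : ℂ)‖ := by
        rw [Complex.norm_real]
        exact le_abs_self _
    _ ≤ ∑ a, ∑ b, ‖c a‖ * ‖c b‖ *
        ((Finset.univ.filter fun σ : Equiv.Perm J => t a ∘ σ = t b).card : ℝ) := by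
      rw [integral_norm_sq_holomorphic_eq]
      refine (norm_sum_le _ _).trans (Finset.sum_le_sum fun a _ =>
        (norm_sum_le _ _).trans (Finset.sum_le_sum fun b _ => le_of_eq ?_))
      simp only [norm_mul, RCLike.norm_conj, Complex.norm_natCast]

/-- The `m`-th power of a homogeneous holomorphic polynomial is again one, with squared coefficient
norm `(∑ ‖c a‖²)ᵐ`, so that the second-moment bound also controls the higher moments. -/
lemma integral_norm_pow_holomorphic_le (c : A → ℂ) (ht : Function.Injective t) (m : ℕ) :
    ∫ Z, ‖∑ a, c a * ∏ j, Z (t a j)‖ ^ (2 * m) ∂gaussianFamily ι ≤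
      (m * Fintype.card J).factorial * (∑ a, ‖c a‖ ^ 2) ^ m := by
  have h_injective : Function.Injective
      fun (p : Fin m → A) (ij : Fin m × J) => t (p ij.1) ij.2 := fun p q hpq =>
    funext fun i => ht (funext fun j => congrFun hpq (i, j))
  have h_power : ∀ Z : ι → ℂ,
      ∑ p : Fin m → A, (∏ i, c (p i)) * ∏ ij : Fin m × J, Z (t (p ij.1) ij.2) =
        (∑ a, c a * ∏ j, Z (t a j)) ^ m := by
    intro Z
    rw [Fintype.sum_pow]
    refine Finset.sum_congr rfl fun p _ => ?_
    rw [Finset.prod_mul_distrib, Fintype.prod_prod_type]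
  have h_coeff : ∑ p : Fin m → A, ‖∏ i, c (p i)‖ ^ 2 = (∑ a, ‖c a‖ ^ 2) ^ m := by
    rw [Fintype.sum_pow]
    refine Finset.sum_congr rfl fun p _ => ?_
    rw [norm_prod, Finset.prod_pow]
  have h_sq := integral_norm_sq_holomorphic_le (fun p : Fin m → A => ∏ i, c (p i)) h_injective
  simp only [h_power, h_coeff, norm_pow, Fintype.card_prod, Fintype.card_fin] at h_sq
  simpa only [mul_comm 2 m, pow_mul] using h_sq

end Holomorphic

/-! ### Rotating a pair of independent families -/

section Zip

variable {ι α : Type*} [MeasurableSpace α]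

/-- The identification of families of pairs with families indexed by `ι × Fin 2`. -/
def familyOfPairs (ι α : Type*) [MeasurableSpace α] : (ι → α × α) ≃ᵐ (ι × Fin 2 → α) :=
  (MeasurableEquiv.piCongrRight fun _ => MeasurableEquiv.finTwoArrow.symm).trans
    (MeasurableEquiv.curry ι (Fin 2) α).symm

lemma measurePreserving_finTwoArrow_symm_infinitePi (μ : Measure α) [IsProbabilityMeasure μ] :
    MeasurePreserving (MeasurableEquiv.finTwoArrow.symm : α × α → Fin 2 → α) (μ.prod μ)
      (Measure.infinitePi fun _ => μ) := by
  rw [Measure.infinitePi_eq_pi]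
  exact (measurePreserving_finTwoArrow μ).symm _

variable (μ : ι → Measure α) [∀ i, IsProbabilityMeasure (μ i)]

lemma measurePreserving_familyOfPairs :
    MeasurePreserving (familyOfPairs ι α) (Measure.infinitePi fun i => (μ i).prod (μ i))
      (Measure.infinitePi fun i => μ i.1) := by
  have h_pairs : MeasurePreserving
      (MeasurableEquiv.piCongrRight fun _ => MeasurableEquiv.finTwoArrow.symm :
        (ι → α × α) ≃ᵐ (ι → Fin 2 → α))
      (Measure.infinitePi fun i => (μ i).prod (μ i))
      (Measure.infinitePi fun i => Measure.infinitePi fun _ => μ i) := by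
    refine ⟨MeasurableEquiv.measurable _, ?_⟩
    rw [← funext fun i => (measurePreserving_finTwoArrow_symm_infinitePi (μ i)).map_eq]
    exact Measure.infinitePi_map_pi (fun i => (μ i).prod (μ i))
      (f := fun _ => (MeasurableEquiv.finTwoArrow.symm : α × α → Fin 2 → α))
      fun _ => MeasurableEquiv.measurable _
  exact MeasurePreserving.comp (g := (MeasurableEquiv.curry ι (Fin 2) α).symm)
    ⟨MeasurableEquiv.measurable _, Measure.infinitePi_map_curry_symm fun i _ => μ i⟩ h_pairs

lemma measurePreserving_zip_infinitePi :
    MeasurePreserving (fun (p : (ι → α) × (ι → α)) (i : ι) => (p.1 i, p.2 i))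
      ((Measure.infinitePi μ).prod (Measure.infinitePi μ))
      (Measure.infinitePi fun i => (μ i).prod (μ i)) := by
  have h_uncurry : MeasurePreserving (MeasurableEquiv.curry (Fin 2) ι α).symm
      (Measure.infinitePi fun _ => Measure.infinitePi μ)
      (Measure.infinitePi fun i : Fin 2 × ι => μ i.2) :=
    ⟨MeasurableEquiv.measurable _, Measure.infinitePi_map_curry_symm fun _ i => μ i⟩
  have h_swap : MeasurePreserving
      (MeasurableEquiv.piCongrLeft (fun _ : ι × Fin 2 => α) (Equiv.prodComm (Fin 2) ι))
      (Measure.infinitePi fun i : Fin 2 × ι => μ i.2)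
      (Measure.infinitePi fun i : ι × Fin 2 => μ i.1) :=
    ⟨MeasurableEquiv.measurable _,
      Measure.infinitePi_map_piCongrLeft (fun i : ι × Fin 2 => μ i.1) (Equiv.prodComm (Fin 2) ι)⟩
  exact ((measurePreserving_familyOfPairs μ).symm _).comp
    (h_swap.comp (h_uncurry.comp (measurePreserving_finTwoArrow_symm_infinitePi _)))

end Zip

/-- The family of the `(X + W) / √2` (second index `0`) and of the `conj (X - W) / √2` (second
index `1`). -/
def mixFamily {ι : Type*} (p : (ι → ℂ) × (ι → ℂ)) : ι × Fin 2 → ℂ :=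
  familyOfPairs ι ℂ fun i => mixPair (p.1 i, p.2 i)

lemma measurePreserving_mixFamily (ι : Type*) :
    MeasurePreserving (mixFamily : (ι → ℂ) × (ι → ℂ) → ι × Fin 2 → ℂ)
      ((gaussianFamily ι).prod (gaussianFamily ι)) (gaussianFamily (ι × Fin 2)) := by
  have h_mix : MeasurePreserving (fun (q : ι → ℂ × ℂ) i => mixPair (q i))
      (Measure.infinitePi fun _ => stdComplexGaussian.prod stdComplexGaussian)
      (Measure.infinitePi fun _ => stdComplexGaussian.prod stdComplexGaussian) := by
    refine ⟨measurable_pi_lambda _ fun i => measurable_mixPair.comp (measurable_pi_apply i), ?_⟩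
    rw [Measure.infinitePi_map_pi _ fun _ => measurable_mixPair]
    simp_rw [measurePreserving_mixPair.map_eq]
  exact (measurePreserving_familyOfPairs fun _ : ι => stdComplexGaussian).comp
    (h_mix.comp (measurePreserving_zip_infinitePi fun _ : ι => stdComplexGaussian))

lemma mixFamily_apply_zero {ι : Type*} (p : (ι → ℂ) × (ι → ℂ)) (i : ι) :
    mixFamily p (i, 0) = (√2 : ℂ)⁻¹ * (p.1 i + p.2 i) := rfl

lemma mixFamily_apply_one {ι : Type*} (p : (ι → ℂ) × (ι → ℂ)) (i : ι) :
    mixFamily p (i, 1) = (√2 : ℂ)⁻¹ * conj (p.1 i - p.2 i) := rfl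

/-! ### Wick monomials of degree four -/

/-- Quadruples of modes; the second and the fourth one index the conjugated factors of a Wick
monomial. -/
abbrev Quad (ι : Type*) : Type _ := (ι × ι) × (ι × ι)

section WickMonomial

variable {ι : Type*}

lemma integral_eval (a : ι) : ∫ W, W a ∂gaussianFamily ι = 0 := by
  simpa using integral_prod_mul_conj_prod_of_card_ne ![a] (![] : Fin 0 → ι) (by simp)

lemma integral_conj_eval (a : ι) : ∫ W, conj (W a) ∂gaussianFamily ι = 0 := by
  simpa using integral_prod_mul_conj_prod_of_card_ne (![] : Fin 0 → ι) ![a] (by simp)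

lemma integral_eval_mul_eval (a b : ι) : ∫ W, W a * W b ∂gaussianFamily ι = 0 := by
  simpa using integral_prod_mul_conj_prod_of_card_ne ![a, b] (![] : Fin 0 → ι) (by simp)

lemma integral_conj_eval_mul_conj_eval (a b : ι) :
    ∫ W, conj (W a) * conj (W b) ∂gaussianFamily ι = 0 := by
  simpa using integral_prod_mul_conj_prod_of_card_ne (![] : Fin 0 → ι) ![a, b] (by simp)

lemma integral_eval_mul_eval_mul_conj (a b c : ι) :
    ∫ W, W a * W b * conj (W c) ∂gaussianFamily ι = 0 := by
  simpa [Fin.prod_univ_succ] using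
    integral_prod_mul_conj_prod_of_card_ne ![a, b] ![c] (by simp)

lemma integral_eval_mul_conj_mul_conj (a b c : ι) :
    ∫ W, W a * (conj (W b) * conj (W c)) ∂gaussianFamily ι = 0 := by
  simpa [Fin.prod_univ_succ] using
    integral_prod_mul_conj_prod_of_card_ne ![a] ![b, c] (by simp)

section Moments

variable [DecidableEq ι]

/-- The Kronecker symbol, that is, the covariance `E[X_k conj X_l]` of the Gaussian family. -/
def kron (k l : ι) : ℂ := if k = l then 1 else 0

/-- The Wick monomial `:X_{k₁} conj X_{k₂} X_{k₃} conj X_{k₄}:` of a family of standard complex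
Gaussians, with its pairings written out: only a factor and a conjugated factor can be paired. -/
def wickMonomial (k : Quad ι) (X : ι → ℂ) : ℂ :=
  X k.1.1 * conj (X k.1.2) * (X k.2.1 * conj (X k.2.2))
    - kron k.1.1 k.1.2 * (X k.2.1 * conj (X k.2.2))
    - kron k.2.1 k.2.2 * (X k.1.1 * conj (X k.1.2))
    - kron k.1.1 k.2.2 * (X k.2.1 * conj (X k.1.2))
    - kron k.2.1 k.1.2 * (X k.1.1 * conj (X k.2.2))
    + kron k.1.1 k.1.2 * kron k.2.1 k.2.2 + kron k.1.1 k.2.2 * kron k.2.1 k.1.2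

lemma integral_eval_mul_conj_eval (a b : ι) :
    ∫ W, W a * conj (W b) ∂gaussianFamily ι = kron a b := by
  simpa [kron, funext_iff, apply_ite] using integral_prod_mul_conj_prod ![a] ![b]

lemma integral_quartic (a b c d : ι) :
    ∫ W, W a * W b * (conj (W c) * conj (W d)) ∂gaussianFamily ι =
      kron a c * kron b d + kron a d * kron b c := by
  have h_moment := integral_prod_mul_conj_prod ![a, b] ![c, d]
  have h_perms : (Finset.univ : Finset (Equiv.Perm (Fin 2))) = {1, Equiv.swap 0 1} := by decide
  have h_one : ![a, b] ∘ (1 : Equiv.Perm (Fin 2)) = ![c, d] ↔ a = c ∧ b = d := by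
    simp [funext_iff, Fin.forall_fin_two]
  have h_swap : ![a, b] ∘ (Equiv.swap 0 1 : Equiv.Perm (Fin 2)) = ![c, d] ↔ a = d ∧ b = c := by
    simp [funext_iff, Fin.forall_fin_two, and_comm]
  simp only [Fin.prod_univ_two, Matrix.cons_val_zero, Matrix.cons_val_one, map_mul] at h_moment
  rw [h_moment, Finset.card_filter, h_perms, Finset.sum_insert (by decide), Finset.sum_singleton]
  simp only [h_one, h_swap, kron, ite_and, ite_mul, one_mul, zero_mul]
  push_cast
  rfl

lemma hasMoments_wickMonomial (k : Quad ι) : HasMoments (wickMonomial k) (gaussianFamily ι) := by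
  have h_fst := hasMoments_eval k.1.1
  have h_snd := (hasMoments_eval k.1.2).star
  have h_thd := hasMoments_eval k.2.1
  have h_fth := (hasMoments_eval k.2.2).star
  have h_const := fun c => HasMoments.const (P := gaussianFamily ι) (𝕜 := ℂ) c
  exact ((((((h_fst.mul h_snd).mul (h_thd.mul h_fth)).sub ((h_const _).mul (h_thd.mul h_fth))).sub
    ((h_const _).mul (h_fst.mul h_snd))).sub ((h_const _).mul (h_thd.mul h_snd))).sub
    ((h_const _).mul (h_fst.mul h_fth))).add (h_const _) |>.add (h_const _)

end Moments

/-- The monomial in `X + W` and `conj (X - W)` of which the Wick monomial is the mean in `W`. The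
opposite signs of `W` produce the subtractions of Wick ordering. -/
def mixMonomial (k : Quad ι) (X W : ι → ℂ) : ℂ :=
  (X k.1.1 + W k.1.1) * conj (X k.1.2 - W k.1.2) *
    ((X k.2.1 + W k.2.1) * conj (X k.2.2 - W k.2.2))

lemma integral_mixMonomial [DecidableEq ι] (k : Quad ι) (X : ι → ℂ) :
    ∫ W, mixMonomial k X W ∂gaussianFamily ι = wickMonomial k X := by
  obtain ⟨⟨a, b⟩, c, d⟩ := k
  let F : Fin 4 → (ι → ℂ) → ℂ := ![fun _ => 1, fun W => W c, fun W => W a, fun W => W a * W c]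
  have hF : ∀ i, HasMoments (F i) (gaussianFamily ι) := Fin.forall_fin_succ.mpr
    ⟨HasMoments.const 1, Fin.forall_fin_succ.mpr ⟨hasMoments_eval c, Fin.forall_fin_two.mpr
      ⟨hasMoments_eval a, (hasMoments_eval a).mul (hasMoments_eval c)⟩⟩⟩
  let G : Fin 4 → (ι → ℂ) → ℂ := ![fun _ => 1, fun W => conj (W d), fun W => conj (W b),
    fun W => conj (W b) * conj (W d)]
  have hG : ∀ i, HasMoments (G i) (gaussianFamily ι) := Fin.forall_fin_succ.mpr
    ⟨HasMoments.const 1, Fin.forall_fin_succ.mpr ⟨(hasMoments_eval d).star, Fin.forall_fin_two.mpr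
      ⟨(hasMoments_eval b).star, (hasMoments_eval b).star.mul (hasMoments_eval d).star⟩⟩⟩
  have h_expand : ∀ W, mixMonomial ((a, b), c, d) X W =
      (∑ i, ![X a * X c, X a, X c, 1] i * F i W) *
        ∑ j, ![conj (X b) * conj (X d), -conj (X b), -conj (X d), 1] j * G j W := by
    intro W
    simp only [mixMonomial, map_sub, Fin.sum_univ_four, F, G, Matrix.cons_val]
    ring
  simp_rw [h_expand]
  rw [HasMoments.integral_sum_mul_sum hF hG]
  simp only [Fin.sum_univ_four, F, G, Matrix.cons_val, mul_one, one_mul, integral_eval,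
    integral_conj_eval, integral_eval_mul_eval, integral_conj_eval_mul_conj_eval,
    integral_eval_mul_conj_eval, integral_eval_mul_eval_mul_conj, integral_eval_mul_conj_mul_conj,
    integral_quartic, integral_const, probReal_univ, one_smul, wickMonomial]
  ring

lemma hasMoments_mixMonomial_right (k : Quad ι) (X : ι → ℂ) :
    HasMoments (mixMonomial k X) (gaussianFamily ι) := by
  have h_add : ∀ i, HasMoments (fun W => X i + W i) (gaussianFamily ι) := fun i =>
    (HasMoments.const _).add (hasMoments_eval i)
  have h_sub : ∀ i, HasMoments (fun W => conj (X i - W i)) (gaussianFamily ι) := fun i =>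
    ((HasMoments.const _).sub (hasMoments_eval i)).star
  exact ((h_add _).mul (h_sub _)).mul ((h_add _).mul (h_sub _))

/-- The indices, in the mixed family, of the four factors of `mixMonomial k`. -/
def quadIndex (k : Quad ι) : Fin 4 → ι × Fin 2 :=
  ![(k.1.1, 0), (k.1.2, 1), (k.2.1, 0), (k.2.2, 1)]

lemma quadIndex_injective : Function.Injective (quadIndex : Quad ι → Fin 4 → ι × Fin 2) :=
  fun _ _ h =>
    have h_fst : ∀ j, (quadIndex _ j).1 = (quadIndex _ j).1 := fun j => congrArg _ (congrFun h j)
    Prod.ext (Prod.ext (h_fst 0) (h_fst 1)) (Prod.ext (h_fst 2) (h_fst 3))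

lemma mixMonomial_eq (k : Quad ι) (p : (ι → ℂ) × (ι → ℂ)) :
    mixMonomial k p.1 p.2 = 4 * ∏ j, mixFamily p (quadIndex k j) := by
  have h_sqrt : (√2 : ℂ)⁻¹ ^ 2 = 2⁻¹ := by
    rw [inv_pow, ← Complex.ofReal_pow, Real.sq_sqrt zero_le_two, Complex.ofReal_ofNat]
  simp only [Fin.prod_univ_four, quadIndex, Matrix.cons_val, mixFamily_apply_zero,
    mixFamily_apply_one, mixMonomial]
  linear_combination (-(4 * ((√2 : ℂ)⁻¹ ^ 2 + 2⁻¹))) * ((p.1 k.1.1 + p.2 k.1.1) *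
    conj (p.1 k.1.2 - p.2 k.1.2) * ((p.1 k.2.1 + p.2 k.2.1) *
      conj (p.1 k.2.2 - p.2 k.2.2))) * h_sqrt

lemma hasMoments_mixMonomial (k : Quad ι) :
    HasMoments (fun p : (ι → ℂ) × (ι → ℂ) => mixMonomial k p.1 p.2)
      ((gaussianFamily ι).prod (gaussianFamily ι)) := by
  simp_rw [mixMonomial_eq]
  exact (HasMoments.const 4).mul ((hasMoments_monomial (quadIndex k)).comp_measurePreserving
    (measurePreserving_mixFamily ι))

lemma integral_norm_pow_mixMonomial_le (s : Finset (Quad ι)) (c : Quad ι → ℂ) (m : ℕ) :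
    ∫ p, ‖∑ k ∈ s, c k * mixMonomial k p.1 p.2‖ ^ (2 * m)
        ∂((gaussianFamily ι).prod (gaussianFamily ι)) ≤
      16 ^ m * (4 * m).factorial * (∑ k ∈ s, ‖c k‖ ^ 2) ^ m := by
  have h_mix := measurePreserving_mixFamily ι
  have h_holomorphic := integral_norm_pow_holomorphic_le (J := Fin 4) (A := s) (fun k => c k)
    (quadIndex_injective.comp Subtype.val_injective) m
  rw [← h_mix.map_eq, integral_map h_mix.measurable.aemeasurable
    (Measurable.aestronglyMeasurable (by fun_prop))] at h_holomorphic
  have h_scale : ∀ p : (ι → ℂ) × (ι → ℂ), ‖∑ k ∈ s, c k * mixMonomial k p.1 p.2‖ ^ (2 * m) =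
      16 ^ m * ‖∑ k : s, c k * ∏ j, mixFamily p (quadIndex k j)‖ ^ (2 * m) := by
    intro p
    rw [Finset.sum_coe_sort s (fun k => c k * ∏ j, mixFamily p (quadIndex k j))]
    simp_rw [mixMonomial_eq, mul_left_comm (c _)]
    rw [← Finset.mul_sum, norm_mul, mul_pow, pow_mul ‖(4 : ℂ)‖]
    norm_num
  simp_rw [h_scale]
  rw [integral_const_mul, mul_assoc]
  refine mul_le_mul_of_nonneg_left (h_holomorphic.trans_eq ?_) (by positivity)
  rw [Finset.sum_coe_sort s (fun k => ‖c k‖ ^ 2), Fintype.card_fin, mul_comm m 4]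

lemma norm_integral_pow_le {Ω E : Type*} [MeasurableSpace Ω] {P : Measure Ω}
    [IsProbabilityMeasure P] [NormedAddCommGroup E] [NormedSpace ℝ E] {f : Ω → E}
    (hf : Integrable f P) (n : ℕ) (hn : Integrable (fun x => ‖f x‖ ^ n) P) :
    ‖∫ x, f x ∂P‖ ^ n ≤ ∫ x, ‖f x‖ ^ n ∂P :=
  calc ‖∫ x, f x ∂P‖ ^ n ≤ (∫ x, ‖f x‖ ∂P) ^ n := by
        gcongr
        exact norm_integral_le_integral_norm _
    _ ≤ ∫ x, ‖f x‖ ^ n ∂P :=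
        (convexOn_pow (𝕜 := ℝ) n).map_integral_le (continuous_pow _).continuousOn isClosed_Ici
          (ae_of_all _ fun x => norm_nonneg _) hf.norm hn

variable [DecidableEq ι]

lemma norm_sum_wickMonomial_pow_le (s : Finset (Quad ι)) (c : Quad ι → ℂ) (n : ℕ) (X : ι → ℂ) :
    ‖∑ k ∈ s, c k * wickMonomial k X‖ ^ n ≤
      ∫ W, ‖∑ k ∈ s, c k * mixMonomial k X W‖ ^ n ∂gaussianFamily ι := by
  have h_moments : ∀ k, HasMoments (fun W => c k * mixMonomial k X W) (gaussianFamily ι) :=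
    fun k => (HasMoments.const _).mul (hasMoments_mixMonomial_right k X)
  have h_mean : ∑ k ∈ s, c k * wickMonomial k X =
      ∫ W, ∑ k ∈ s, c k * mixMonomial k X W ∂gaussianFamily ι := by
    rw [integral_finsetSum _ fun k _ => (h_moments k).integrable]
    simp_rw [integral_const_mul, integral_mixMonomial]
  rw [h_mean]
  exact norm_integral_pow_le (HasMoments.finsetSum s h_moments).integrable n
    ((HasMoments.finsetSum s h_moments).integrable_norm_pow n)

lemma hasMoments_sum_wickMonomial (s : Finset (Quad ι)) (c : Quad ι → ℂ) :
    HasMoments (fun X => ∑ k ∈ s, c k * wickMonomial k X) (gaussianFamily ι) :=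
  HasMoments.finsetSum s fun k => (HasMoments.const _).mul (hasMoments_wickMonomial k)

/-- By Jensen, averaging over `W` does not increase the moments of the mixed polynomial, which is
holomorphic in another family of independent standard Gaussians. -/
lemma integral_norm_pow_wickMonomial_le (s : Finset (Quad ι)) (c : Quad ι → ℂ) (m : ℕ) :
    ∫ X, ‖∑ k ∈ s, c k * wickMonomial k X‖ ^ (2 * m) ∂gaussianFamily ι ≤
      16 ^ m * (4 * m).factorial * (∑ k ∈ s, ‖c k‖ ^ 2) ^ m := by
  have h_integrable : Integrable (fun p : (ι → ℂ) × (ι → ℂ) =>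
      ‖∑ k ∈ s, c k * mixMonomial k p.1 p.2‖ ^ (2 * m))
      ((gaussianFamily ι).prod (gaussianFamily ι)) :=
    HasMoments.integrable_norm_pow (HasMoments.finsetSum s fun k =>
      (HasMoments.const _).mul (hasMoments_mixMonomial k)) (2 * m)
  refine le_trans ?_ (integral_norm_pow_mixMonomial_le s c m)
  rw [integral_prod _ h_integrable]
  exact integral_mono ((hasMoments_sum_wickMonomial s c).integrable_norm_pow (2 * m))
    h_integrable.integral_prod_left fun X => norm_sum_wickMonomial_pow_le s c (2 * m) X

end WickMonomial

/-! ### Square summable series of Wick monomials -/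

lemma norm_sq_Lp_two {Ω E : Type*} [MeasurableSpace Ω] {P : Measure Ω} [NormedAddCommGroup E]
    (f : Lp E 2 P) : ‖f‖ ^ 2 = ∫ x, ‖f x‖ ^ 2 ∂P := by
  have h_nonneg : 0 ≤ ∫ x, ‖f x‖ ^ 2 ∂P := integral_nonneg fun x => by positivity
  rw [Lp.norm_def, (Lp.memLp f).eLpNorm_eq_integral_rpow_norm two_ne_zero ENNReal.ofNat_ne_top]
  simp only [ENNReal.toReal_ofNat, Real.rpow_two]
  rw [ENNReal.toReal_ofReal (by positivity), ← one_div, ← Real.sqrt_eq_rpow, Real.sq_sqrt h_nonneg]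

lemma summable_norm_sq_sub {A E : Type*} [SeminormedAddCommGroup E] {c c' : A → E}
    (hc : Summable fun k => ‖c k‖ ^ 2) (hc' : Summable fun k => ‖c' k‖ ^ 2) :
    Summable fun k => ‖c k - c' k‖ ^ 2 := by
  refine Summable.of_nonneg_of_le (fun k => by positivity) (fun k => ?_)
    ((hc.mul_left 2).add (hc'.mul_left 2))
  calc ‖c k - c' k‖ ^ 2 ≤ (‖c k‖ + ‖c' k‖) ^ 2 := by
        gcongr
        exact norm_sub_le _ _
    _ ≤ 2 * ‖c k‖ ^ 2 + 2 * ‖c' k‖ ^ 2 := by linarith [add_sq_le (a := ‖c k‖) (b := ‖c' k‖)]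

section WickSeries

variable {ι : Type*} [DecidableEq ι]

/-- The Wick monomial as an element of `L²`. -/
def wickLp (k : Quad ι) : Lp ℂ 2 (gaussianFamily ι) :=
  (hasMoments_wickMonomial k 2 ENNReal.ofNat_ne_top).toLp _

/-- The series `∑ₖ c k :X_{k₁} conj X_{k₂} X_{k₃} conj X_{k₄}:` in `L²`; it converges for square
summable coefficients. -/
def wickSeries (c : Quad ι → ℂ) : Lp ℂ 2 (gaussianFamily ι) := ∑' k, c k • wickLp k

lemma coeFn_smul_wickLp (c : ℂ) (k : Quad ι) :
    ⇑(c • wickLp k) =ᵐ[gaussianFamily ι] fun X => c * wickMonomial k X := by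
  filter_upwards [Lp.coeFn_smul c (wickLp k),
    (hasMoments_wickMonomial k 2 ENNReal.ofNat_ne_top).coeFn_toLp] with X h_smul h_toLp
  rw [h_smul, Pi.smul_apply, wickLp, h_toLp, smul_eq_mul]

lemma coeFn_sum_wickLp (s : Finset (Quad ι)) (c : Quad ι → ℂ) :
    ⇑(∑ k ∈ s, c k • wickLp k) =ᵐ[gaussianFamily ι] fun X => ∑ k ∈ s, c k * wickMonomial k X := by
  have h_terms : ∀ᵐ X ∂gaussianFamily ι, ∀ k ∈ s, (c k • wickLp k) X = c k * wickMonomial k X :=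
    (Finset.eventually_all s).mpr fun k _ => coeFn_smul_wickLp (c k) k
  filter_upwards [Lp.coeFn_finsetSum s (fun k => c k • wickLp k), h_terms] with X h_sum h_terms
  rw [h_sum, Finset.sum_apply]
  exact Finset.sum_congr rfl h_terms

lemma norm_sq_sum_wickLp_le (s : Finset (Quad ι)) (c : Quad ι → ℂ) :
    ‖∑ k ∈ s, c k • wickLp k‖ ^ 2 ≤ 384 * ∑ k ∈ s, ‖c k‖ ^ 2 := by
  have h_ae : (fun X => ‖(∑ k ∈ s, c k • wickLp k) X‖ ^ 2) =ᵐ[gaussianFamily ι]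
      fun X => ‖∑ k ∈ s, c k * wickMonomial k X‖ ^ 2 :=
    (coeFn_sum_wickLp s c).mono fun X hX => by simp only [hX]
  rw [norm_sq_Lp_two, integral_congr_ae h_ae]
  exact (integral_norm_pow_wickMonomial_le s c 1).trans_eq (by norm_num [Nat.factorial])

lemma summable_wickLp {c : Quad ι → ℂ} (hc : Summable fun k => ‖c k‖ ^ 2) :
    Summable fun k => c k • wickLp k := by
  rw [summable_iff_vanishing_norm] at hc ⊢
  intro ε hε
  obtain ⟨s, hs⟩ := hc (ε ^ 2 / 384) (by positivity)
  refine ⟨s, fun t ht => lt_of_pow_lt_pow_left₀ 2 hε.le ?_⟩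
  have h_tail := hs t ht
  rw [Real.norm_of_nonneg (by positivity), lt_div_iff₀' (by norm_num)] at h_tail
  exact (norm_sq_sum_wickLp_le t c).trans_lt h_tail

lemma norm_sq_wickSeries_le {c : Quad ι → ℂ} (hc : Summable fun k => ‖c k‖ ^ 2) :
    ‖wickSeries c‖ ^ 2 ≤ 384 * ∑' k, ‖c k‖ ^ 2 := by
  have h_norm : Tendsto (fun s => ‖∑ k ∈ s, c k • wickLp k‖ ^ 2) atTop (𝓝 (‖wickSeries c‖ ^ 2)) :=
    ((continuous_norm.tendsto _).comp (summable_wickLp hc).hasSum).pow 2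
  refine le_of_tendsto h_norm (Eventually.of_forall fun s => (norm_sq_sum_wickLp_le s c).trans ?_)
  gcongr
  exact hc.sum_le_tsum s fun k _ => by positivity

lemma wickSeries_sub {c c' : Quad ι → ℂ} (hc : Summable fun k => ‖c k‖ ^ 2)
    (hc' : Summable fun k => ‖c' k‖ ^ 2) :
    wickSeries (fun k => c k - c' k) = wickSeries c - wickSeries c' := by
  simp_rw [wickSeries, sub_smul]
  exact (summable_wickLp hc).tsum_sub (summable_wickLp hc')

lemma lintegral_norm_pow_wickMonomial_le {c : Quad ι → ℂ} (hc : Summable fun k => ‖c k‖ ^ 2)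
    (s : Finset (Quad ι)) (m : ℕ) :
    ∫⁻ X, ‖∑ k ∈ s, c k * wickMonomial k X‖ₑ ^ (2 * m) ∂gaussianFamily ι ≤
      ENNReal.ofReal (16 ^ m * (4 * m).factorial * (∑' k, ‖c k‖ ^ 2) ^ m) := by
  simp_rw [← ofReal_norm, ← ENNReal.ofReal_pow (norm_nonneg _)]
  rw [← ofReal_integral_eq_lintegral_ofReal
    ((hasMoments_sum_wickMonomial s c).integrable_norm_pow _) (ae_of_all _ fun X => by positivity)]
  refine ENNReal.ofReal_le_ofReal ((integral_norm_pow_wickMonomial_le s c m).trans ?_)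
  gcongr
  exact hc.sum_le_tsum _ fun k _ => by positivity

variable [Countable ι]

lemma exists_seq_tendsto_wickSeries {c : Quad ι → ℂ} (hc : Summable fun k => ‖c k‖ ^ 2) :
    ∃ s : ℕ → Finset (Quad ι), Tendsto s atTop atTop ∧ ∀ᵐ X ∂gaussianFamily ι,
      Tendsto (fun n => ∑ k ∈ s n, c k * wickMonomial k X) atTop (𝓝 (wickSeries c X)) := by
  obtain ⟨s, hs, h_lim⟩ :=
    (tendstoInMeasure_of_tendsto_Lp (summable_wickLp hc).hasSum).exists_seq_tendsto_ae'
  refine ⟨s, hs, ?_⟩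
  filter_upwards [h_lim, ae_all_iff.mpr fun n => coeFn_sum_wickLp (s n) c] with X hX h_sum
  exact hX.congr h_sum

lemma wickSeries_ae_eq_of_hasSum {c : Quad ι → ℂ} (hc : Summable fun k => ‖c k‖ ^ 2)
    {g : (ι → ℂ) → ℂ}
    (hg : ∀ᵐ X ∂gaussianFamily ι, HasSum (fun k => c k * wickMonomial k X) (g X)) :
    wickSeries c =ᵐ[gaussianFamily ι] g := by
  obtain ⟨s, hs, h_lim⟩ := exists_seq_tendsto_wickSeries hc
  filter_upwards [h_lim, hg] with X hX hgX
  exact tendsto_nhds_unique hX (hgX.comp hs)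

lemma lintegral_norm_pow_wickSeries_le {c : Quad ι → ℂ} (hc : Summable fun k => ‖c k‖ ^ 2)
    (m : ℕ) :
    ∫⁻ X, ‖wickSeries c X‖ₑ ^ (2 * m) ∂gaussianFamily ι ≤
      ENNReal.ofReal (16 ^ m * (4 * m).factorial * (∑' k, ‖c k‖ ^ 2) ^ m) := by
  obtain ⟨s, -, h_lim⟩ := exists_seq_tendsto_wickSeries hc
  calc ∫⁻ X, ‖wickSeries c X‖ₑ ^ (2 * m) ∂gaussianFamily ι
      = ∫⁻ X, liminf (fun n => ‖∑ k ∈ s n, c k * wickMonomial k X‖ₑ ^ (2 * m)) atTop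
          ∂gaussianFamily ι := by
        refine lintegral_congr_ae (h_lim.mono fun X hX => ?_)
        exact (((ENNReal.continuous_pow (2 * m)).tendsto _).comp hX.enorm).liminf_eq.symm
    _ ≤ liminf (fun n => ∫⁻ X, ‖∑ k ∈ s n, c k * wickMonomial k X‖ₑ ^ (2 * m)
          ∂gaussianFamily ι) atTop :=
        lintegral_liminf_le' fun n =>
          ((hasMoments_sum_wickMonomial (s n) c).integrable.1.enorm).pow_const _
    _ ≤ _ := by
      refine liminf_le_of_le ⟨0, by simp⟩ fun b hb => ?_
      obtain ⟨n, hn⟩ := hb.exists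
      exact hn.trans (lintegral_norm_pow_wickMonomial_le hc (s n) m)

lemma measure_one_le_norm_wickSeries_le {c : Quad ι → ℂ} (hc : Summable fun k => ‖c k‖ ^ 2)
    (m : ℕ) : (gaussianFamily ι).real {X | 1 ≤ ‖wickSeries c X‖} ≤
      16 ^ m * (4 * m).factorial * (∑' k, ‖c k‖ ^ 2) ^ m := by
  refine ENNReal.toReal_le_of_le_ofReal (by positivity)
    (le_trans ?_ (lintegral_norm_pow_wickSeries_le hc m))
  have h_markov := mul_meas_ge_le_lintegral₀ (μ := gaussianFamily ι)
    (f := fun X => ‖wickSeries c X‖ₑ ^ (2 * m))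
    ((Lp.aestronglyMeasurable _).enorm.pow_const _) 1
  rw [one_mul] at h_markov
  refine le_trans (measure_mono fun X (hX : 1 ≤ ‖wickSeries c X‖) => ?_) h_markov
  rw [← ENNReal.one_le_ofReal, ofReal_norm] at hX
  exact one_le_pow₀ hX

end WickSeries

/-! ### Integrals of series -/

section IntegralSeries

variable {α A E 𝕜 : Type*} [MeasurableSpace α] {μ : Measure α} [NormedAddCommGroup E] [RCLike 𝕜]

lemma summable_integral_norm_const_mul {h : α → 𝕜} (hh : Integrable h μ) {C : A → 𝕜}
    (hC : Summable fun i => ‖C i‖) {g : A → α → 𝕜} (hg : ∀ i, AEStronglyMeasurable (g i) μ)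
    (hg_le : ∀ i a, ‖g i a‖ ≤ 1) : Summable fun i => ∫ a, ‖C i * (h a * g i a)‖ ∂μ := by
  refine Summable.of_nonneg_of_le (fun i => integral_nonneg fun a => norm_nonneg _) (fun i => ?_)
    (hC.mul_right (∫ a, ‖h a‖ ∂μ))
  simp_rw [norm_mul, integral_const_mul]
  refine mul_le_mul_of_nonneg_left (integral_mono ?_ hh.norm fun a => ?_) (norm_nonneg _)
  · simpa only [norm_mul] using (hh.mul_bdd (hg i) (ae_of_all _ (hg_le i))).norm
  · exact mul_le_of_le_one_right (norm_nonneg _) (hg_le i a)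

variable [Countable A]

lemma lintegral_tsum_enorm_ne_top {F : A → α → E} (hF : ∀ i, Integrable (F i) μ)
    (hs : Summable fun i => ∫ a, ‖F i a‖ ∂μ) : ∫⁻ a, ∑' i, ‖F i a‖ₑ ∂μ ≠ ⊤ := by
  rw [lintegral_tsum fun i => (hF i).1.enorm]
  simp_rw [← fun i => ofReal_integral_norm_eq_lintegral_enorm (hF i)]
  exact hs.tsum_ofReal_ne_top

lemma ae_summable_norm_of_summable_integral {F : A → α → E} (hF : ∀ i, Integrable (F i) μ)
    (hs : Summable fun i => ∫ a, ‖F i a‖ ∂μ) : ∀ᵐ a ∂μ, Summable fun i => ‖F i a‖ := by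
  filter_upwards [ae_lt_top' (AEMeasurable.tsum fun i => (hF i).1.enorm)
    (lintegral_tsum_enorm_ne_top hF hs)] with a ha
  exact Summable.of_enorm (by simpa only [enorm_norm] using ha.ne)

lemma integrable_tsum_of_summable_integral [CompleteSpace E] {F : A → α → E}
    (hF : ∀ i, Integrable (F i) μ) (hs : Summable fun i => ∫ a, ‖F i a‖ ∂μ) :
    Integrable (fun a => ∑' i, F i a) μ := by
  obtain ⟨s, hs'⟩ := exists_seq_tendsto (atTop : Filter (Finset A))
  refine ⟨aestronglyMeasurable_of_tendsto_ae (atTop : Filter ℕ)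
    (f := fun n a => ∑ i ∈ s n, F i a)
    (fun n => (integrable_finsetSum _ fun i _ => hF i).1) ?_, ?_⟩
  · filter_upwards [ae_summable_norm_of_summable_integral hF hs] with a ha
    exact ha.of_norm.hasSum.comp hs'
  · exact (lintegral_mono fun a => enorm_tsum_le_tsum_enorm).trans_lt
      (lintegral_tsum_enorm_ne_top hF hs).lt_top

lemma integrable_mul_tsum {h : α → 𝕜} (hh : Integrable h μ) {C : A → 𝕜}
    (hC : Summable fun i => ‖C i‖) {g : A → α → 𝕜} (hg : ∀ i, AEStronglyMeasurable (g i) μ)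
    (hg_le : ∀ i a, ‖g i a‖ ≤ 1) : Integrable (fun a => h a * ∑' i, C i * g i a) μ := by
  simp_rw [← tsum_mul_left, mul_left_comm (h _)]
  exact integrable_tsum_of_summable_integral
    (fun i => (hh.mul_bdd (hg i) (ae_of_all _ (hg_le i))).const_mul _)
    (summable_integral_norm_const_mul hh hC hg hg_le)

lemma integral_mul_tsum {h : α → 𝕜} (hh : Integrable h μ) {C : A → 𝕜}
    (hC : Summable fun i => ‖C i‖) {g : A → α → 𝕜} (hg : ∀ i, AEStronglyMeasurable (g i) μ)
    (hg_le : ∀ i a, ‖g i a‖ ≤ 1) :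
    ∫ a, h a * ∑' i, C i * g i a ∂μ = ∑' i, C i * ∫ a, h a * g i a ∂μ := by
  simp_rw [← tsum_mul_left, mul_left_comm (h _), ← integral_const_mul]
  exact (integral_tsum_of_summable_integral_norm
    (fun i => (hh.mul_bdd (hg i) (ae_of_all _ (hg_le i))).const_mul _)
    (summable_integral_norm_const_mul hh hC hg hg_le)).symm

end IntegralSeries

/-! ### Fourier analysis on the torus -/

lemma toPlane_zero : toPlane 0 = 0 := by
  ext i
  simp [toPlane]

lemma toPlane_neg (k : Lattice) : toPlane (-k) = -toPlane k := by
  ext i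
  simp [toPlane]

lemma eigenfunction_eq (k : Lattice) (x : Plane) :
    eigenfunction k x = Complex.exp (2 * Real.pi * Complex.I * (k 0 * x 0 + k 1 * x 1)) := by
  unfold eigenfunction
  congr 2
  simp [toPlane, PiLp.inner_apply, Fin.sum_univ_two, mul_comm]

lemma eigenfunction_zero (x : Plane) : eigenfunction 0 x = 1 := by
  simp [eigenfunction_eq]

lemma eigenfunction_add_left (k l : Lattice) (x : Plane) :
    eigenfunction (k + l) x = eigenfunction k x * eigenfunction l x := by
  simp only [eigenfunction_eq, ← Complex.exp_add, Pi.add_apply, Int.cast_add]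
  ring_nf

lemma conj_eigenfunction (k : Lattice) (x : Plane) :
    conj (eigenfunction k x) = eigenfunction (-k) x := by
  rw [eigenfunction_eq, eigenfunction_eq, ← Complex.exp_conj]
  congr 1
  simp only [map_mul, map_add, map_ofNat, Complex.conj_ofReal, Complex.conj_I, map_intCast,
    Pi.neg_apply, Int.cast_neg]
  ring

lemma eigenfunction_sub_left (k l : Lattice) (x : Plane) :
    eigenfunction (k - l) x = eigenfunction k x * conj (eigenfunction l x) := by
  rw [sub_eq_add_neg, eigenfunction_add_left, conj_eigenfunction]

lemma eigenfunction_add_right (k : Lattice) (x y : Plane) :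
    eigenfunction k (x + y) = eigenfunction k x * eigenfunction k y := by
  simp only [eigenfunction_eq, ← Complex.exp_add, PiLp.add_apply, Complex.ofReal_add]
  ring_nf

lemma eigenfunction_toPlane (k n : Lattice) : eigenfunction k (toPlane n) = 1 := by
  rw [eigenfunction_eq, Complex.exp_eq_one_iff]
  refine ⟨k 0 * n 0 + k 1 * n 1, ?_⟩
  simp only [toPlane, Complex.ofReal_intCast, Int.cast_add, Int.cast_mul]
  ring

lemma norm_eigenfunction (k : Lattice) (x : Plane) : ‖eigenfunction k x‖ = 1 := by
  simp [eigenfunction_eq, Complex.norm_exp]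

lemma continuous_eigenfunction (k : Lattice) : Continuous (eigenfunction k) := by
  unfold eigenfunction
  fun_prop

lemma toLp_preimage_torus : (WithLp.toLp 2 ⁻¹' torus : Set (Fin 2 → ℝ)) =
    Set.univ.pi fun _ => Set.Ico (-(1 / 2) : ℝ) (1 / 2) := by
  ext x
  simp [torus, Set.mem_pi]

lemma measurableSet_torus : MeasurableSet torus := by
  rw [← (MeasurableEquiv.toLp 2 (Fin 2 → ℝ)).measurableSet_preimage]
  exact toLp_preimage_torus ▸ MeasurableSet.univ_pi fun _ => measurableSet_Ico

lemma volume_torus : volume torus = 1 := by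
  rw [← (PiLp.volume_preserving_toLp (Fin 2)).measure_preimage
    measurableSet_torus.nullMeasurableSet, toLp_preimage_torus, Real.volume_pi_Ico]
  norm_num

instance : IsProbabilityMeasure (volume.restrict torus) :=
  ⟨by rw [Measure.restrict_apply_univ, volume_torus]⟩

lemma integral_torus_prod {𝕜 : Type*} [RCLike 𝕜] (f : Fin 2 → ℝ → 𝕜) :
    ∫ x in torus, ∏ i, f i (x i) = ∏ i, ∫ t in Set.Ico (-(1 / 2) : ℝ) (1 / 2), f i t := by
  rw [← (PiLp.volume_preserving_toLp (Fin 2)).setIntegral_preimage_emb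
    (MeasurableEquiv.toLp 2 (Fin 2 → ℝ)).measurableEmbedding
    (fun x : Plane => ∏ i, f i (x i)) torus, toLp_preimage_torus, volume_pi,
    Measure.restrict_pi_pi]
  exact integral_fintype_prod_eq_prod (μ := fun _ : Fin 2 =>
    volume.restrict (Set.Ico (-(1 / 2) : ℝ) (1 / 2))) f

lemma integral_exp_unit_interval (n : ℤ) :
    ∫ t in Set.Ico (-(1 / 2) : ℝ) (1 / 2), Complex.exp (2 * Real.pi * Complex.I * n * t) =
      if n = 0 then 1 else 0 := by
  rw [integral_Ico_eq_integral_Ioc, ← intervalIntegral.integral_of_le (by norm_num)]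
  split_ifs with hn
  · norm_num [hn]
  · have h_ne : (2 * Real.pi * Complex.I * n : ℂ) ≠ 0 :=
      mul_ne_zero Complex.two_pi_I_ne_zero (Int.cast_ne_zero.mpr hn)
    have h_periodic : Complex.exp (2 * Real.pi * Complex.I * n * ((1 / 2 : ℝ) : ℂ)) =
        Complex.exp (2 * Real.pi * Complex.I * n * ((-(1 / 2) : ℝ) : ℂ)) := by
      refine Complex.exp_eq_exp_iff_exists_int.mpr ⟨n, ?_⟩
      push_cast
      ring
    rw [integral_exp_mul_complex h_ne, h_periodic, sub_self, zero_div]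

lemma integral_torus_eigenfunction (k : Lattice) :
    ∫ x in torus, eigenfunction k x = if k = 0 then 1 else 0 := by
  have h_prod (x : Plane) : eigenfunction k x =
      ∏ i, Complex.exp (2 * Real.pi * Complex.I * k i * x i) := by
    rw [eigenfunction_eq, ← Complex.exp_sum, Fin.sum_univ_two]
    ring_nf
  simp_rw [h_prod]
  rw [integral_torus_prod fun i t => Complex.exp (2 * Real.pi * Complex.I * k i * t)]
  simp_rw [integral_exp_unit_interval]
  rcases eq_or_ne k 0 with rfl | hk
  · simp
  · obtain ⟨i, hi⟩ := Function.ne_iff.mp hk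
    rw [if_neg hk]
    exact Finset.prod_eq_zero (Finset.mem_univ i) (if_neg hi)

/-! ### Unfolding -/

/-- The translate of the fundamental domain by `n`; these sets tile the plane, which turns a
periodization integrated over the torus into an integral over the plane. It is written as a
preimage so that the change of variables applies directly. -/
def torusTranslate (n : Lattice) : Set Plane := (fun x => x + toPlane (-n)) ⁻¹' torus

lemma measurableSet_torusTranslate (n : Lattice) : MeasurableSet (torusTranslate n) :=
  measurable_add_const (toPlane (-n)) measurableSet_torus

lemma mem_torusTranslate {n : Lattice} {x : Plane} :
    x ∈ torusTranslate n ↔ ∀ i, n i = ⌊x i + 1 / 2⌋ := by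
  refine forall_congr' fun i => ?_
  rw [eq_comm, Int.floor_eq_iff]
  simp only [toPlane, PiLp.add_apply, Pi.neg_apply, Int.cast_neg, Set.mem_Ico]
  constructor <;> rintro ⟨h_le, h_lt⟩ <;> constructor <;> linarith

lemma iUnion_torusTranslate : ⋃ n, torusTranslate n = Set.univ :=
  Set.eq_univ_of_forall fun x =>
    Set.mem_iUnion.mpr ⟨fun i => ⌊x i + 1 / 2⌋, mem_torusTranslate.mpr fun _ => rfl⟩

lemma pairwise_disjoint_torusTranslate : Pairwise (Function.onFun Disjoint torusTranslate) :=
  fun _ _ hnm => Set.disjoint_left.mpr fun _ hn hm => hnm <| funext fun i =>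
    (mem_torusTranslate.mp hn i).trans (mem_torusTranslate.mp hm i).symm

section Unfolding

variable {E : Type*} [NormedAddCommGroup E]

lemma integrableOn_comp_add_toPlane {F : Plane → E} (hF : Integrable F) (n : Lattice) :
    IntegrableOn (fun y => F (y + toPlane n)) torus :=
  (hF.comp_add_right _).integrableOn

lemma setIntegral_torusTranslate [NormedSpace ℝ E] (F : Plane → E) (n : Lattice) :
    ∫ y in torusTranslate n, F y = ∫ y in torus, F (y + toPlane n) := by
  rw [← (measurePreserving_add_right volume (toPlane (-n))).setIntegral_preimage_emb
    (measurableEmbedding_addRight _) (fun y => F (y + toPlane n)) torus]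
  simp [toPlane_neg, torusTranslate]

lemma hasSum_integral_torus [NormedSpace ℝ E] {F : Plane → E} (hF : Integrable F) :
    HasSum (fun n => ∫ y in torus, F (y + toPlane n)) (∫ y, F y) := by
  have h_sum := hasSum_integral_iUnion measurableSet_torusTranslate
    pairwise_disjoint_torusTranslate hF.integrableOn
  simpa only [iUnion_torusTranslate, setIntegral_univ, setIntegral_torusTranslate] using h_sum

lemma integrableOn_torus_tsum [CompleteSpace E] {F : Plane → E} (hF : Integrable F) :
    IntegrableOn (fun y => ∑' n, F (y + toPlane n)) torus :=
  integrable_tsum_of_summable_integral (integrableOn_comp_add_toPlane hF)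
    (hasSum_integral_torus hF.norm).summable

lemma integral_torus_tsum [NormedSpace ℝ E] {F : Plane → E} (hF : Integrable F) :
    ∫ y in torus, ∑' n, F (y + toPlane n) = ∫ y, F y := by
  rw [← integral_tsum_of_summable_integral_norm (integrableOn_comp_add_toPlane hF)
    (hasSum_integral_torus hF.norm).summable]
  exact (hasSum_integral_torus hF).tsum_eq

end Unfolding

/-! ### The rescaled potential -/

/-- The integrable functions of positive type, that is with nonnegative Fourier transform: the
class of two-body potentials for which the estimates below hold. -/
structure IsPositiveType (v : Plane → ℝ) : Prop where
  integrable : Integrable v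
  fourier_nonneg : ∀ ξ, ∃ r : ℝ, 0 ≤ r ∧ 𝓕 (fun x => (v x : ℂ)) ξ = (r : ℂ)

lemma IsPotential.isPositiveType {v : Plane → ℝ} (hv : IsPotential v) : IsPositiveType v where
  integrable := hv.smooth.continuous.integrable_of_hasCompactSupport hv.compactSupport
  fourier_nonneg := hv.positiveType

section Rescaled

variable {v : Plane → ℝ} {ε : ℝ}

lemma integrable_rescale_mul_eigenfunction (hv : Integrable v) (hε : 0 < ε) (x : Plane)
    (k : Lattice) : Integrable fun y : Plane =>
      (((ε ^ 2)⁻¹ * v (ε⁻¹ • (x - y)) : ℝ) : ℂ) * eigenfunction k y := by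
  have h_scaled : Integrable fun y : Plane => v (ε⁻¹ • y) :=
    (integrable_comp_smul_iff volume v (inv_ne_zero hε.ne')).mpr hv
  exact (((h_scaled.comp_sub_left x).const_mul _).ofReal (𝕜 := ℂ)).mul_bdd (c := 1)
    (continuous_eigenfunction k).aestronglyMeasurable
    (ae_of_all _ fun y => (norm_eigenfunction k y).le)

lemma rescaled_sub_mul_eigenfunction (v : Plane → ℝ) (ε : ℝ) (x y : Plane) (k : Lattice) :
    (rescaled v ε (x - y) : ℂ) * eigenfunction k y =
      ∑' n, (((ε ^ 2)⁻¹ * v (ε⁻¹ • (x - (y + toPlane n))) : ℝ) : ℂ) *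
        eigenfunction k (y + toPlane n) := by
  simp_rw [eigenfunction_add_right, eigenfunction_toPlane, mul_one]
  rw [tsum_mul_right, rescaled, Complex.ofReal_tsum]
  simp_rw [sub_sub]

lemma integrableOn_rescaled (hv : Integrable v) (hε : 0 < ε) (x : Plane) :
    IntegrableOn (fun y => (rescaled v ε (x - y) : ℂ)) torus := by
  refine (integrableOn_torus_tsum (integrable_rescale_mul_eigenfunction hv hε x 0)).congr
    (ae_of_all _ fun y => ?_)
  beta_reduce
  rw [← rescaled_sub_mul_eigenfunction, eigenfunction_zero, mul_one]

lemma eigenfunction_sub_smul (k : Lattice) (ε : ℝ) (x w : Plane) :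
    eigenfunction k (x - ε • w) = eigenfunction k x *
      Complex.exp (((-2 * Real.pi * inner ℝ w (ε • toPlane k) : ℝ) : ℂ) * Complex.I) := by
  rw [sub_eq_add_neg, eigenfunction_add_right]
  congr 1
  rw [eigenfunction, inner_neg_right, inner_smul_right, inner_smul_right, real_inner_comm]
  congr 1
  push_cast
  ring

lemma integral_rescale_mul (hε : 0 < ε) (v : Plane → ℝ) (f : Plane → ℂ) (x : Plane) :
    ∫ y, (((ε ^ 2)⁻¹ * v (ε⁻¹ • (x - y)) : ℝ) : ℂ) * f y = ∫ w, v w * f (x - ε • w) := by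
  have hε' : (ε : ℂ) ≠ 0 := by exact_mod_cast hε.ne'
  have h_scale (y : Plane) : y = x - ε • ε⁻¹ • (x - y) := by
    rw [smul_inv_smul₀ hε.ne', sub_sub_cancel]
  calc ∫ y, (((ε ^ 2)⁻¹ * v (ε⁻¹ • (x - y)) : ℝ) : ℂ) * f y
      = ∫ y, (((ε ^ 2)⁻¹ * v (ε⁻¹ • (x - y)) : ℝ) : ℂ) * f (x - ε • ε⁻¹ • (x - y)) := by
        simp_rw [← h_scale]
    _ = ∫ z, (((ε ^ 2)⁻¹ * v (ε⁻¹ • z) : ℝ) : ℂ) * f (x - ε • ε⁻¹ • z) :=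
        integral_sub_left_eq_self (fun z : Plane =>
          (((ε ^ 2)⁻¹ * v (ε⁻¹ • z) : ℝ) : ℂ) * f (x - ε • ε⁻¹ • z)) volume x
    _ = ε ^ 2 • ∫ w, (((ε ^ 2)⁻¹ * v w : ℝ) : ℂ) * f (x - ε • w) := by
        rw [Measure.integral_comp_inv_smul volume (fun w : Plane =>
          (((ε ^ 2)⁻¹ * v w : ℝ) : ℂ) * f (x - ε • w)) ε, finrank_euclideanSpace_fin,
          abs_of_nonneg (sq_nonneg ε)]
    _ = ∫ w, v w * f (x - ε • w) := by
        simp only [Complex.ofReal_mul, mul_assoc, integral_const_mul, Complex.real_smul]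
        push_cast
        field_simp

lemma integral_rescaled_mul_eigenfunction (hv : Integrable v) (hε : 0 < ε) (x : Plane)
    (k : Lattice) : ∫ y in torus, (rescaled v ε (x - y) : ℂ) * eigenfunction k y =
      eigenfunction k x * 𝓕 (fun x => (v x : ℂ)) (ε • toPlane k) := by
  simp_rw [rescaled_sub_mul_eigenfunction]
  rw [integral_torus_tsum (integrable_rescale_mul_eigenfunction hv hε x k),
    integral_rescale_mul hε, Real.fourier_eq', ← integral_const_mul]
  simp only [eigenfunction_sub_smul, smul_eq_mul]
  exact integral_congr_ae (ae_of_all _ fun w => by ring)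

/-- The Fourier coefficients `v̂ (ε k)` of the rescaled potential, as real numbers (for `v` of
positive type the imaginary part, dropped here, vanishes). -/
def multiplier (v : Plane → ℝ) (ε : ℝ) (k : Lattice) : ℝ :=
  (𝓕 (fun x => (v x : ℂ)) (ε • toPlane k)).re

lemma IsPositiveType.multiplier_nonneg (hv : IsPositiveType v) (ε : ℝ) (k : Lattice) :
    0 ≤ multiplier v ε k := by
  obtain ⟨r, hr, h_fourier⟩ := hv.fourier_nonneg (ε • toPlane k)
  simpa only [multiplier, h_fourier, Complex.ofReal_re] using hr

lemma IsPositiveType.ofReal_multiplier (hv : IsPositiveType v) (ε : ℝ) (k : Lattice) :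
    (multiplier v ε k : ℂ) = 𝓕 (fun x => (v x : ℂ)) (ε • toPlane k) := by
  obtain ⟨r, -, h_fourier⟩ := hv.fourier_nonneg (ε • toPlane k)
  simp only [multiplier, h_fourier, Complex.ofReal_re]

lemma abs_multiplier_le (v : Plane → ℝ) (ε : ℝ) (k : Lattice) :
    |multiplier v ε k| ≤ ∫ x, |v x| := by
  refine (Complex.abs_re_le_norm _).trans ?_
  rw [Real.fourier_eq']
  refine (norm_integral_le_integral_norm _).trans_eq ?_
  simp_rw [norm_smul, Complex.norm_exp_ofReal_mul_I, one_mul, Complex.norm_real, Real.norm_eq_abs]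

end Rescaled

/-! ### Wick products of four series -/

lemma filter_involutive_perm_four :
    (Finset.univ.filter fun σ : Equiv.Perm (Fin 4) => σ * σ = 1) =
      {1, Equiv.swap 0 1, Equiv.swap 0 2, Equiv.swap 0 3, Equiv.swap 1 2, Equiv.swap 1 3,
        Equiv.swap 2 3, Equiv.swap 0 1 * Equiv.swap 2 3, Equiv.swap 0 2 * Equiv.swap 1 3,
        Equiv.swap 0 3 * Equiv.swap 1 2} := by
  decide

lemma wick_four {Ω : Type*} [MeasurableSpace Ω] (P : Measure Ω) (ξ : Fin 4 → Ω → ℂ) (s : Ω) :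
    wick P ξ s = ξ 0 s * ξ 1 s * (ξ 2 s * ξ 3 s)
      - (∫ t, ξ 0 t * ξ 1 t ∂P) * (ξ 2 s * ξ 3 s) - (∫ t, ξ 0 t * ξ 2 t ∂P) * (ξ 1 s * ξ 3 s)
      - (∫ t, ξ 0 t * ξ 3 t ∂P) * (ξ 1 s * ξ 2 s) - (∫ t, ξ 1 t * ξ 2 t ∂P) * (ξ 0 s * ξ 3 s)
      - (∫ t, ξ 1 t * ξ 3 t ∂P) * (ξ 0 s * ξ 2 s) - (∫ t, ξ 2 t * ξ 3 t ∂P) * (ξ 0 s * ξ 1 s)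
      + (∫ t, ξ 0 t * ξ 1 t ∂P) * (∫ t, ξ 2 t * ξ 3 t ∂P)
      + (∫ t, ξ 0 t * ξ 2 t ∂P) * (∫ t, ξ 1 t * ξ 3 t ∂P)
      + (∫ t, ξ 0 t * ξ 3 t ∂P) * (∫ t, ξ 1 t * ξ 2 t ∂P) := by
  rw [wick, filter_involutive_perm_four]
  repeat rw [Finset.sum_insert (by decide)]
  rw [Finset.sum_singleton]
  simp only [Finset.prod_filter, Fin.prod_univ_four]
  simp [Equiv.swap_apply_def]
  ring

lemma hasSum_mul_prod {A B 𝕜 : Type*} [RCLike 𝕜] {f : A → 𝕜} {g : B → 𝕜} {F G : 𝕜}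
    (hf : HasSum f F) (hg : HasSum g G) : HasSum (fun p : A × B => f p.1 * g p.2) (F * G) :=
  hf.mul hg (summable_mul_of_summable_norm hf.summable.norm hg.summable.norm)

section WickSeriesExpansion

variable {ι : Type*}

/-- Exchange of the second and the fourth index of a quadruple, which brings the two pairings of
a Wick monomial into the same form. -/
def exchange : Quad ι ≃ Quad ι where
  toFun k := ((k.1.1, k.2.2), (k.2.1, k.1.2))
  invFun k := ((k.1.1, k.2.2), (k.2.1, k.1.2))
  left_inv _ := rfl
  right_inv _ := rfl

lemma hasSum_mul_exchange {f g : ι × ι → ℂ} {F G : ℂ} (hf : HasSum f F) (hg : HasSum g G) :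
    HasSum (fun k : Quad ι => f (k.1.1, k.2.2) * g (k.2.1, k.1.2)) (F * G) :=
  exchange.hasSum_iff.mpr (hasSum_mul_prod hf hg)

variable [DecidableEq ι]

lemma hasSum_kron_mul {f g : ι → ℂ} {F : ℂ} (hfg : HasSum (fun k => f k * g k) F) :
    HasSum (fun p : ι × ι => kron p.1 p.2 * (f p.1 * g p.2)) F := by
  have h_inj : Function.Injective fun k : ι => (k, k) := fun _ _ h => congrArg Prod.fst h
  refine (h_inj.hasSum_iff fun p hp => ?_).mp (hfg.congr_fun fun k => ?_)
  · rw [kron, if_neg fun h => hp ⟨p.1, Prod.ext rfl h⟩, zero_mul]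
  · simp [kron]

lemma hasSum_wickMonomial {f f' g g' : ι → ℂ} {X : ι → ℂ} {F F' G G' Cff' Cgg' Cfg' Cgf' : ℂ}
    (hf : HasSum (fun k => f k * X k) F) (hf' : HasSum (fun k => f' k * conj (X k)) F')
    (hg : HasSum (fun k => g k * X k) G) (hg' : HasSum (fun k => g' k * conj (X k)) G')
    (hff' : HasSum (fun k => f k * f' k) Cff') (hgg' : HasSum (fun k => g k * g' k) Cgg')
    (hfg' : HasSum (fun k => f k * g' k) Cfg') (hgf' : HasSum (fun k => g k * f' k) Cgf') :
    HasSum (fun k : Quad ι => f k.1.1 * f' k.1.2 * (g k.2.1 * g' k.2.2) * wickMonomial k X)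
      (F * F' * (G * G') - Cff' * (G * G') - Cgg' * (F * F') - Cfg' * (G * F') - Cgf' * (F * G')
        + Cff' * Cgg' + Cfg' * Cgf') := by
  have h_full := hasSum_mul_prod (hasSum_mul_prod hf hf') (hasSum_mul_prod hg hg')
  have h_ff' := hasSum_mul_prod (hasSum_kron_mul hff') (hasSum_mul_prod hg hg')
  have h_gg' := hasSum_mul_prod (hasSum_kron_mul hgg') (hasSum_mul_prod hf hf')
  have h_fg' := hasSum_mul_exchange (hasSum_kron_mul hfg') (hasSum_mul_prod hg hf')
  have h_gf' := hasSum_mul_exchange (hasSum_mul_prod hf hg') (hasSum_kron_mul hgf')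
  have h_straight := hasSum_mul_prod (hasSum_kron_mul hff') (hasSum_kron_mul hgg')
  have h_crossed := hasSum_mul_exchange (hasSum_kron_mul hfg') (hasSum_kron_mul hgf')
  rw [mul_comm Cgf']
  refine ((((((h_full.sub h_ff').sub ((Equiv.prodComm _ _).hasSum_iff.mpr h_gg')).sub h_fg').sub
    h_gf').add h_straight).add h_crossed).congr_fun fun k => ?_
  simp only [wickMonomial, Function.comp_apply, Equiv.prodComm_apply, Prod.fst_swap, Prod.snd_swap]
  ring

end WickSeriesExpansion

/-! ### Covariances of absolutely convergent series -/

section SeriesOfRandomVariables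

variable {Ω A B : Type*} [MeasurableSpace Ω] {P : Measure Ω}

lemma integral_norm_mul_norm_le_one {E F : Type*} [NormedAddCommGroup E] [NormedAddCommGroup F]
    {X : Ω → E} {Y : Ω → F} (hX : MemLp X 2 P) (hY : MemLp Y 2 P)
    (hX1 : ∫ s, ‖X s‖ ^ 2 ∂P ≤ 1) (hY1 : ∫ s, ‖Y s‖ ^ 2 ∂P ≤ 1) :
    ∫ s, ‖X s‖ * ‖Y s‖ ∂P ≤ 1 := by
  have hX2 := hX.integrable_norm_pow two_ne_zero
  have hY2 := hY.integrable_norm_pow two_ne_zero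
  calc ∫ s, ‖X s‖ * ‖Y s‖ ∂P ≤ ∫ s, (2⁻¹ * ‖X s‖ ^ 2 + 2⁻¹ * ‖Y s‖ ^ 2) ∂P := by
        refine integral_mono_of_nonneg (ae_of_all _ fun s => by positivity)
          ((hX2.const_mul _).add (hY2.const_mul _)) (ae_of_all _ fun s => ?_)
        linarith [two_mul_le_add_sq ‖X s‖ ‖Y s‖]
    _ ≤ 1 := by
        rw [integral_add (hX2.const_mul _) (hY2.const_mul _), integral_const_mul,
          integral_const_mul]
        linarith

variable [Countable A] {f : A → ℂ} {X : A → Ω → ℂ}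

lemma ae_summable_mul [IsProbabilityMeasure P] (hf : Summable f) (hX : ∀ k, MemLp (X k) 2 P)
    (hX1 : ∀ k, ∫ s, ‖X k s‖ ^ 2 ∂P ≤ 1) : ∀ᵐ s ∂P, Summable fun k => f k * X k s := by
  have h_norm (k : A) : ∫ s, ‖X k s‖ ∂P ≤ 1 := by
    simpa using integral_norm_mul_norm_le_one (hX k) (memLp_const (1 : ℝ)) (hX1 k) (by simp)
  have h_sum : Summable fun k => ∫ s, ‖f k * X k s‖ ∂P := by
    refine Summable.of_nonneg_of_le (fun k => integral_nonneg fun s => norm_nonneg _)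
      (fun k => ?_) hf.norm
    simp_rw [norm_mul, integral_const_mul]
    exact mul_le_of_le_one_right (norm_nonneg _) (h_norm k)
  filter_upwards [ae_summable_norm_of_summable_integral
    (fun k => ((hX k).integrable one_le_two).const_mul (f k)) h_sum] with s hs
  exact hs.of_norm

lemma integral_tsum_mul_tsum [IsProbabilityMeasure P] [Countable B] {g : B → ℂ} {Y : B → Ω → ℂ}
    (hf : Summable f) (hg : Summable g) (hX : ∀ k, MemLp (X k) 2 P) (hY : ∀ k, MemLp (Y k) 2 P)
    (hX1 : ∀ k, ∫ s, ‖X k s‖ ^ 2 ∂P ≤ 1) (hY1 : ∀ k, ∫ s, ‖Y k s‖ ^ 2 ∂P ≤ 1) :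
    ∫ s, (∑' k, f k * X k s) * (∑' k, g k * Y k s) ∂P =
      ∑' p : A × B, f p.1 * g p.2 * ∫ s, X p.1 s * Y p.2 s ∂P := by
  have h_expand : ∀ᵐ s ∂P, (∑' k, f k * X k s) * (∑' k, g k * Y k s) =
      ∑' p : A × B, f p.1 * g p.2 * (X p.1 s * Y p.2 s) := by
    filter_upwards [ae_summable_mul hf hX hX1, ae_summable_mul hg hY hY1] with s hXs hYs
    rw [tsum_mul_tsum_of_summable_norm hXs.norm hYs.norm]
    exact tsum_congr fun p => by ring
  rw [integral_congr_ae h_expand, ← integral_tsum_of_summable_integral_norm]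
  · exact tsum_congr fun p => integral_const_mul _ _
  · exact fun p => ((hX p.1).integrable_mul (hY p.2)).const_mul _
  · refine Summable.of_nonneg_of_le (fun p => integral_nonneg fun s => norm_nonneg _)
      (fun p => ?_) (hf.norm.mul_norm hg.norm)
    simp_rw [norm_mul, integral_const_mul]
    exact mul_le_of_le_one_right (by positivity)
      (integral_norm_mul_norm_le_one (hX p.1) (hY p.2) (hX1 p.1) (hY1 p.2))

end SeriesOfRandomVariables

section GaussianSeries

variable {ι : Type*}

lemma memLp_two_eval (k : ι) : MemLp (fun X : ι → ℂ => X k) 2 (gaussianFamily ι) :=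
  hasMoments_eval k 2 ENNReal.ofNat_ne_top

lemma integral_norm_sq_eval (k : ι) : ∫ X, ‖X k‖ ^ 2 ∂gaussianFamily ι = 1 := by
  classical
  have h_ofReal : ((∫ X, ‖X k‖ ^ 2 ∂gaussianFamily ι : ℝ) : ℂ) = 1 := by
    simpa [← integral_complex_ofReal, Complex.mul_conj', kron] using
      integral_eval_mul_conj_eval k k
  exact_mod_cast h_ofReal

variable [Countable ι] {f g : ι → ℂ}

lemma ae_summable_mul_eval (hf : Summable f) :
    ∀ᵐ X ∂gaussianFamily ι, Summable fun k => f k * X k :=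
  ae_summable_mul hf memLp_two_eval fun k => (integral_norm_sq_eval k).le

lemma integral_tsum_mul_tsum_eval (hf : Summable f) (hg : Summable g) :
    ∫ X, (∑' k, f k * X k) * (∑' k, g k * X k) ∂gaussianFamily ι = 0 := by
  rw [integral_tsum_mul_tsum hf hg memLp_two_eval memLp_two_eval
    (fun k => (integral_norm_sq_eval k).le) (fun k => (integral_norm_sq_eval k).le)]
  simp_rw [integral_eval_mul_eval, mul_zero, tsum_zero]

lemma integral_tsum_mul_tsum_conj_eval (hf : Summable f) (hg : Summable g) :
    ∫ X, (∑' k, f k * X k) * (∑' k, g k * conj (X k)) ∂gaussianFamily ι =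
      ∑' k, f k * g k := by
  classical
  rw [integral_tsum_mul_tsum hf hg memLp_two_eval
    (fun k => (hasMoments_eval k).star 2 ENNReal.ofNat_ne_top)
    (fun k => (integral_norm_sq_eval k).le)
    (fun k => by simpa only [RCLike.norm_conj] using (integral_norm_sq_eval k).le)]
  simp_rw [integral_eval_mul_conj_eval, mul_comm _ (kron _ _)]
  exact (hasSum_kron_mul
    (hf.norm.mul_norm hg.norm |>.of_norm.comp_injective (i := fun k => (k, k))
      fun _ _ h => congrArg Prod.fst h).hasSum).tsum_eq

end GaussianSeries

/-! ### The regularized field -/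

lemma norm_le_norm_toPlane (k : Lattice) : ‖k‖ ≤ ‖toPlane k‖ := by
  refine (pi_norm_le_iff_of_nonneg (norm_nonneg _)).mpr fun i => ?_
  rw [Int.norm_eq_abs]
  exact PiLp.norm_apply_le (toPlane k) i

lemma le_eigenvalue (κ : ℝ) (k : Lattice) : κ ≤ eigenvalue κ k :=
  le_add_of_nonneg_right (by positivity)

lemma eigenvalue_pos {κ : ℝ} (hκ : 0 < κ) (k : Lattice) : 0 < eigenvalue κ k :=
  hκ.trans_le (le_eigenvalue κ k)

lemma norm_sq_le_eigenvalue {κ : ℝ} (hκ : 0 ≤ κ) (k : Lattice) : ‖k‖ ^ 2 ≤ eigenvalue κ k := by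
  have h_one_le : 1 ≤ 2 * Real.pi ^ 2 := by nlinarith [Real.pi_gt_three]
  calc ‖k‖ ^ 2 ≤ ‖toPlane k‖ ^ 2 := by gcongr; exact norm_le_norm_toPlane k
    _ ≤ 2 * Real.pi ^ 2 * ‖toPlane k‖ ^ 2 := le_mul_of_one_le_left (by positivity) h_one_le
    _ ≤ eigenvalue κ k := le_add_of_nonneg_left hκ

/-- The amplitude `λ_k^{-1/2} θ(k/N)^{1/2}` of the `k`-th mode of the regularized field. -/
def amplitude (κ : ℝ) (θ : Plane → ℝ) (N : ℝ) (k : Lattice) : ℝ :=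
  √(θ (N⁻¹ • toPlane k)) / √(eigenvalue κ k)

lemma amplitude_nonneg (κ : ℝ) (θ : Plane → ℝ) (N : ℝ) (k : Lattice) : 0 ≤ amplitude κ θ N k := by
  unfold amplitude
  positivity

lemma IsCutoff.exists_norm_pow_mul_sqrt_le {θ : Plane → ℝ} (hθ : IsCutoff θ) (m : ℕ) :
    ∃ C, ∀ ξ, ‖ξ‖ ^ m * √(θ ξ) ≤ C := by
  obtain ⟨C, hC⟩ := hθ.decay (m * 2)
  refine ⟨√C, fun ξ => ?_⟩
  rw [← Real.sqrt_sq (by positivity : 0 ≤ ‖ξ‖ ^ m), ← Real.sqrt_mul (by positivity), ← pow_mul]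
  exact Real.sqrt_le_sqrt (hC ξ)

lemma IsCutoff.exists_amplitude_le {κ : ℝ} (hκ : 0 < κ) {θ : Plane → ℝ} (hθ : IsCutoff θ) {N : ℝ}
    (hN : 0 < N) (m : ℕ) : ∃ C, ∀ k, ‖k‖ ^ m * amplitude κ θ N k ≤ C := by
  obtain ⟨C, hC⟩ := hθ.exists_norm_pow_mul_sqrt_le m
  refine ⟨N ^ m * C / √κ, fun k => ?_⟩
  have h_norm : ‖k‖ ≤ N * ‖N⁻¹ • toPlane k‖ := by
    rw [norm_smul, norm_inv, Real.norm_of_nonneg hN.le, mul_inv_cancel_left₀ hN.ne']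
    exact norm_le_norm_toPlane k
  calc ‖k‖ ^ m * amplitude κ θ N k
      ≤ (N * ‖N⁻¹ • toPlane k‖) ^ m * (√(θ (N⁻¹ • toPlane k)) / √κ) := by
        unfold amplitude
        gcongr
        exact le_eigenvalue κ k
    _ = N ^ m * (‖N⁻¹ • toPlane k‖ ^ m * √(θ (N⁻¹ • toPlane k))) / √κ := by ring
    _ ≤ N ^ m * C / √κ := by
        gcongr
        exact hC _

lemma summable_amplitude {κ : ℝ} (hκ : 0 < κ) {θ : Plane → ℝ} (hθ : IsCutoff θ) {N : ℝ}
    (hN : 0 < N) : Summable (amplitude κ θ N) := by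
  obtain ⟨C, hC⟩ := hθ.exists_amplitude_le hκ hN 3
  refine Summable.of_norm_bounded_eventually
    ((EisensteinSeries.summable_one_div_norm_rpow (k := 3) (by norm_num)).mul_left C) ?_
  filter_upwards [Set.Finite.compl_mem_cofinite (Set.finite_singleton (0 : Lattice))] with k hk
  have hk0 : 0 < ‖k‖ := norm_pos_iff.mpr hk
  rw [Real.norm_of_nonneg (amplitude_nonneg κ θ N k), Real.rpow_neg hk0.le, ← div_eq_mul_inv,
    le_div_iff₀ (by positivity), mul_comm]
  exact_mod_cast hC k

section Field

variable {κ : ℝ} {θ : Plane → ℝ} {N : ℝ}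

/-- The coefficient of `X k` in the regularized field at the point `x`. -/
def mode (κ : ℝ) (θ : Plane → ℝ) (N : ℝ) (x : Plane) (k : Lattice) : ℂ :=
  amplitude κ θ N k * eigenfunction k x

lemma field_eq_tsum_mode (κ : ℝ) (θ : Plane → ℝ) (N : ℝ) (x : Plane) (X : Sample) :
    field κ θ N x X = ∑' k, mode κ θ N x k * X k := by
  refine tsum_congr fun k => ?_
  rw [mode, amplitude, Complex.ofReal_div]
  ring

lemma conj_field_eq_tsum_mode (κ : ℝ) (θ : Plane → ℝ) (N : ℝ) (x : Plane) (X : Sample) :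
    conj (field κ θ N x X) = ∑' k, conj (mode κ θ N x k) * conj (X k) := by
  simp_rw [field_eq_tsum_mode, Complex.conj_tsum, map_mul]

lemma summable_mul_eigenfunction {A : Type*} {f : A → ℂ} (hf : Summable f) (p : A → Lattice)
    (x : Plane) : Summable fun k => f k * eigenfunction (p k) x :=
  Summable.of_norm_bounded hf.norm fun k => by rw [norm_mul, norm_eigenfunction, mul_one]

lemma summable_mode (ha : Summable (amplitude κ θ N)) (x : Plane) : Summable (mode κ θ N x) :=
  summable_mul_eigenfunction (Complex.summable_ofReal.mpr ha) id x

lemma summable_mode_mul {X : Sample} (hX : Summable fun k => (amplitude κ θ N k : ℂ) * X k)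
    (x : Plane) : Summable fun k => mode κ θ N x k * X k :=
  (summable_mul_eigenfunction hX id x).congr fun _ => mul_right_comm _ _ _

lemma integral_field_mul_field (ha : Summable (amplitude κ θ N)) (x y : Plane) :
    ∫ X, field κ θ N x X * field κ θ N y X ∂law = 0 := by
  simp_rw [law_eq_gaussianFamily, field_eq_tsum_mode]
  exact integral_tsum_mul_tsum_eval (summable_mode ha x) (summable_mode ha y)

lemma integral_conj_field_mul_conj_field (ha : Summable (amplitude κ θ N)) (x y : Plane) :
    ∫ X, conj (field κ θ N x X) * conj (field κ θ N y X) ∂law = 0 := by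
  simp_rw [← map_mul]
  rw [integral_conj, integral_field_mul_field ha, map_zero]

lemma integral_field_mul_conj_field (ha : Summable (amplitude κ θ N)) (x y : Plane) :
    ∫ X, field κ θ N x X * conj (field κ θ N y X) ∂law =
      ∑' k, mode κ θ N x k * conj (mode κ θ N y k) := by
  simp_rw [law_eq_gaussianFamily, conj_field_eq_tsum_mode, field_eq_tsum_mode]
  exact integral_tsum_mul_tsum_conj_eval (summable_mode ha x) (summable_mode ha y).star

lemma hasSum_wick_field (ha : Summable (amplitude κ θ N)) {X : Sample}
    (hX : Summable fun k => (amplitude κ θ N k : ℂ) * X k) (x y : Plane) :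
    HasSum (fun k : Quad Lattice => mode κ θ N x k.1.1 * conj (mode κ θ N x k.1.2) *
        (mode κ θ N y k.2.1 * conj (mode κ θ N y k.2.2)) * wickMonomial k X)
      (wick law ![field κ θ N x, fun X => conj (field κ θ N x X),
        field κ θ N y, fun X => conj (field κ θ N y X)] X) := by
  have h_field (z : Plane) : HasSum (fun k => mode κ θ N z k * X k) (field κ θ N z X) := by
    rw [field_eq_tsum_mode]
    exact (summable_mode_mul hX z).hasSum
  have h_conj (z : Plane) : HasSum (fun k => conj (mode κ θ N z k) * conj (X k))
      (conj (field κ θ N z X)) := by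
    simpa only [map_mul] using Complex.hasSum_conj'.mpr (h_field z)
  have h_cov (z z' : Plane) : HasSum (fun k => mode κ θ N z k * conj (mode κ θ N z' k))
      (∫ X, field κ θ N z X * conj (field κ θ N z' X) ∂law) := by
    rw [integral_field_mul_conj_field ha]
    exact ((summable_mode ha z).norm.mul_norm (summable_mode ha z').star.norm
      |>.of_norm.comp_injective (i := fun k => (k, k)) fun _ _ h => congrArg Prod.fst h).hasSum
  convert hasSum_wickMonomial (h_field x) (h_conj x) (h_field y) (h_conj y) (h_cov x x)
    (h_cov y y) (h_cov x y) (h_cov y x) using 1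
  rw [wick_four]
  simp only [Matrix.cons_val_zero, Matrix.cons_val_one, Matrix.cons_val,
    integral_field_mul_field ha, integral_conj_field_mul_conj_field ha,
    mul_comm (conj (field κ θ N x _)) (field κ θ N y _)]
  ring

end Field

/-! ### The truncated interactions in Fourier series -/

/-- The momentum `k₃ - k₄` exchanged between the two pairs of the Wick monomial
`:X_{k₁} conj X_{k₂} X_{k₃} conj X_{k₄}:`, at which the Fourier transform of the two-body
potential is evaluated. -/
def transfer (k : Quad Lattice) : Lattice := k.2.1 - k.2.2

/-- The momentum `k₁ - k₂ + k₃ - k₄` of a Wick monomial; translation invariance of the interaction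
forces it to vanish. -/
def totalMomentum (k : Quad Lattice) : Lattice := k.1.1 - k.1.2 + transfer k

/-- The product of the four amplitudes of a quadruple of modes. -/
def amplitudeProd (a : Lattice → ℝ) (k : Quad Lattice) : ℝ :=
  a k.1.1 * a k.1.2 * (a k.2.1 * a k.2.2)

/-- The coefficient of a Wick monomial in the interaction whose two-body potential has the Fourier
coefficients `w`, for a field with the amplitudes `a`; the local interaction has `w = 1`. -/
def interactionCoeff (w a : Lattice → ℝ) (k : Quad Lattice) : ℝ :=
  if totalMomentum k = 0 then 1 / 2 * w (transfer k) * amplitudeProd a k else 0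

lemma mode_mul_conj_mode (κ : ℝ) (θ : Plane → ℝ) (N : ℝ) (x : Plane) (k l : Lattice) :
    mode κ θ N x k * conj (mode κ θ N x l) =
      amplitude κ θ N k * amplitude κ θ N l * eigenfunction (k - l) x := by
  rw [eigenfunction_sub_left, mode, mode, map_mul, Complex.conj_ofReal]
  ring

section Truncated

variable {κ : ℝ} {θ : Plane → ℝ} {N : ℝ} {X : Sample}

lemma hasSum_wick_field_fourier (ha : Summable (amplitude κ θ N))
    (hX : Summable fun k => (amplitude κ θ N k : ℂ) * X k) (x y : Plane) :
    HasSum (fun k : Quad Lattice => (amplitudeProd (amplitude κ θ N) k : ℂ) * wickMonomial k X *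
        eigenfunction (k.1.1 - k.1.2) x * eigenfunction (transfer k) y)
      (wick law ![field κ θ N x, fun X => conj (field κ θ N x X),
        field κ θ N y, fun X => conj (field κ θ N y X)] X) := by
  refine (hasSum_wick_field ha hX x y).congr_fun fun k => ?_
  simp only [mode_mul_conj_mode, amplitudeProd, transfer, Complex.ofReal_mul]
  ring

lemma wickSquares_eq_re_tsum (ha : Summable (amplitude κ θ N))
    (hX : Summable fun k => (amplitude κ θ N k : ℂ) * X k) (x y : Plane) :
    wickSquares κ θ N x y X = (∑' k : Quad Lattice,
      (amplitudeProd (amplitude κ θ N) k : ℂ) * wickMonomial k X *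
        eigenfunction (k.1.1 - k.1.2) x * eigenfunction (transfer k) y).re :=
  congrArg Complex.re (hasSum_wick_field_fourier ha hX x y).tsum_eq.symm

lemma summable_amplitudeProd_mul_wickMonomial (ha : Summable (amplitude κ θ N))
    (hX : Summable fun k => (amplitude κ θ N k : ℂ) * X k) :
    Summable fun k => (amplitudeProd (amplitude κ θ N) k : ℂ) * wickMonomial k X := by
  simpa only [eigenfunction_toPlane, mul_one] using
    (hasSum_wick_field_fourier ha hX (toPlane 0) (toPlane 0)).summable

variable {w : Lattice → ℝ} {B : ℝ}

lemma summable_multiplier_mul (hw : ∀ k, |w k| ≤ B) {f : Quad Lattice → ℂ} (hf : Summable f) :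
    Summable fun k => w (transfer k) * f k := by
  refine Summable.of_norm_bounded (hf.norm.mul_left B) fun k => ?_
  rw [norm_mul, Complex.norm_real]
  gcongr
  exact hw _

lemma interactionCoeff_mul (w a : Lattice → ℝ) (k : Quad Lattice) (z : ℂ) :
    interactionCoeff w a k * z =
      if totalMomentum k = 0 then 1 / 2 * (w (transfer k) * (amplitudeProd a k * z)) else 0 := by
  unfold interactionCoeff
  split_ifs
  · push_cast
    ring
  · rw [Complex.ofReal_zero, zero_mul]

lemma summable_interactionCoeff_mul_wickMonomial (ha : Summable (amplitude κ θ N))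
    (hX : Summable fun k => (amplitude κ θ N k : ℂ) * X k) (hw : ∀ k, |w k| ≤ B) :
    Summable fun k => (interactionCoeff w (amplitude κ θ N) k : ℂ) * wickMonomial k X := by
  refine Summable.of_norm_bounded ((summable_multiplier_mul hw
    (summable_amplitudeProd_mul_wickMonomial ha hX)).norm.mul_left (1 / 2)) fun k => ?_
  rw [interactionCoeff_mul]
  split_ifs
  · simp only [norm_mul, norm_div, norm_one, RCLike.norm_ofNat, le_refl]
  · rw [norm_zero]
    positivity

lemma re_integral_torus {f : Plane → ℂ} (hf : IntegrableOn f torus) :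
    ∫ x in torus, (f x).re = (∫ x in torus, f x).re :=
  Complex.reCLM.integral_comp_comm hf

lemma integral_torus_re_tsum {A : Type*} [Countable A] {C : A → ℂ} (hC : Summable C)
    (p : A → Lattice) :
    ∫ x in torus, (∑' k, C k * eigenfunction (p k) x).re =
      (∑' k, if p k = 0 then C k else 0).re := by
  have h_meas (k : A) :
      AEStronglyMeasurable (fun x => eigenfunction (p k) x) (volume.restrict torus) :=
    (continuous_eigenfunction _).aestronglyMeasurable
  have h_le (k : A) (x : Plane) : ‖eigenfunction (p k) x‖ ≤ 1 := (norm_eigenfunction _ x).le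
  have h_int := integrable_mul_tsum (integrable_const 1) hC.norm h_meas h_le
  have h_eq := integral_mul_tsum (integrable_const 1) hC.norm h_meas h_le
  simp only [one_mul] at h_int h_eq
  simp only [re_integral_torus h_int, h_eq, integral_torus_eigenfunction, mul_ite, mul_one,
    mul_zero]

lemma half_mul_integral_torus_re_tsum (hw : ∀ k, |w k| ≤ B) {a : Lattice → ℝ}
    (hC : Summable fun k => (amplitudeProd a k : ℂ) * wickMonomial k X) :
    1 / 2 * ∫ x in torus, (∑' k, w (transfer k) * (amplitudeProd a k * wickMonomial k X) *
        eigenfunction (totalMomentum k) x).re =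
      (∑' k, (interactionCoeff w a k : ℂ) * wickMonomial k X).re := by
  rw [integral_torus_re_tsum (summable_multiplier_mul hw hC), ← Complex.re_ofReal_mul,
    ← tsum_mul_left]
  simp only [interactionCoeff_mul, mul_ite, mul_zero, Complex.ofReal_div, Complex.ofReal_one,
    Complex.ofReal_ofNat]

lemma truncatedLocal_eq (ha : Summable (amplitude κ θ N))
    (hX : Summable fun k => (amplitude κ θ N k : ℂ) * X k) :
    truncatedLocal κ θ N X = (∑' k,
      (interactionCoeff (fun _ => 1) (amplitude κ θ N) k : ℂ) * wickMonomial k X).re := by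
  rw [← half_mul_integral_torus_re_tsum (w := fun _ => 1) (fun _ => abs_one.le)
    (summable_amplitudeProd_mul_wickMonomial ha hX)]
  simp only [truncatedLocal, wickSquares_eq_re_tsum ha hX, totalMomentum, eigenfunction_add_left,
    Complex.ofReal_one, one_mul, mul_assoc]

lemma integral_torus_rescaled_mul_wickSquares {v : Plane → ℝ} (hv : IsPositiveType v) {ε : ℝ}
    (hε : 0 < ε) (ha : Summable (amplitude κ θ N))
    (hX : Summable fun k => (amplitude κ θ N k : ℂ) * X k) (x : Plane) :
    ∫ y in torus, rescaled v ε (x - y) * wickSquares κ θ N x y X =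
      (∑' k, multiplier v ε (transfer k) *
        (amplitudeProd (amplitude κ θ N) k * wickMonomial k X) *
          eigenfunction (totalMomentum k) x).re := by
  have hC := (summable_mul_eigenfunction (summable_amplitudeProd_mul_wickMonomial ha hX)
    (fun k => k.1.1 - k.1.2) x).norm
  have h_meas (k : Quad Lattice) :
      AEStronglyMeasurable (fun y => eigenfunction (transfer k) y) (volume.restrict torus) :=
    (continuous_eigenfunction _).aestronglyMeasurable
  have h_le (k : Quad Lattice) (y : Plane) : ‖eigenfunction (transfer k) y‖ ≤ 1 :=
    (norm_eigenfunction _ y).le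
  simp_rw [wickSquares_eq_re_tsum ha hX, ← Complex.re_ofReal_mul]
  rw [re_integral_torus
      (integrable_mul_tsum (integrableOn_rescaled hv.integrable hε x) hC h_meas h_le),
    integral_mul_tsum (integrableOn_rescaled hv.integrable hε x) hC h_meas h_le]
  congr 1
  refine tsum_congr fun k => ?_
  rw [integral_rescaled_mul_eigenfunction hv.integrable hε, ← hv.ofReal_multiplier, totalMomentum,
    eigenfunction_add_left]
  ring

lemma truncatedNonlocal_eq {v : Plane → ℝ} (hv : IsPositiveType v) {ε : ℝ} (hε : 0 < ε)
    (ha : Summable (amplitude κ θ N)) (hX : Summable fun k => (amplitude κ θ N k : ℂ) * X k) :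
    truncatedNonlocal κ v ε θ N X = (∑' k,
      (interactionCoeff (multiplier v ε) (amplitude κ θ N) k : ℂ) * wickMonomial k X).re := by
  rw [← half_mul_integral_torus_re_tsum (abs_multiplier_le v ε)
    (summable_amplitudeProd_mul_wickMonomial ha hX)]
  simp only [truncatedNonlocal, integral_torus_rescaled_mul_wickSquares hv hε ha hX]

end Truncated

/-! ### Coefficients of the limiting interaction -/

lemma summable_eigenvalue_rpow {κ : ℝ} (hκ : 0 < κ) :
    Summable fun k : Lattice => eigenvalue κ k ^ (-(7 / 6) : ℝ) := by
  refine Summable.of_norm_bounded_eventually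
    (EisensteinSeries.summable_one_div_norm_rpow (k := 7 / 3) (by norm_num)) ?_
  filter_upwards [Set.Finite.compl_mem_cofinite (Set.finite_singleton (0 : Lattice))] with k hk
  have hk0 : 0 < ‖k‖ := norm_pos_iff.mpr hk
  rw [Real.norm_of_nonneg (Real.rpow_nonneg (eigenvalue_pos hκ k).le _)]
  calc eigenvalue κ k ^ (-(7 / 6) : ℝ) ≤ (‖k‖ ^ 2) ^ (-(7 / 6) : ℝ) :=
        Real.rpow_le_rpow_of_nonpos (by positivity) (norm_sq_le_eigenvalue hκ.le k) (by norm_num)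
    _ = ‖k‖ ^ (-(7 / 3) : ℝ) := by
        rw [← Real.rpow_natCast, ← Real.rpow_mul hk0.le]
        norm_num

lemma mul_mul_mul_le_sum_pow_four (a b c d : ℝ) :
    a * b * (c * d) ≤ 1 / 4 * (a ^ 4 + b ^ 4 + c ^ 4 + d ^ 4) := by
  nlinarith [sq_nonneg (a * b - c * d), sq_nonneg (a ^ 2 - b ^ 2), sq_nonneg (c ^ 2 - d ^ 2)]

lemma amplitudeProd_nonneg {f : Lattice → ℝ} (hf : ∀ k, 0 ≤ f k) (k : Quad Lattice) :
    0 ≤ amplitudeProd f k :=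
  mul_nonneg (mul_nonneg (hf _) (hf _)) (mul_nonneg (hf _) (hf _))

/-- Three of the four momenta determine the fourth, so the products of three of the numbers `h ^ 4`
are summable over the quadruples of total momentum zero; `∏ h ^ 3` is the geometric mean of these
four products. -/
lemma summable_amplitudeProd_pow_three {h : Lattice → ℝ} (h_nonneg : ∀ k, 0 ≤ h k)
    (h_summable : Summable fun k => h k ^ 4) :
    Summable fun k : {k : Quad Lattice // totalMomentum k = 0} =>
      amplitudeProd (fun l => h l ^ 3) k := by
  have h_pow : ∀ k, 0 ≤ h k ^ 4 := fun k => by positivity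
  have h_triple : Summable fun p : (Lattice × Lattice) × Lattice =>
      h p.1.1 ^ 4 * h p.1.2 ^ 4 * h p.2 ^ 4 :=
    (h_summable.mul_of_nonneg h_summable h_pow h_pow).mul_of_nonneg h_summable
      (fun _ => mul_nonneg (h_pow _) (h_pow _)) h_pow
  have summable_of_injOn : ∀ p : Quad Lattice → (Lattice × Lattice) × Lattice,
      (∀ k l, totalMomentum k = 0 → totalMomentum l = 0 → p k = p l → k = l) →
      Summable fun k : {k // totalMomentum k = 0} =>
        h (p k).1.1 ^ 4 * h (p k).1.2 ^ 4 * h (p k).2 ^ 4 := fun p hp =>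
    h_triple.comp_injective (i := fun k : {k // totalMomentum k = 0} => p k)
      fun k l hkl => Subtype.ext (hp _ _ k.2 l.2 hkl)
  have drop_fourth := summable_of_injOn (fun k => (k.1, k.2.1)) (by
    simp only [totalMomentum, transfer, Prod.ext_iff]
    grind)
  have drop_third := summable_of_injOn (fun k => (k.1, k.2.2)) (by
    simp only [totalMomentum, transfer, Prod.ext_iff]
    grind)
  have drop_second := summable_of_injOn (fun k => ((k.1.1, k.2.1), k.2.2)) (by
    simp only [totalMomentum, transfer, Prod.ext_iff]
    grind)
  have drop_first := summable_of_injOn (fun k => ((k.1.2, k.2.1), k.2.2)) (by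
    simp only [totalMomentum, transfer, Prod.ext_iff]
    grind)
  refine Summable.of_nonneg_of_le
    (fun k => amplitudeProd_nonneg (fun l => pow_nonneg (h_nonneg l) 3) _) (fun k => ?_)
    ((((drop_fourth.add drop_third).add drop_second).add drop_first).mul_left (1 / 4))
  convert mul_mul_mul_le_sum_pow_four (h k.1.1.1 * h k.1.1.2 * h k.1.2.1)
    (h k.1.1.1 * h k.1.1.2 * h k.1.2.2) (h k.1.1.1 * h k.1.2.1 * h k.1.2.2)
    (h k.1.1.2 * h k.1.2.1 * h k.1.2.2) using 1
  · unfold amplitudeProd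
    ring
  · ring

/-- The coefficient `λ_k^{-1/2}` of `X k` in the free field. -/
def freeAmplitude (κ : ℝ) (k : Lattice) : ℝ := (√(eigenvalue κ k))⁻¹

lemma freeAmplitude_sq {κ : ℝ} (hκ : 0 < κ) (k : Lattice) :
    freeAmplitude κ k ^ 2 = (eigenvalue κ k)⁻¹ := by
  rw [freeAmplitude, inv_pow, Real.sq_sqrt (eigenvalue_pos hκ k).le]

/-- The summable majorant `∏ λ_k^{-7/8}` of the squared interaction coefficients. The factor
`∏ λ_k^{-1/8}` left over from `∏ λ_k^{-1}` is the source of the rate of convergence of the box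
cutoff. -/
def majorant (κ : ℝ) (k : Quad Lattice) : ℝ :=
  if totalMomentum k = 0 then amplitudeProd (fun l => eigenvalue κ l ^ (-(7 / 8) : ℝ)) k else 0

lemma summable_majorant {κ : ℝ} (hκ : 0 < κ) : Summable (majorant κ) := by
  have h_four : ∀ l, (eigenvalue κ l ^ (-(7 / 24) : ℝ)) ^ 4 = eigenvalue κ l ^ (-(7 / 6) : ℝ) :=
    fun l => by
      rw [← Real.rpow_natCast, ← Real.rpow_mul (eigenvalue_pos hκ l).le]
      norm_num
  have h_three : ∀ l, (eigenvalue κ l ^ (-(7 / 24) : ℝ)) ^ 3 = eigenvalue κ l ^ (-(7 / 8) : ℝ) :=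
    fun l => by
      rw [← Real.rpow_natCast, ← Real.rpow_mul (eigenvalue_pos hκ l).le]
      norm_num
  have h_summable := summable_amplitudeProd_pow_three
    (h := fun l => eigenvalue κ l ^ (-(7 / 24) : ℝ))
    (fun l => Real.rpow_nonneg (eigenvalue_pos hκ l).le _)
    ((summable_eigenvalue_rpow hκ).congr fun l => (h_four l).symm)
  simp only [h_three] at h_summable
  refine (summable_subtype_iff_indicator (s := {k | totalMomentum k = 0})
    (f := amplitudeProd fun l => eigenvalue κ l ^ (-(7 / 8) : ℝ)).mp h_summable).congr fun k => ?_
  simp only [Set.indicator_apply, Set.mem_ofPred_eq, majorant]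

lemma majorant_nonneg {κ : ℝ} (hκ : 0 < κ) (k : Quad Lattice) : 0 ≤ majorant κ k := by
  unfold majorant
  split_ifs
  · exact amplitudeProd_nonneg (fun l => Real.rpow_nonneg (eigenvalue_pos hκ l).le _) k
  · exact le_rfl

lemma amplitudeProd_le {f : Lattice → ℝ} {K R : ℝ} (hf : ∀ l, 0 ≤ f l) (hK : ∀ l, f l ≤ K)
    {k : Quad Lattice} (hR : f k.1.1 ≤ R ∨ f k.1.2 ≤ R ∨ f k.2.1 ≤ R ∨ f k.2.2 ≤ R) :
    amplitudeProd f k ≤ K ^ 3 * R := by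
  have hprod : ∀ {a b c d a' b' c' d' : ℝ}, 0 ≤ a → 0 ≤ b → 0 ≤ c → 0 ≤ d → a ≤ a' → b ≤ b' →
      c ≤ c' → d ≤ d' → a * b * (c * d) ≤ a' * b' * (c' * d') := by
    intro a b c d a' b' c' d' ha hb hc hd haa hbb hcc hdd
    have := ha.trans haa
    have := hb.trans hbb
    have := hc.trans hcc
    have : 0 ≤ a' * b' := by positivity
    gcongr
  unfold amplitudeProd
  rcases hR with h | h | h | h
  · exact (hprod (hf _) (hf _) (hf _) (hf _) h (hK _) (hK _) (hK _)).trans_eq (by ring)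
  · exact (hprod (hf _) (hf _) (hf _) (hf _) (hK _) h (hK _) (hK _)).trans_eq (by ring)
  · exact (hprod (hf _) (hf _) (hf _) (hf _) (hK _) (hK _) h (hK _)).trans_eq (by ring)
  · exact (hprod (hf _) (hf _) (hf _) (hf _) (hK _) (hK _) (hK _) h).trans_eq (by ring)

section Coefficients

variable {κ : ℝ} {w : Lattice → ℝ} {B : ℝ}

lemma eigenvalue_rpow_le (hκ : 0 < κ) (k : Lattice) :
    eigenvalue κ k ^ (-(1 / 8) : ℝ) ≤ κ ^ (-(1 / 8) : ℝ) :=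
  Real.rpow_le_rpow_of_nonpos hκ (le_eigenvalue κ k) (by norm_num)

lemma interactionCoeff_sq_le_mul_amplitudeProd (hκ : 0 < κ) (hw : ∀ k, |w k| ≤ B)
    (k : Quad Lattice) :
    interactionCoeff w (freeAmplitude κ) k ^ 2 ≤ 1 / 4 * B ^ 2 * majorant κ k *
      amplitudeProd (fun l => eigenvalue κ l ^ (-(1 / 8) : ℝ)) k := by
  by_cases hk : totalMomentum k = 0
  · have hsplit : ∀ l, freeAmplitude κ l ^ 2 =
        eigenvalue κ l ^ (-(7 / 8) : ℝ) * eigenvalue κ l ^ (-(1 / 8) : ℝ) := fun l => by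
      rw [freeAmplitude_sq hκ, ← Real.rpow_add (eigenvalue_pos hκ l), ← Real.rpow_neg_one]
      norm_num
    have hpow : ∀ (s : ℝ) l, 0 ≤ eigenvalue κ l ^ s :=
      fun s l => Real.rpow_nonneg (eigenvalue_pos hκ l).le s
    calc interactionCoeff w (freeAmplitude κ) k ^ 2
        = 1 / 4 * w (transfer k) ^ 2 * (amplitudeProd (fun l => eigenvalue κ l ^ (-(7 / 8) : ℝ)) k *
            amplitudeProd (fun l => eigenvalue κ l ^ (-(1 / 8) : ℝ)) k) := by
          rw [interactionCoeff, if_pos hk]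
          simp only [amplitudeProd, mul_pow, hsplit]
          ring
      _ ≤ 1 / 4 * B ^ 2 * (amplitudeProd (fun l => eigenvalue κ l ^ (-(7 / 8) : ℝ)) k *
            amplitudeProd (fun l => eigenvalue κ l ^ (-(1 / 8) : ℝ)) k) := by
          gcongr ?_ * ?_ * _
          · exact mul_nonneg (amplitudeProd_nonneg (hpow _) k) (amplitudeProd_nonneg (hpow _) k)
          · exact sq_le_sq' (abs_le.mp (hw _)).1 (abs_le.mp (hw _)).2
      _ = _ := by rw [majorant, if_pos hk, ← mul_assoc]
  · simp [interactionCoeff, majorant, hk]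

lemma interactionCoeff_sq_le (hκ : 0 < κ) (hw : ∀ k, |w k| ≤ B) {k : Quad Lattice} {R : ℝ}
    (hR : ∃ l ∈ ({k.1.1, k.1.2, k.2.1, k.2.2} : Set Lattice), eigenvalue κ l ^ (-(1 / 8) : ℝ) ≤ R) :
    interactionCoeff w (freeAmplitude κ) k ^ 2 ≤
      1 / 4 * B ^ 2 * (κ ^ (-(1 / 8) : ℝ)) ^ 3 * R * majorant κ k := by
  have hprod := amplitudeProd_le (f := fun l => eigenvalue κ l ^ (-(1 / 8) : ℝ))
    (fun l => Real.rpow_nonneg (eigenvalue_pos hκ l).le _) (eigenvalue_rpow_le hκ)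
    (k := k) (R := R) (by simpa using hR)
  calc _ ≤ 1 / 4 * B ^ 2 * majorant κ k *
        amplitudeProd (fun l => eigenvalue κ l ^ (-(1 / 8) : ℝ)) k :=
        interactionCoeff_sq_le_mul_amplitudeProd hκ hw k
    _ ≤ 1 / 4 * B ^ 2 * majorant κ k * ((κ ^ (-(1 / 8) : ℝ)) ^ 3 * R) := by
        have := majorant_nonneg hκ k
        gcongr
    _ = _ := by ring

lemma summable_interactionCoeff_sq (hκ : 0 < κ) (hw : ∀ k, |w k| ≤ B) :
    Summable fun k => interactionCoeff w (freeAmplitude κ) k ^ 2 :=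
  Summable.of_nonneg_of_le (fun _ => sq_nonneg _)
    (fun k => interactionCoeff_sq_le hκ hw ⟨k.1.1, by simp, eigenvalue_rpow_le hκ _⟩)
    ((summable_majorant hκ).mul_left _)

/-! ### The box cutoff -/

/-- The box of Fourier modes of size at most `n`, the sharp cutoff of Nelson's argument. -/
def modeBox (n : ℕ) : Finset Lattice := Fintype.piFinset fun _ => Finset.Icc (-(n : ℤ)) n

lemma mem_modeBox {n : ℕ} {k : Lattice} : k ∈ modeBox n ↔ ‖k‖ ≤ n := by
  rw [modeBox, Fintype.mem_piFinset, pi_norm_le_iff_of_nonneg (by positivity)]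
  refine forall_congr' fun i => ?_
  rw [Finset.mem_Icc, Int.norm_eq_abs, abs_le]
  exact_mod_cast Iff.rfl

lemma eigenvalue_rpow_le_of_notMem_modeBox (hκ : 0 ≤ κ) {n : ℕ} (hn : 1 ≤ n) {l : Lattice}
    (hl : l ∉ modeBox n) : eigenvalue κ l ^ (-(1 / 8) : ℝ) ≤ (n : ℝ) ^ (-(1 / 4) : ℝ) := by
  have hnl : (n : ℝ) < ‖l‖ := by rwa [mem_modeBox, not_le] at hl
  calc eigenvalue κ l ^ (-(1 / 8) : ℝ) ≤ ((n : ℝ) ^ 2) ^ (-(1 / 8) : ℝ) :=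
        Real.rpow_le_rpow_of_nonpos (by positivity)
          ((by gcongr : (n : ℝ) ^ 2 ≤ ‖l‖ ^ 2).trans (norm_sq_le_eigenvalue hκ l)) (by norm_num)
    _ = (n : ℝ) ^ (-(1 / 4) : ℝ) := by
        rw [← Real.rpow_natCast, ← Real.rpow_mul (by positivity)]
        norm_num

/-- The coefficient of `X k` in the free field cut off to the box of modes of size at most `n`. -/
def boxAmplitude (κ : ℝ) (n : ℕ) (k : Lattice) : ℝ :=
  if k ∈ modeBox n then freeAmplitude κ k else 0

lemma interactionCoeff_box_eq_zero (w : Lattice → ℝ) {n : ℕ} {k : Quad Lattice}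
    (hk : k ∉ (modeBox n ×ˢ modeBox n) ×ˢ (modeBox n ×ˢ modeBox n)) :
    interactionCoeff w (boxAmplitude κ n) k = 0 := by
  have hprod : amplitudeProd (boxAmplitude κ n) k = 0 := by
    simp only [Finset.mem_product] at hk
    simp only [amplitudeProd, boxAmplitude, mul_eq_zero, ite_eq_right_iff]
    tauto
  simp [interactionCoeff, hprod]

lemma interactionCoeff_sub_box_sq_le (hκ : 0 < κ) (hw : ∀ k, |w k| ≤ B) {n : ℕ} (hn : 1 ≤ n)
    (k : Quad Lattice) :
    (interactionCoeff w (freeAmplitude κ) k - interactionCoeff w (boxAmplitude κ n) k) ^ 2 ≤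
      1 / 4 * B ^ 2 * (κ ^ (-(1 / 8) : ℝ)) ^ 3 * (n : ℝ) ^ (-(1 / 4) : ℝ) * majorant κ k := by
  by_cases hk : k ∈ (modeBox n ×ˢ modeBox n) ×ˢ (modeBox n ×ˢ modeBox n)
  · have heq :
        interactionCoeff w (freeAmplitude κ) k = interactionCoeff w (boxAmplitude κ n) k := by
      simp only [Finset.mem_product] at hk
      simp [interactionCoeff, amplitudeProd, boxAmplitude, hk]
    rw [heq, sub_self, zero_pow two_ne_zero]
    exact mul_nonneg (by positivity) (majorant_nonneg hκ k)
  · rw [interactionCoeff_box_eq_zero w hk, sub_zero]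
    refine interactionCoeff_sq_le hκ hw ?_
    have hout := fun l => eigenvalue_rpow_le_of_notMem_modeBox hκ.le hn (l := l)
    simp only [Finset.mem_product, not_and_or] at hk
    simp only [Set.mem_insert_iff, Set.mem_singleton_iff, exists_eq_or_imp, exists_eq_left]
    rcases hk with (h | h) | (h | h) <;> simp only [hout _ h, true_or, or_true]

lemma summable_interactionCoeff_sub_box_sq (hκ : 0 < κ) (hw : ∀ k, |w k| ≤ B) {n : ℕ}
    (hn : 1 ≤ n) : Summable fun k =>
      (interactionCoeff w (freeAmplitude κ) k - interactionCoeff w (boxAmplitude κ n) k) ^ 2 :=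
  Summable.of_nonneg_of_le (fun _ => sq_nonneg _) (interactionCoeff_sub_box_sq_le hκ hw hn)
    ((summable_majorant hκ).mul_left _)

/-- The constant in front of the rate `n^{-1/4}` at which the interaction coefficients with box
cutoff converge, for multipliers bounded by `B`. -/
def rateConst (κ B : ℝ) : ℝ :=
  1 / 4 * B ^ 2 * (κ ^ (-(1 / 8) : ℝ)) ^ 3 * ∑' k, majorant κ k

lemma rateConst_nonneg (hκ : 0 < κ) (B : ℝ) : 0 ≤ rateConst κ B :=
  mul_nonneg (by positivity) (tsum_nonneg (majorant_nonneg hκ))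

lemma tsum_interactionCoeff_sub_box_sq_le (hκ : 0 < κ) (hw : ∀ k, |w k| ≤ B) {n : ℕ}
    (hn : 1 ≤ n) :
    ∑' k, (interactionCoeff w (freeAmplitude κ) k - interactionCoeff w (boxAmplitude κ n) k) ^ 2 ≤
      rateConst κ B * (n : ℝ) ^ (-(1 / 4) : ℝ) := by
  refine ((summable_interactionCoeff_sub_box_sq hκ hw hn).tsum_le_tsum
    (interactionCoeff_sub_box_sq_le hκ hw hn) ((summable_majorant hκ).mul_left _)).trans_eq ?_
  rw [tsum_mul_left, rateConst]
  ring

end Coefficients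

/-- The variance `∑ λ_k^{-1}` of the field with box cutoff at a point of the torus. -/
def boxVariance (κ : ℝ) (n : ℕ) : ℝ := ∑ k ∈ modeBox n, freeAmplitude κ k ^ 2

lemma boxVariance_nonneg (κ : ℝ) (n : ℕ) : 0 ≤ boxVariance κ n :=
  Finset.sum_nonneg fun _ _ => sq_nonneg _

lemma card_modeBox (n : ℕ) : (modeBox n).card = (2 * n + 1) ^ 2 := by
  rw [modeBox, Fintype.card_piFinset]
  simp only [Int.card_Icc, Finset.prod_const, Finset.card_univ, Fintype.card_fin]
  congr 1
  omega

lemma modeBox_subset (n : ℕ) : modeBox n ⊆ modeBox (n + 1) := by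
  intro k hk
  rw [mem_modeBox] at hk ⊢
  push_cast
  linarith

lemma add_one_le_norm_of_notMem_modeBox {n : ℕ} {k : Lattice} (hk : k ∉ modeBox n) :
    (n : ℝ) + 1 ≤ ‖k‖ := by
  rw [mem_modeBox, not_le, EisensteinSeries.norm_eq_max_natAbs] at hk
  rw [EisensteinSeries.norm_eq_max_natAbs]
  exact_mod_cast hk

/-- The shell between two consecutive boxes holds `8 (n + 1)` modes with `λ_k ≥ (n + 1)²`. -/
lemma boxVariance_succ_le {κ : ℝ} (hκ : 0 < κ) (n : ℕ) :
    boxVariance κ (n + 1) ≤ boxVariance κ n + 8 * ((n : ℝ) + 1)⁻¹ := by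
  unfold boxVariance
  rw [← Finset.sum_sdiff (modeBox_subset n), add_comm]
  gcongr
  have hshell : ∀ k ∈ modeBox (n + 1) \ modeBox n,
      freeAmplitude κ k ^ 2 ≤ (((n : ℝ) + 1) ^ 2)⁻¹ := by
    intro k hk
    have hnorm := add_one_le_norm_of_notMem_modeBox (Finset.mem_sdiff.mp hk).2
    rw [freeAmplitude_sq hκ]
    gcongr
    exact le_trans (by gcongr) (norm_sq_le_eigenvalue hκ.le k)
  refine (Finset.sum_le_card_nsmul _ _ _ hshell).trans_eq ?_
  rw [Finset.card_sdiff_of_subset (modeBox_subset n), card_modeBox, card_modeBox, nsmul_eq_mul,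
    show (2 * (n + 1) + 1) ^ 2 - (2 * n + 1) ^ 2 = 8 * (n + 1) from
      Nat.sub_eq_of_eq_add (by ring)]
  push_cast
  field_simp

lemma boxVariance_le_harmonic {κ : ℝ} (hκ : 0 < κ) (n : ℕ) :
    boxVariance κ n ≤ κ⁻¹ + 8 * (harmonic n : ℝ) := by
  induction n with
  | zero =>
    have hbox : modeBox 0 = {0} := by
      ext k
      rw [mem_modeBox, Finset.mem_singleton, Nat.cast_zero, norm_le_zero_iff]
    simp [boxVariance, hbox, freeAmplitude_sq hκ, eigenvalue, toPlane_zero]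
  | succ n ih =>
    refine (boxVariance_succ_le hκ n).trans ?_
    rw [harmonic_succ]
    push_cast
    linarith

lemma boxVariance_le {κ : ℝ} (hκ : 0 < κ) (n : ℕ) :
    boxVariance κ n ≤ (κ⁻¹ + 8) * (1 + Real.log n) := by
  have hlog : 0 ≤ κ⁻¹ * Real.log n :=
    mul_nonneg (inv_pos.mpr hκ).le (Real.log_natCast_nonneg n)
  linarith [boxVariance_le_harmonic hκ n, harmonic_le_one_add_log n]

/-! ### The lower bound for the interaction with finitely many modes -/

/-- The term of index `p` of the Fourier series of the Wick-ordered density `:|φ|²:` of the field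
with the amplitudes `a`. -/
def densityTerm (a : Lattice → ℝ) (X : Sample) (p : Lattice × Lattice) : ℂ :=
  a p.1 * a p.2 * (X p.1 * conj (X p.2) - kron p.1 p.2)

/-- The Fourier coefficient at `d` of the Wick-ordered density `:|φ|²:`, for a field with modes in
the finite set `S`. -/
def densityCoeff (S : Finset Lattice) (a : Lattice → ℝ) (X : Sample) (d : Lattice) : ℂ :=
  ∑ p ∈ S ×ˢ S with p.1 - p.2 = d, densityTerm a X p

lemma conj_densityTerm (a : Lattice → ℝ) (X : Sample) (p : Lattice × Lattice) :
    conj (densityTerm a X p) = densityTerm a X p.swap := by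
  have h_kron : conj (kron p.1 p.2) = kron p.2 p.1 := by
    simp only [kron, apply_ite conj, map_one, map_zero, eq_comm]
  simp only [densityTerm, map_mul, map_sub, Complex.conj_ofReal, Complex.conj_conj, h_kron,
    Prod.fst_swap, Prod.snd_swap]
  ring

lemma conj_densityCoeff (S : Finset Lattice) (a : Lattice → ℝ) (X : Sample) (d : Lattice) :
    conj (densityCoeff S a X d) = densityCoeff S a X (-d) := by
  unfold densityCoeff
  rw [map_sum]
  refine Finset.sum_nbij' Prod.swap Prod.swap ?_ ?_ (by simp) (by simp)
    fun p _ => conj_densityTerm a X p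
  all_goals
    simp only [Finset.mem_filter, Finset.mem_product, Prod.fst_swap, Prod.snd_swap]
    rintro p ⟨⟨h_fst, h_snd⟩, h_sub⟩
    exact ⟨⟨h_snd, h_fst⟩, by grind⟩

lemma densityCoeff_zero (S : Finset Lattice) (a : Lattice → ℝ) (X : Sample) :
    densityCoeff S a X 0 = ((∑ k ∈ S, a k ^ 2 * ‖X k‖ ^ 2 - ∑ k ∈ S, a k ^ 2 : ℝ) : ℂ) := by
  have h_diag : (S ×ˢ S).filter (fun p : Lattice × Lattice => p.1 - p.2 = 0) = S.diag := by
    ext p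
    simp only [sub_eq_zero, Finset.mem_filter, Finset.mem_product, Finset.mem_diag]
    grind
  rw [densityCoeff, h_diag, Finset.sum_diag, ← Finset.sum_sub_distrib, Complex.ofReal_sum]
  refine Finset.sum_congr rfl fun k _ => ?_
  rw [densityTerm, kron, if_pos rfl, Complex.mul_conj']
  push_cast
  ring

lemma sum_mul_densityTerm_mul_densityTerm (S : Finset Lattice) (a w : Lattice → ℝ) (X : Sample) :
    ∑ p ∈ S ×ˢ S, ∑ q ∈ S ×ˢ S, (if totalMomentum (p, q) = 0 then
        (w (transfer (p, q)) : ℂ) * (densityTerm a X p * densityTerm a X q) else 0) =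
      ((∑ d ∈ (S ×ˢ S).image fun q => q.1 - q.2, w d * ‖densityCoeff S a X d‖ ^ 2 : ℝ) : ℂ) := by
  have h_inner : ∀ q ∈ S ×ˢ S, ∑ p ∈ S ×ˢ S, (if totalMomentum (p, q) = 0 then
        (w (transfer (p, q)) : ℂ) * (densityTerm a X p * densityTerm a X q) else 0) =
      w (q.1 - q.2) * conj (densityCoeff S a X (q.1 - q.2)) * densityTerm a X q := by
    intro q _
    rw [conj_densityCoeff, densityCoeff, Finset.mul_sum, Finset.sum_mul, Finset.sum_filter]
    simp only [totalMomentum, transfer, add_eq_zero_iff_eq_neg, mul_assoc]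
  rw [Finset.sum_comm, Finset.sum_congr rfl h_inner, ← Finset.sum_fiberwise_of_maps_to
    (g := fun q : Lattice × Lattice => q.1 - q.2) (t := (S ×ˢ S).image fun q => q.1 - q.2)
    (fun q hq => Finset.mem_image_of_mem _ hq), Complex.ofReal_sum]
  refine Finset.sum_congr rfl fun d _ => ?_
  calc ∑ q ∈ S ×ˢ S with q.1 - q.2 = d,
        w (q.1 - q.2) * conj (densityCoeff S a X (q.1 - q.2)) * densityTerm a X q
      = w d * conj (densityCoeff S a X d) * densityCoeff S a X d := by
        conv_rhs => rw [densityCoeff, Finset.mul_sum]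
        exact Finset.sum_congr rfl fun q hq => by rw [(Finset.mem_filter.mp hq).2]; rfl
    _ = ((w d * ‖densityCoeff S a X d‖ ^ 2 : ℝ) : ℂ) := by
        rw [mul_assoc, Complex.conj_mul']
        push_cast
        rfl

/-- A Wick monomial of total momentum zero is a product of two Wick-ordered densities, except that
its two pairs can be contracted with one another when one is the reverse of the other. -/
lemma interactionCoeff_mul_wickMonomial (a w : Lattice → ℝ) (X : Sample)
    (p q : Lattice × Lattice) :
    (interactionCoeff w a (p, q) : ℂ) * wickMonomial (p, q) X =
      1 / 2 * (if totalMomentum (p, q) = 0 then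
        (w (transfer (p, q)) : ℂ) * (densityTerm a X p * densityTerm a X q) else 0) -
      (if q = p.swap then ((1 / 2 * w (p.2 - p.1) * (a p.1 ^ 2 * a p.2 ^ 2 *
        (‖X p.1‖ ^ 2 + ‖X p.2‖ ^ 2 - 1)) : ℝ) : ℂ) else 0) := by
  rw [interactionCoeff_mul]
  by_cases h_swap : q = p.swap
  · subst h_swap
    have h_momentum : totalMomentum (p, p.swap) = 0 := by
      simp only [totalMomentum, transfer, Prod.fst_swap, Prod.snd_swap]
      abel
    simp only [if_pos h_momentum, if_true, wickMonomial, densityTerm, amplitudeProd, transfer,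
      Prod.fst_swap, Prod.snd_swap, kron]
    push_cast
    simp only [← Complex.mul_conj']
    rcases eq_or_ne p.1 p.2 with h | h
    · simp only [h, if_true]
      ring
    · simp only [h, h.symm, if_false]
      ring
  · rw [if_neg h_swap, sub_zero, mul_ite, mul_zero]
    refine ite_congr rfl (fun h_momentum => ?_) fun _ => rfl
    obtain ⟨k, l⟩ := p
    obtain ⟨m, n⟩ := q
    have h_kn : k ≠ n := by
      rintro rfl
      simp only [totalMomentum, transfer, Prod.swap, Prod.mk.injEq, and_true] at h_momentum h_swap
      exact h_swap (by linear_combination h_momentum)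
    have h_ml : m ≠ l := by
      rintro rfl
      simp only [totalMomentum, transfer, Prod.swap, Prod.mk.injEq, true_and] at h_momentum h_swap
      exact h_swap (by linear_combination -h_momentum)
    simp only [wickMonomial, amplitudeProd, densityTerm, kron, h_kn, h_ml, if_false]
    push_cast
    ring

lemma sum_interactionCoeff_mul_wickMonomial (S : Finset Lattice) (a w : Lattice → ℝ)
    (X : Sample) :
    ∑ k ∈ (S ×ˢ S) ×ˢ (S ×ˢ S), (interactionCoeff w a k : ℂ) * wickMonomial k X =
      ((1 / 2 * (∑ d ∈ (S ×ˢ S).image fun q => q.1 - q.2, w d * ‖densityCoeff S a X d‖ ^ 2) -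
        ∑ p ∈ S ×ˢ S, 1 / 2 * w (p.2 - p.1) * (a p.1 ^ 2 * a p.2 ^ 2 *
          (‖X p.1‖ ^ 2 + ‖X p.2‖ ^ 2 - 1)) : ℝ) : ℂ) := by
  rw [Finset.sum_product]
  simp_rw [interactionCoeff_mul_wickMonomial, Finset.sum_sub_distrib, ← Finset.mul_sum,
    Finset.sum_ite_eq']
  have h_swap : ∀ p ∈ S ×ˢ S, p.swap ∈ S ×ˢ S := fun p hp =>
    Finset.mem_product.mpr (Finset.mem_product.mp hp).symm
  rw [sum_mul_densityTerm_mul_densityTerm, Finset.sum_congr rfl fun p hp => if_pos (h_swap p hp)]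
  push_cast
  rfl

/-- The Fourier coefficients `w` of a two-body potential of positive type with integral one, with
an upper bound `B`; this is the form in which the potential enters the interaction. The local
interaction has `w = 1`. -/
structure IsMultiplier (w : Lattice → ℝ) (B : ℝ) : Prop where
  nonneg : ∀ k, 0 ≤ w k
  le : ∀ k, w k ≤ B
  zero : w 0 = 1

section LowerBound

variable {w : Lattice → ℝ} {B : ℝ}

lemma IsMultiplier.abs_le (hw : IsMultiplier w B) (k : Lattice) : |w k| ≤ B :=
  (abs_of_nonneg (hw.nonneg k)).trans_le (hw.le k)

lemma IsMultiplier.one_le (hw : IsMultiplier w B) : 1 ≤ B := hw.zero ▸ hw.le 0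

lemma sq_le_sum_mul_norm_densityCoeff_sq (hw : IsMultiplier w B) (S : Finset Lattice)
    (a : Lattice → ℝ) (X : Sample) :
    (∑ k ∈ S, a k ^ 2 * ‖X k‖ ^ 2 - ∑ k ∈ S, a k ^ 2) ^ 2 ≤
      ∑ d ∈ (S ×ˢ S).image fun q => q.1 - q.2, w d * ‖densityCoeff S a X d‖ ^ 2 := by
  rcases S.eq_empty_or_nonempty with rfl | ⟨k, hk⟩
  · simp
  · have h_zero : w 0 * ‖densityCoeff S a X 0‖ ^ 2 =
        (∑ k ∈ S, a k ^ 2 * ‖X k‖ ^ 2 - ∑ k ∈ S, a k ^ 2) ^ 2 := by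
      rw [hw.zero, densityCoeff_zero, Complex.norm_real, Real.norm_eq_abs, sq_abs, one_mul]
    rw [← h_zero]
    exact Finset.single_le_sum (f := fun d => w d * ‖densityCoeff S a X d‖ ^ 2)
      (fun d _ => mul_nonneg (hw.nonneg d) (by positivity))
      (Finset.mem_image.mpr ⟨(k, k), Finset.mem_product.mpr ⟨hk, hk⟩, sub_self k⟩)

lemma sum_exchange_le (hw : IsMultiplier w B) (S : Finset Lattice) (a : Lattice → ℝ)
    (X : Sample) :
    ∑ p ∈ S ×ˢ S, 1 / 2 * w (p.2 - p.1) * (a p.1 ^ 2 * a p.2 ^ 2 *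
        (‖X p.1‖ ^ 2 + ‖X p.2‖ ^ 2 - 1)) ≤
      B * ((∑ k ∈ S, a k ^ 2) * ∑ k ∈ S, a k ^ 2 * ‖X k‖ ^ 2) := by
  calc _ ≤ ∑ p ∈ S ×ˢ S, B / 2 * (a p.1 ^ 2 * ‖X p.1‖ ^ 2 * a p.2 ^ 2 +
        a p.1 ^ 2 * (a p.2 ^ 2 * ‖X p.2‖ ^ 2)) := by
        refine Finset.sum_le_sum fun p _ => ?_
        have h_le : w (p.2 - p.1) * (a p.1 ^ 2 * a p.2 ^ 2 * (‖X p.1‖ ^ 2 + ‖X p.2‖ ^ 2)) ≤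
            B * (a p.1 ^ 2 * a p.2 ^ 2 * (‖X p.1‖ ^ 2 + ‖X p.2‖ ^ 2)) :=
          mul_le_mul_of_nonneg_right (hw.le _) (by positivity)
        have h_pos : 0 ≤ w (p.2 - p.1) * (a p.1 ^ 2 * a p.2 ^ 2) :=
          mul_nonneg (hw.nonneg _) (by positivity)
        linarith
    _ = B * ((∑ k ∈ S, a k ^ 2) * ∑ k ∈ S, a k ^ 2 * ‖X k‖ ^ 2) := by
        simp only [← Finset.mul_sum, Finset.sum_add_distrib, Finset.sum_product, ← Finset.sum_mul]
        ring

/-- With `G = ∑ a²` and `M = ∑ a² |X|²` the interaction is at least `(M - G)² / 2 - B G M`, and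
the square absorbs the part of the exchange term that grows with `M`. -/
lemma le_re_sum_interactionCoeff_mul_wickMonomial (hw : IsMultiplier w B) (S : Finset Lattice)
    (a : Lattice → ℝ) (X : Sample) :
    -(B ^ 2 / 2 + B) * (∑ k ∈ S, a k ^ 2) ^ 2 ≤
      (∑ k ∈ (S ×ˢ S) ×ˢ (S ×ˢ S), (interactionCoeff w a k : ℂ) * wickMonomial k X).re := by
  rw [sum_interactionCoeff_mul_wickMonomial, Complex.ofReal_re]
  have h_direct := sq_le_sum_mul_norm_densityCoeff_sq hw S a X
  have h_exchange := sum_exchange_le hw S a X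
  set G := ∑ k ∈ S, a k ^ 2
  set M := ∑ k ∈ S, a k ^ 2 * ‖X k‖ ^ 2
  linarith [sq_nonneg (M - G - B * G)]

end LowerBound

/-! ### Convergence of the truncated interactions -/

section InteractionSeries

/-- The interaction with the Fourier multiplier `w` of the field with the amplitudes `a`, as an
element of `L²`. -/
def interactionSeries (w a : Lattice → ℝ) : Lp ℂ 2 law :=
  wickSeries fun k => (interactionCoeff w a k : ℂ)

/-- The interaction with the Fourier multiplier `w` of the free field. It is the common construction
of `V^ε`, for which `w = multiplier v ε`, and of `V`, for which `w = 1`. -/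
def interaction (κ : ℝ) (w : Lattice → ℝ) (X : Sample) : ℝ :=
  (interactionSeries w (freeAmplitude κ) X).re

variable {w a b : Lattice → ℝ}

lemma summable_norm_interactionCoeff_sq_iff :
    (Summable fun k => ‖(interactionCoeff w a k : ℂ)‖ ^ 2) ↔
      Summable fun k => interactionCoeff w a k ^ 2 := by
  simp only [Complex.norm_real, Real.norm_eq_abs, sq_abs]

lemma interactionSeries_sub (ha : Summable fun k => interactionCoeff w a k ^ 2)
    (hb : Summable fun k => interactionCoeff w b k ^ 2) :
    interactionSeries w a - interactionSeries w b =
      wickSeries fun k => ((interactionCoeff w a k - interactionCoeff w b k : ℝ) : ℂ) := by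
  simp only [Complex.ofReal_sub]
  exact (wickSeries_sub (summable_norm_interactionCoeff_sq_iff.mpr ha)
    (summable_norm_interactionCoeff_sq_iff.mpr hb)).symm

lemma summable_norm_interactionCoeff_sub_sq (ha : Summable fun k => interactionCoeff w a k ^ 2)
    (hb : Summable fun k => interactionCoeff w b k ^ 2) :
    Summable fun k => ‖((interactionCoeff w a k - interactionCoeff w b k : ℝ) : ℂ)‖ ^ 2 := by
  simp only [Complex.ofReal_sub]
  exact summable_norm_sq_sub (summable_norm_interactionCoeff_sq_iff.mpr ha)
    (summable_norm_interactionCoeff_sq_iff.mpr hb)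

lemma abs_re_sub_re_le_norm_interactionSeries_sub (w a b : Lattice → ℝ) :
    ∀ᵐ X ∂law, |(interactionSeries w a X).re - (interactionSeries w b X).re| ≤
      ‖(interactionSeries w a - interactionSeries w b : Lp ℂ 2 law) X‖ := by
  filter_upwards [Lp.coeFn_sub (interactionSeries w a) (interactionSeries w b)] with X hX
  rw [hX, Pi.sub_apply, ← Complex.sub_re]
  exact Complex.abs_re_le_norm _

lemma eLpNorm_interactionSeries_sub_le (ha : Summable fun k => interactionCoeff w a k ^ 2)
    (hb : Summable fun k => interactionCoeff w b k ^ 2) :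
    eLpNorm (fun X => (interactionSeries w a X).re - (interactionSeries w b X).re) 2 law ≤
      ENNReal.ofReal √(384 * ∑' k, (interactionCoeff w a k - interactionCoeff w b k) ^ 2) := by
  have h_norm := norm_sq_wickSeries_le (summable_norm_interactionCoeff_sub_sq ha hb)
  rw [← interactionSeries_sub ha hb] at h_norm
  simp only [Complex.norm_real, Real.norm_eq_abs, sq_abs] at h_norm
  calc _ ≤ eLpNorm (interactionSeries w a - interactionSeries w b : Lp ℂ 2 law) 2 law :=
        eLpNorm_mono_ae (abs_re_sub_re_le_norm_interactionSeries_sub w a b)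
    _ = ENNReal.ofReal ‖interactionSeries w a - interactionSeries w b‖ := by
        rw [ofReal_norm, Lp.enorm_def]
    _ ≤ _ := ENNReal.ofReal_le_ofReal (Real.le_sqrt_of_sq_le h_norm)

lemma memLp_interaction (κ : ℝ) (w : Lattice → ℝ) : MemLp (interaction κ w) 2 law :=
  (Lp.memLp (interactionSeries w (freeAmplitude κ))).re

lemma amplitudeProd_le_amplitudeProd (ha : ∀ k, 0 ≤ a k) (hab : ∀ k, a k ≤ b k)
    (k : Quad Lattice) : amplitudeProd a k ≤ amplitudeProd b k := by
  have hb : ∀ k, 0 ≤ b k := fun k => (ha k).trans (hab k)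
  exact mul_le_mul (mul_le_mul (hab _) (hab _) (ha _) (hb _))
    (mul_le_mul (hab _) (hab _) (ha _) (hb _)) (mul_nonneg (ha _) (ha _)) (mul_nonneg (hb _) (hb _))

lemma interactionCoeff_sq_le_of_le (ha : ∀ k, 0 ≤ a k) (hab : ∀ k, a k ≤ b k)
    (w : Lattice → ℝ) (k : Quad Lattice) :
    interactionCoeff w a k ^ 2 ≤ interactionCoeff w b k ^ 2 := by
  unfold interactionCoeff
  split_ifs
  · simp only [mul_pow _ (amplitudeProd _ k)]
    gcongr
    exacts [amplitudeProd_nonneg ha k, amplitudeProd_le_amplitudeProd ha hab k]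
  · exact le_rfl

lemma interactionCoeff_const_mul (w a : Lattice → ℝ) (K : ℝ) (k : Quad Lattice) :
    interactionCoeff w (fun l => K * a l) k = K ^ 4 * interactionCoeff w a k := by
  unfold interactionCoeff amplitudeProd
  split_ifs <;> ring

end InteractionSeries

section Cutoff

variable {θ : Plane → ℝ} {κ : ℝ} {w : Lattice → ℝ} {B : ℝ}

lemma IsCutoff.exists_amplitude_le_mul_freeAmplitude (hθ : IsCutoff θ) (κ : ℝ) :
    ∃ K, ∀ N k, amplitude κ θ N k ≤ K * freeAmplitude κ k := by
  obtain ⟨C, hC⟩ := hθ.decay 0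
  refine ⟨√C, fun N k => ?_⟩
  rw [amplitude, freeAmplitude, div_eq_mul_inv]
  gcongr
  simpa only [pow_zero, one_mul] using hC (N⁻¹ • toPlane k)

lemma IsCutoff.exists_interactionCoeff_sq_le (hθ : IsCutoff θ) (κ : ℝ) (w : Lattice → ℝ) :
    ∃ K, ∀ N k, interactionCoeff w (amplitude κ θ N) k ^ 2 ≤
      K * interactionCoeff w (freeAmplitude κ) k ^ 2 := by
  obtain ⟨K, hK⟩ := hθ.exists_amplitude_le_mul_freeAmplitude κ
  refine ⟨(K ^ 4) ^ 2, fun N k => ?_⟩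
  rw [← mul_pow, ← interactionCoeff_const_mul]
  exact interactionCoeff_sq_le_of_le (amplitude_nonneg κ θ N) (hK N) w k

lemma summable_interactionCoeff_amplitude_sq (hκ : 0 < κ) (hθ : IsCutoff θ)
    (hw : ∀ k, |w k| ≤ B) (N : ℝ) :
    Summable fun k => interactionCoeff w (amplitude κ θ N) k ^ 2 := by
  obtain ⟨K, hK⟩ := hθ.exists_interactionCoeff_sq_le κ w
  exact Summable.of_nonneg_of_le (fun _ => sq_nonneg _) (hK N)
    ((summable_interactionCoeff_sq hκ hw).mul_left K)

lemma tendsto_amplitude (hθ : IsCutoff θ) (κ : ℝ) (k : Lattice) :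
    Tendsto (fun N => amplitude κ θ N k) atTop (𝓝 (freeAmplitude κ k)) := by
  have h_arg : Tendsto (fun N : ℝ => N⁻¹ • toPlane k) atTop (𝓝 0) := by
    simpa only [zero_smul] using (tendsto_inv_atTop_zero (𝕜 := ℝ)).smul_const (toPlane k)
  have h_cutoff : Tendsto (fun N : ℝ => θ (N⁻¹ • toPlane k)) atTop (𝓝 1) :=
    hθ.at_zero ▸ hθ.continuousAt_zero.tendsto.comp h_arg
  simpa only [amplitude, freeAmplitude, Real.sqrt_one, one_div] using
    h_cutoff.sqrt.div_const √(eigenvalue κ k)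

lemma tendsto_interactionCoeff (hθ : IsCutoff θ) (κ : ℝ) (w : Lattice → ℝ) (k : Quad Lattice) :
    Tendsto (fun N => interactionCoeff w (amplitude κ θ N) k) atTop
      (𝓝 (interactionCoeff w (freeAmplitude κ) k)) := by
  have h_mode := tendsto_amplitude hθ κ
  unfold interactionCoeff amplitudeProd
  split_ifs
  · exact (((h_mode _).mul (h_mode _)).mul ((h_mode _).mul (h_mode _))).const_mul _
  · exact tendsto_const_nhds

lemma tendsto_tsum_interactionCoeff_sub_sq (hκ : 0 < κ) (hθ : IsCutoff θ)
    (hw : ∀ k, |w k| ≤ B) :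
    Tendsto (fun N => ∑' k, (interactionCoeff w (amplitude κ θ N) k -
      interactionCoeff w (freeAmplitude κ) k) ^ 2) atTop (𝓝 0) := by
  obtain ⟨K, hK⟩ := hθ.exists_interactionCoeff_sq_le κ w
  rw [← tsum_zero (α := ℝ) (β := Quad Lattice)]
  refine tendsto_tsum_of_dominated_convergence
    (bound := fun k => 2 * (K + 1) * interactionCoeff w (freeAmplitude κ) k ^ 2)
    ((summable_interactionCoeff_sq hκ hw).mul_left _) (fun k => ?_)
    (Eventually.of_forall fun N k => ?_)
  · simpa only [sub_self, zero_pow two_ne_zero] using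
      ((tendsto_interactionCoeff hθ κ w k).sub_const (interactionCoeff w (freeAmplitude κ) k)).pow 2
  · rw [Real.norm_of_nonneg (sq_nonneg _)]
    have h_sub := add_sq_le (a := interactionCoeff w (amplitude κ θ N) k)
      (b := -interactionCoeff w (freeAmplitude κ) k)
    rw [← sub_eq_add_neg, neg_sq] at h_sub
    linarith [hK N k]

/-- The random variables `T N` are the truncated interactions with the Fourier multiplier `w` and
the cutoff `θ`. The Wick series is only asked to represent `T N` at the samples for which the series
of the field converges, which are almost all of them. -/
def IsTruncation (κ : ℝ) (w : Lattice → ℝ) (θ : Plane → ℝ) (T : ℝ → Sample → ℝ) : Prop :=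
  ∀ N, 0 < N → ∀ X : Sample, (Summable fun k => (amplitude κ θ N k : ℂ) * X k) →
    T N X = (∑' k, (interactionCoeff w (amplitude κ θ N) k : ℂ) * wickMonomial k X).re

lemma isTruncation_truncatedNonlocal {v : Plane → ℝ} (hκ : 0 < κ) (hv : IsPositiveType v) {ε : ℝ}
    (hε : 0 < ε) (hθ : IsCutoff θ) :
    IsTruncation κ (multiplier v ε) θ (truncatedNonlocal κ v ε θ) :=
  fun _ hN _ hX => truncatedNonlocal_eq hv hε (summable_amplitude hκ hθ hN) hX

lemma isTruncation_truncatedLocal (hκ : 0 < κ) (hθ : IsCutoff θ) :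
    IsTruncation κ (fun _ => 1) θ (truncatedLocal κ θ) :=
  fun _ hN _ hX => truncatedLocal_eq (summable_amplitude hκ hθ hN) hX

variable {T : ℝ → Sample → ℝ}

lemma IsTruncation.ae_eq (hT : IsTruncation κ w θ T) (hκ : 0 < κ) (hθ : IsCutoff θ)
    (hw : ∀ k, |w k| ≤ B) {N : ℝ} (hN : 0 < N) :
    (fun X => (interactionSeries w (amplitude κ θ N) X).re) =ᵐ[law] T N := by
  have ha := summable_amplitude hκ hθ hN
  have h_field : ∀ᵐ X ∂law, Summable fun k => (amplitude κ θ N k : ℂ) * X k :=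
    ae_summable_mul_eval (Complex.summable_ofReal.mpr ha)
  have h_series : interactionSeries w (amplitude κ θ N) =ᵐ[law]
      fun X => ∑' k, (interactionCoeff w (amplitude κ θ N) k : ℂ) * wickMonomial k X := by
    refine wickSeries_ae_eq_of_hasSum (summable_norm_interactionCoeff_sq_iff.mpr
      (summable_interactionCoeff_amplitude_sq hκ hθ hw N)) ?_
    filter_upwards [h_field] with X hX
    exact (summable_interactionCoeff_mul_wickMonomial ha hX hw).hasSum
  filter_upwards [h_field, h_series] with X hX hX_series
  rw [hT N hN X hX, hX_series]

lemma IsTruncation.tendsto (hT : IsTruncation κ w θ T) (hκ : 0 < κ) (hθ : IsCutoff θ)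
    (hw : ∀ k, |w k| ≤ B) :
    Tendsto (fun N => eLpNorm (fun X => T N X - interaction κ w X) 2 law) atTop (𝓝 0) := by
  have h_bound : Tendsto (fun N => ENNReal.ofReal √(384 * ∑' k,
      (interactionCoeff w (amplitude κ θ N) k - interactionCoeff w (freeAmplitude κ) k) ^ 2))
      atTop (𝓝 0) := by
    simpa only [mul_zero, Real.sqrt_zero, ENNReal.ofReal_zero] using ENNReal.tendsto_ofReal
      ((tendsto_tsum_interactionCoeff_sub_sq hκ hθ hw).const_mul 384).sqrt
  refine tendsto_of_tendsto_of_tendsto_of_le_of_le' tendsto_const_nhds h_bound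
    (Eventually.of_forall fun _ => zero_le) ?_
  filter_upwards [eventually_gt_atTop 0] with N hN
  refine (eLpNorm_congr_ae ?_).trans_le (eLpNorm_interactionSeries_sub_le
    (summable_interactionCoeff_amplitude_sq hκ hθ hw N) (summable_interactionCoeff_sq hκ hw))
  filter_upwards [hT.ae_eq hκ hθ hw hN] with X hX
  rw [hX, interaction]

lemma ae_eq_of_tendsto_eLpNorm_sub {Ω A E : Type*} [MeasurableSpace Ω] {P : Measure Ω}
    [NormedAddCommGroup E] {p : ENNReal} (hp : 1 ≤ p) {l : Filter A} [l.NeBot] {f : A → Ω → E}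
    (hf : ∀ᶠ i in l, AEStronglyMeasurable (f i) P) {g g' : Ω → E} (hg : AEStronglyMeasurable g P)
    (hg' : AEStronglyMeasurable g' P)
    (h : Tendsto (fun i => eLpNorm (fun x => f i x - g x) p P) l (𝓝 0))
    (h' : Tendsto (fun i => eLpNorm (fun x => f i x - g' x) p P) l (𝓝 0)) : g =ᵐ[P] g' := by
  have h_dist : eLpNorm (g - g') p P ≤ 0 := by
    have h_sum := h'.add h
    rw [add_zero] at h_sum
    refine ge_of_tendsto h_sum ?_
    filter_upwards [hf] with i hi
    calc eLpNorm (g - g') p P = eLpNorm ((f i - g') - (f i - g)) p P := by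
          rw [sub_sub_sub_cancel_left]
      _ ≤ _ := eLpNorm_sub_le (hi.sub hg') (hi.sub hg) hp
  rw [← sub_ae_eq_zero]
  exact (eLpNorm_eq_zero_iff (hg.sub hg') (one_pos.trans_le hp).ne').mp
    (le_antisymm h_dist zero_le)

lemma IsTruncation.interaction_ae_eq (hT : IsTruncation κ w θ T) (hκ : 0 < κ) (hθ : IsCutoff θ)
    (hw : ∀ k, |w k| ≤ B) {V : Sample → ℝ} (hV : MemLp V 2 law)
    (hTV : Tendsto (fun N => eLpNorm (fun X => T N X - V X) 2 law) atTop (𝓝 0)) :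
    V =ᵐ[law] interaction κ w := by
  refine ae_eq_of_tendsto_eLpNorm_sub one_le_two ?_ hV.1 (memLp_interaction κ w).1 hTV
    (hT.tendsto hκ hθ hw)
  filter_upwards [eventually_gt_atTop 0] with N hN
  exact (Complex.continuous_re.comp_aestronglyMeasurable
    (Lp.aestronglyMeasurable (interactionSeries w (amplitude κ θ N)))).congr (hT.ae_eq hκ hθ hw hN)

end Cutoff

lemma isCutoff_indicator_closedBall :
    IsCutoff ((Metric.closedBall (0 : Plane) 1).indicator fun _ => 1) where
  nonneg ξ := Set.indicator_nonneg (fun _ _ => zero_le_one) ξ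
  at_zero := Set.indicator_of_mem (Metric.mem_closedBall_self zero_le_one) _
  continuousAt_zero := by
    refine continuousAt_const (y := (1 : ℝ)) |>.congr ?_
    filter_upwards [Metric.closedBall_mem_nhds (0 : Plane) one_pos] with ξ hξ
    exact (Set.indicator_of_mem hξ fun _ => (1 : ℝ)).symm
  decay m := by
    refine ⟨1, fun ξ => ?_⟩
    by_cases hξ : ξ ∈ Metric.closedBall (0 : Plane) 1
    · rw [Set.indicator_of_mem hξ, mul_one]
      exact pow_le_one₀ (norm_nonneg ξ) (mem_closedBall_zero_iff.mp hξ)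
    · rw [Set.indicator_of_notMem hξ, mul_zero]
      exact zero_le_one

section Existence

variable {κ : ℝ} {v : Plane → ℝ} {ε : ℝ} {V : Sample → ℝ}

lemma isNonlocalInteraction_interaction (hκ : 0 < κ) (hv : IsPositiveType v) (hε : 0 < ε) :
    IsNonlocalInteraction κ v ε (interaction κ (multiplier v ε)) :=
  ⟨memLp_interaction _ _, fun _ hθ =>
    (isTruncation_truncatedNonlocal hκ hv hε hθ).tendsto hκ hθ (abs_multiplier_le v ε)⟩

lemma isLocalInteraction_interaction (hκ : 0 < κ) :
    IsLocalInteraction κ (interaction κ fun _ => 1) :=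
  ⟨memLp_interaction _ _, fun _ hθ =>
    (isTruncation_truncatedLocal hκ hθ).tendsto hκ hθ fun _ => abs_one.le⟩

lemma IsNonlocalInteraction.ae_eq (hV : IsNonlocalInteraction κ v ε V) (hκ : 0 < κ)
    (hv : IsPositiveType v) (hε : 0 < ε) : V =ᵐ[law] interaction κ (multiplier v ε) :=
  have hθ := isCutoff_indicator_closedBall
  (isTruncation_truncatedNonlocal hκ hv hε hθ).interaction_ae_eq hκ hθ (abs_multiplier_le v ε)
    hV.1 (hV.2 _ hθ)

lemma IsLocalInteraction.ae_eq (hV : IsLocalInteraction κ V) (hκ : 0 < κ) :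
    V =ᵐ[law] interaction κ fun _ => 1 :=
  have hθ := isCutoff_indicator_closedBall
  (isTruncation_truncatedLocal hκ hθ).interaction_ae_eq hκ hθ (fun _ => abs_one.le) hV.1
    (hV.2 _ hθ)

end Existence

/-! ### Nelson's estimate -/

section Nelson

variable {κ : ℝ} {w : Lattice → ℝ} {B : ℝ} {n : ℕ}

lemma summable_interactionCoeff_box_sq (w : Lattice → ℝ) (κ : ℝ) (n : ℕ) :
    Summable fun k => interactionCoeff w (boxAmplitude κ n) k ^ 2 :=
  summable_of_ne_finset_zero (s := (modeBox n ×ˢ modeBox n) ×ˢ (modeBox n ×ˢ modeBox n))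
    fun k hk => by rw [interactionCoeff_box_eq_zero w hk, zero_pow two_ne_zero]

lemma le_re_interactionSeries_box (κ : ℝ) (hw : IsMultiplier w B) (n : ℕ) :
    ∀ᵐ X ∂law, -(B ^ 2 / 2 + B) * boxVariance κ n ^ 2 ≤
      (interactionSeries w (boxAmplitude κ n) X).re := by
  have h_variance : boxVariance κ n = ∑ k ∈ modeBox n, boxAmplitude κ n k ^ 2 :=
    Finset.sum_congr rfl fun k hk => by rw [boxAmplitude, if_pos hk]
  have h_series : interactionSeries w (boxAmplitude κ n) =ᵐ[law] fun X =>
      ∑ k ∈ (modeBox n ×ˢ modeBox n) ×ˢ (modeBox n ×ˢ modeBox n),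
        (interactionCoeff w (boxAmplitude κ n) k : ℂ) * wickMonomial k X :=
    wickSeries_ae_eq_of_hasSum
      (summable_norm_interactionCoeff_sq_iff.mpr (summable_interactionCoeff_box_sq w κ n))
      (ae_of_all _ fun X => hasSum_sum_of_ne_finset_zero fun k hk => by
        rw [interactionCoeff_box_eq_zero w hk, Complex.ofReal_zero, zero_mul])
  filter_upwards [h_series] with X hX
  rw [hX, h_variance]
  exact le_re_sum_interactionCoeff_mul_wickMonomial hw (modeBox n) (boxAmplitude κ n) X

lemma measureReal_one_le_norm_interactionSeries_sub_le (hκ : 0 < κ) (hw : ∀ k, |w k| ≤ B)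
    (hn : 1 ≤ n) (m : ℕ) :
    law.real {X | 1 ≤ ‖(interactionSeries w (freeAmplitude κ) -
        interactionSeries w (boxAmplitude κ n) : Lp ℂ 2 law) X‖} ≤
      16 ^ m * (4 * m).factorial * (rateConst κ B * (n : ℝ) ^ (-(1 / 4) : ℝ)) ^ m := by
  have h_free := summable_interactionCoeff_sq hκ hw
  have h_box := summable_interactionCoeff_box_sq w κ n
  have h_moment :=
    measure_one_le_norm_wickSeries_le (summable_norm_interactionCoeff_sub_sq h_free h_box) m
  rw [← interactionSeries_sub h_free h_box] at h_moment
  simp only [Complex.norm_real, Real.norm_eq_abs, sq_abs] at h_moment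
  refine h_moment.trans ?_
  gcongr
  exact tsum_interactionCoeff_sub_box_sq_le hκ hw hn

/-- If the interaction is below the lower bound for the one with finitely many modes by more than
one, then the two interactions differ by more than one. -/
lemma measureReal_interaction_lt_le (hκ : 0 < κ) (hw : IsMultiplier w B) (hn : 1 ≤ n) (m : ℕ)
    {L : ℝ} (hL : (B ^ 2 / 2 + B) * boxVariance κ n ^ 2 + 1 ≤ L) :
    law.real {X | interaction κ w X < -L} ≤
      16 ^ m * (4 * m).factorial * (rateConst κ B * (n : ℝ) ^ (-(1 / 4) : ℝ)) ^ m := by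
  refine le_trans (ENNReal.toReal_mono (measure_ne_top _ _) (measure_mono_ae ?_))
    (measureReal_one_le_norm_interactionSeries_sub_le hκ hw.abs_le hn m)
  filter_upwards [le_re_interactionSeries_box κ hw n,
    abs_re_sub_re_le_norm_interactionSeries_sub w (freeAmplitude κ) (boxAmplitude κ n)]
    with X h_lower h_diff (hX : interaction κ w X < -L)
  refine le_trans ?_ h_diff
  rw [le_abs]
  unfold interaction at hX
  right
  linarith

lemma pow_mul_factorial_mul_pow_le (m : ℕ) {y : ℝ} (hy : 0 ≤ y) :
    16 ^ m * (4 * m).factorial * y ^ m ≤ (4096 * (m : ℝ) ^ 4 * y) ^ m := by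
  have h_factorial : ((4 * m).factorial : ℝ) ≤ (4 * m : ℝ) ^ (4 * m) := by
    exact_mod_cast Nat.factorial_le_pow (4 * m)
  calc 16 ^ m * (4 * m).factorial * y ^ m ≤ 16 ^ m * (4 * m : ℝ) ^ (4 * m) * y ^ m := by gcongr
    _ = (4096 * (m : ℝ) ^ 4 * y) ^ m := by
      rw [pow_mul, ← mul_pow, ← mul_pow]
      congr 1
      ring

/-- The constant of the bound `V_n ≥ -A (1 + log n) ²` for the interaction whose modes are in the
box of size `n`. -/
def lowerBoundConst (κ B : ℝ) : ℝ := (B ^ 2 / 2 + B) * (κ⁻¹ + 8) ^ 2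

lemma one_le_lowerBoundConst (hκ : 0 < κ) (hB : 1 ≤ B) : 1 ≤ lowerBoundConst κ B := by
  have h_inv : 0 < κ⁻¹ := inv_pos.mpr hκ
  exact one_le_mul_of_one_le_of_one_le (by nlinarith) (by nlinarith)

lemma lowerBound_floor_exp_add_one_le (hκ : 0 < κ) (hB : 1 ≤ B) {s : ℝ} (hs : 3 ≤ s) :
    (B ^ 2 / 2 + B) * boxVariance κ ⌊Real.exp s⌋₊ ^ 2 + 1 ≤ 4 * lowerBoundConst κ B * s ^ 2 := by
  have h_const := one_le_lowerBoundConst hκ hB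
  have h_floor : (0 : ℝ) < ⌊Real.exp s⌋₊ := by
    exact_mod_cast Nat.floor_pos.mpr (Real.one_le_exp (by linarith))
  have h_log : Real.log ⌊Real.exp s⌋₊ ≤ s :=
    (Real.log_le_iff_le_exp h_floor).mpr (Nat.floor_le (Real.exp_nonneg s))
  have h_variance : boxVariance κ ⌊Real.exp s⌋₊ ≤ (κ⁻¹ + 8) * (1 + s) :=
    (boxVariance_le hκ _).trans (by gcongr)
  calc (B ^ 2 / 2 + B) * boxVariance κ ⌊Real.exp s⌋₊ ^ 2 + 1
      ≤ (B ^ 2 / 2 + B) * ((κ⁻¹ + 8) * (1 + s)) ^ 2 + 1 := by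
        gcongr
        exact boxVariance_nonneg κ _
    _ = lowerBoundConst κ B * (1 + s) ^ 2 + 1 := by rw [lowerBoundConst]; ring
    _ ≤ lowerBoundConst κ B * ((1 + s) ^ 2 + 1) := by linarith
    _ ≤ lowerBoundConst κ B * (4 * s ^ 2) := by
        gcongr
        nlinarith
    _ = 4 * lowerBoundConst κ B * s ^ 2 := by ring

lemma floor_exp_rpow_neg_quarter_le {s : ℝ} (hs : 0 ≤ s) :
    (⌊Real.exp s⌋₊ : ℝ) ^ (-(1 / 4) : ℝ) ≤ 2 * Real.exp (-(s / 4)) := by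
  have h_one_le : (1 : ℝ) ≤ ⌊Real.exp s⌋₊ := by
    exact_mod_cast Nat.floor_pos.mpr (Real.one_le_exp hs)
  have h_half : Real.exp s / 2 ≤ ⌊Real.exp s⌋₊ := by linarith [Nat.lt_floor_add_one (Real.exp s)]
  have h_two : (2 : ℝ) ^ (1 / 4 : ℝ) ≤ 2 := by
    simpa only [Real.rpow_one] using
      Real.rpow_le_rpow_of_exponent_le one_le_two (by norm_num : (1 / 4 : ℝ) ≤ 1)
  calc (⌊Real.exp s⌋₊ : ℝ) ^ (-(1 / 4) : ℝ) ≤ (Real.exp s / 2) ^ (-(1 / 4) : ℝ) :=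
        Real.rpow_le_rpow_of_nonpos (by positivity) h_half (by norm_num)
    _ = 2 ^ (1 / 4 : ℝ) * Real.exp (-(s / 4)) := by
        rw [Real.div_rpow (by positivity) zero_le_two, ← Real.exp_mul, Real.rpow_neg zero_le_two,
          div_inv_eq_mul, mul_comm]
        congr 2
        ring
    _ ≤ 2 * Real.exp (-(s / 4)) := by gcongr

/-- The choice of the moment `m` is `⌊q z⌋`. -/
lemma le_exp_of_forall_le_pow {p Q q z : ℝ} (hQ : 0 ≤ Q) (hq : 0 ≤ q)
    (hQq : Q * q ^ 4 ≤ Real.exp (-1)) (hz : 0 < z) (h : ∀ m : ℕ, p ≤ (Q * (m / z) ^ 4) ^ m) :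
    p ≤ Real.exp (1 - q * z) := by
  set m := ⌊q * z⌋₊
  have h_floor : (m : ℝ) / z ≤ q := (div_le_iff₀ hz).mpr (Nat.floor_le (by positivity))
  calc p ≤ (Q * (m / z) ^ 4) ^ m := h m
    _ ≤ (Q * q ^ 4) ^ m := by gcongr
    _ ≤ Real.exp (-1) ^ m := by gcongr
    _ = Real.exp (-m) := by rw [← Real.exp_nat_mul, mul_neg_one]
    _ ≤ Real.exp (1 - q * z) := by
        rw [Real.exp_le_exp]
        linarith [Nat.lt_floor_add_one (q * z)]

lemma measureReal_interaction_lt_le_exp (hκ : 0 < κ) (hw : IsMultiplier w B) {q : ℝ}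
    (hq : 0 ≤ q) (hRq : 8192 * rateConst κ B * q ^ 4 ≤ Real.exp (-1)) {s : ℝ} (hs : 3 ≤ s) :
    law.real {X | interaction κ w X < -(4 * lowerBoundConst κ B * s ^ 2)} ≤
      Real.exp (1 - q * Real.exp (s / 16)) := by
  have h_rate := rateConst_nonneg hκ B
  refine le_exp_of_forall_le_pow (by positivity) hq hRq (Real.exp_pos _) fun m => ?_
  have h_floor : 1 ≤ ⌊Real.exp s⌋₊ := Nat.floor_pos.mpr (Real.one_le_exp (by linarith))
  calc law.real {X | interaction κ w X < -(4 * lowerBoundConst κ B * s ^ 2)}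
      ≤ 16 ^ m * (4 * m).factorial *
          (rateConst κ B * (⌊Real.exp s⌋₊ : ℝ) ^ (-(1 / 4) : ℝ)) ^ m :=
        measureReal_interaction_lt_le hκ hw h_floor m
          (lowerBound_floor_exp_add_one_le hκ hw.one_le hs)
    _ ≤ (4096 * (m : ℝ) ^ 4 * (rateConst κ B * (⌊Real.exp s⌋₊ : ℝ) ^ (-(1 / 4) : ℝ))) ^ m :=
        pow_mul_factorial_mul_pow_le m (by positivity)
    _ ≤ (4096 * (m : ℝ) ^ 4 * (rateConst κ B * (2 * Real.exp (-(s / 4))))) ^ m := by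
        gcongr
        exact floor_exp_rpow_neg_quarter_le (by linarith)
    _ = (8192 * rateConst κ B * (m / Real.exp (s / 16)) ^ 4) ^ m := by
        have h_exp : Real.exp (-(s / 4)) = (Real.exp (s / 16) ^ 4)⁻¹ := by
          rw [← Real.exp_nat_mul, ← Real.exp_neg]
          congr 1
          push_cast
          ring
        rw [h_exp, div_pow]
        congr 1
        ring

lemma exp_one_sub_mul_exp_le {q : ℝ} (hq : 0 < q) (s : ℝ) :
    Real.exp (1 - q * Real.exp (s / 16)) ≤
      Real.exp (4 + 1 / q) * Real.exp (-Real.exp (s / 32)) := by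
  have h_sq : Real.exp (s / 16) = Real.exp (s / 32) ^ 2 := by
    rw [← Real.exp_nat_mul]
    congr 1
    push_cast
    ring
  have h_amgm : q * Real.exp (s / 32) ^ 2 + 1 / q - 2 * Real.exp (s / 32) =
      (q * Real.exp (s / 32) - 1) ^ 2 / q := by
    field_simp
    ring
  have h_square : 0 ≤ (q * Real.exp (s / 32) - 1) ^ 2 / q := by positivity
  rw [← Real.exp_add, Real.exp_le_exp, h_sq]
  linarith [Real.exp_pos (s / 32)]

end Nelson

section DoubleExpLowerTail

variable {Ω : Type*} [MeasurableSpace Ω]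

/-- Nelson's bound for the lower tail of the random variable `W`; it is the bound
`P (e^{-W} > t) ≤ C exp (-e^{c √(log t)})` with `t = e^L`. -/
def HasDoubleExpLowerTail (P : Measure Ω) (W : Ω → ℝ) (c C : ℝ) : Prop :=
  ∀ L, 0 ≤ L → P.real {x | W x < -L} ≤ C * Real.exp (-Real.exp (c * √L))

variable {P : Measure Ω} {W W' : Ω → ℝ} {c C : ℝ}

lemma HasDoubleExpLowerTail.congr (h : HasDoubleExpLowerTail P W c C) (hW : W' =ᵐ[P] W) :
    HasDoubleExpLowerTail P W' c C := by
  intro L hL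
  refine (measureReal_congr ?_).trans_le (h L hL)
  filter_upwards [hW] with x hx
  exact congrArg (· < -L) hx

lemma HasDoubleExpLowerTail.measureReal_lt_exp_neg_le (h : HasDoubleExpLowerTail P W c C) {t : ℝ}
    (ht : 1 ≤ t) :
    P.real {x | t < Real.exp (-W x)} ≤ C * Real.exp (-Real.exp (c * √(Real.log t))) := by
  have h_set : {x | t < Real.exp (-W x)} = {x | W x < -Real.log t} :=
    Set.ext fun x => (Real.log_lt_iff_lt_exp (one_pos.trans_le ht)).symm.trans lt_neg
  exact h_set ▸ h _ (Real.log_nonneg ht)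

lemma exists_hasDoubleExpLowerTail_interaction {κ : ℝ} (hκ : 0 < κ) {B : ℝ} (hB : 1 ≤ B) :
    ∃ c, 0 < c ∧ ∃ C, 0 < C ∧ ∀ w, IsMultiplier w B →
      HasDoubleExpLowerTail law (interaction κ w) c C := by
  set A := lowerBoundConst κ B
  have hA : 0 < A := one_pos.trans_le (one_le_lowerBoundConst hκ hB)
  obtain ⟨q, hq, hRq⟩ : ∃ q, 0 < q ∧ 8192 * rateConst κ B * q ^ 4 ≤ Real.exp (-1) := by
    have h_rate := rateConst_nonneg hκ B
    have h_exp : Real.exp (-1) ≤ 1 := Real.exp_le_one_iff.mpr (by norm_num)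
    set q := Real.exp (-1) / (8192 * rateConst κ B + 1)
    have hq : 0 < q := by positivity
    have hq_one : q ≤ 1 := (div_le_one (by positivity)).mpr (by linarith)
    have hq_mul : q * (8192 * rateConst κ B + 1) = Real.exp (-1) :=
      div_mul_cancel₀ _ (by positivity)
    have hq_pow : q ^ 4 ≤ q := pow_le_of_le_one hq.le hq_one four_ne_zero
    exact ⟨q, hq, by nlinarith⟩
  refine ⟨1 / (64 * √A), by positivity, Real.exp (4 + 1 / q), by positivity, fun w hw L hL => ?_⟩
  obtain ⟨s, hs, rfl⟩ : ∃ s, 0 ≤ s ∧ 4 * A * s ^ 2 = L :=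
    ⟨√(L / (4 * A)), Real.sqrt_nonneg _, by
      rw [Real.sq_sqrt (by positivity), mul_div_cancel₀ _ (by positivity)]⟩
  have h_exponent : 1 / (64 * √A) * √(4 * A * s ^ 2) = s / 32 := by
    rw [show 4 * A * s ^ 2 = A * (2 * s) ^ 2 by ring, Real.sqrt_mul hA.le,
      Real.sqrt_sq (by positivity)]
    field_simp
    ring
  rw [h_exponent]
  rcases lt_or_ge s 3 with hs_small | hs_large
  · have h_exp : Real.exp (s / 32) ≤ 4 := by
      linarith [Real.exp_le_exp.mpr (by linarith : s / 32 ≤ 1), Real.exp_one_lt_d9]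
    rw [← Real.exp_add]
    refine measureReal_le_one.trans (Real.one_le_exp ?_)
    linarith [one_div_pos.mpr hq]
  · exact (measureReal_interaction_lt_le_exp hκ hw hq.le hRq hs_large).trans
      (exp_one_sub_mul_exp_le hq s)

/-! ### Exponential integrability -/

lemma lintegral_exp_neg_mul_le [IsProbabilityMeasure P] (hW : AEMeasurable W P) {r : ℝ}
    (hr : 0 ≤ r) :
    ∫⁻ x, ENNReal.ofReal (Real.exp (-(r * W x))) ∂P ≤
      1 + ∑' j : ℕ, ENNReal.ofReal (Real.exp (r * (j + 1))) * P {x | W x < -j} := by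
  have h_set : ∀ j : ℕ, NullMeasurableSet {x | W x < -(j : ℝ)} P := fun j =>
    nullMeasurableSet_lt hW aemeasurable_const
  have h_pointwise : ∀ x, ENNReal.ofReal (Real.exp (-(r * W x))) ≤
      1 + ∑' j : ℕ, {x | W x < -(j : ℝ)}.indicator
        (fun _ => ENNReal.ofReal (Real.exp (r * (j + 1)))) x := by
    intro x
    rcases le_or_gt 0 (W x) with hx | hx
    · refine le_add_right ?_
      rw [ENNReal.ofReal_le_one, Real.exp_le_one_iff, neg_nonpos]
      positivity
    · obtain ⟨j, hj⟩ : ∃ j, ⌈-W x⌉₊ = j + 1 :=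
        Nat.exists_eq_add_one.mpr (Nat.ceil_pos.mpr (neg_pos.mpr hx))
      obtain ⟨h_lower, h_upper⟩ := (Nat.ceil_eq_iff j.succ_ne_zero).mp hj
      refine le_add_left (le_trans ?_ (ENNReal.le_tsum j))
      rw [Nat.succ_sub_one] at h_lower
      rw [Nat.cast_succ] at h_upper
      have h_mem : x ∈ {x | W x < -(j : ℝ)} := lt_neg_of_lt_neg h_lower
      rw [Set.indicator_of_mem h_mem]
      rw [← mul_neg]
      gcongr
  refine (lintegral_mono h_pointwise).trans_eq ?_
  rw [lintegral_add_left measurable_const, lintegral_tsum fun j =>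
    aemeasurable_const.indicator₀ (h_set j), lintegral_const, measure_univ, mul_one]
  simp only [lintegral_indicator_const₀ (h_set _)]

lemma mul_sub_le_exp_mul_sqrt (hc : 0 < c) (a : ℝ) {y : ℝ} (hy : 0 ≤ y) :
    a * y - 6 * a ^ 2 / c ^ 4 ≤ Real.exp (c * √y) := by
  have h_sqrt : (c * √y) ^ 4 = c ^ 4 * y ^ 2 := by
    rw [mul_pow, show (√y) ^ 4 = (√y ^ 2) ^ 2 by ring, Real.sq_sqrt hy]
  have h_square : c ^ 4 * y ^ 2 / (Nat.factorial 4 : ℕ) - (a * y - 6 * a ^ 2 / c ^ 4) =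
      (c ^ 4 * y - 12 * a) ^ 2 / (24 * c ^ 4) := by
    simp only [Nat.factorial]
    field_simp
    ring
  calc a * y - 6 * a ^ 2 / c ^ 4 ≤ c ^ 4 * y ^ 2 / (Nat.factorial 4 : ℕ) := by
        rw [← sub_nonneg, h_square]
        positivity
    _ ≤ Real.exp (c * √y) := h_sqrt ▸ Real.pow_div_factorial_le_exp (c * √y) (by positivity) 4

lemma HasDoubleExpLowerTail.lintegral_exp_neg_mul_le [IsProbabilityMeasure P]
    (h : HasDoubleExpLowerTail P W c C) (hW : AEMeasurable W P) (hc : 0 < c) (hC : 0 ≤ C) {r : ℝ}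
    (hr : 0 ≤ r) :
    ∫⁻ x, ENNReal.ofReal (Real.exp (-(r * W x))) ∂P ≤ ENNReal.ofReal
      (1 + C * Real.exp (r + 6 * (r + 1) ^ 2 / c ^ 4) * (1 - Real.exp (-1))⁻¹) := by
  set K := C * Real.exp (r + 6 * (r + 1) ^ 2 / c ^ 4)
  have h_geometric : HasSum (fun j : ℕ => K * Real.exp (-1) ^ j) (K * (1 - Real.exp (-1))⁻¹) :=
    (hasSum_geometric_of_lt_one (Real.exp_nonneg _)
      (Real.exp_lt_one_iff.mpr (by norm_num))).mul_left K
  have h_nonneg : ∀ j : ℕ, 0 ≤ K * Real.exp (-1) ^ j := fun j => by positivity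
  refine (Phi42.lintegral_exp_neg_mul_le hW hr).trans ?_
  rw [← h_geometric.tsum_eq, ENNReal.ofReal_add zero_le_one (tsum_nonneg h_nonneg),
    ENNReal.ofReal_one, ENNReal.ofReal_tsum_of_nonneg h_nonneg h_geometric.summable]
  gcongr with j
  rw [← ofReal_measureReal, ← ENNReal.ofReal_mul (Real.exp_nonneg _)]
  refine ENNReal.ofReal_le_ofReal ?_
  calc Real.exp (r * (j + 1)) * P.real {x | W x < -j}
      ≤ Real.exp (r * (j + 1)) * (C * Real.exp (-Real.exp (c * √j))) := by
        gcongr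
        exact h j j.cast_nonneg
    _ ≤ Real.exp (r * (j + 1)) * (C * Real.exp (6 * (r + 1) ^ 2 / c ^ 4 - (r + 1) * j)) := by
        gcongr
        linarith [mul_sub_le_exp_mul_sqrt hc (r + 1) j.cast_nonneg]
    _ = K * Real.exp (-1) ^ j := by
        rw [← Real.exp_nat_mul, mul_left_comm, ← Real.exp_add, mul_assoc, ← Real.exp_add]
        congr 2
        ring

lemma uniformIntegrable_of_lintegral_sq_le {A : Type*} [IsFiniteMeasure P] {f : A → Ω → ℝ}
    (hf : ∀ i, AEStronglyMeasurable (f i) P) {K : ℝ}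
    (hK : ∀ i, ∫⁻ x, ENNReal.ofReal (f i x ^ 2) ∂P ≤ ENNReal.ofReal K) :
    UniformIntegrable f 1 P := by
  refine uniformIntegrable_of le_rfl ENNReal.one_ne_top hf fun δ hδ => ?_
  set M : ℝ := (|K| + 1) / δ
  have hM : 0 < M := by positivity
  refine ⟨M.toNNReal, fun i => ?_⟩
  have h_pointwise : ∀ x, ‖{x | M.toNNReal ≤ ‖f i x‖₊}.indicator (f i) x‖ₑ ≤
      ENNReal.ofReal M⁻¹ * ENNReal.ofReal (f i x ^ 2) := by
    intro x
    by_cases hx : x ∈ {x | M.toNNReal ≤ ‖f i x‖₊}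
    · have h_large : M ≤ ‖f i x‖ := Real.toNNReal_le_iff_le_coe.mp hx
      rw [Set.indicator_of_mem hx, ← ENNReal.ofReal_mul (by positivity), ← ofReal_norm]
      refine ENNReal.ofReal_le_ofReal ?_
      rw [← sq_abs, ← Real.norm_eq_abs, inv_mul_eq_div, le_div_iff₀ hM, sq]
      gcongr
    · rw [Set.indicator_of_notMem hx, enorm_zero]
      exact zero_le
  calc eLpNorm ({x | M.toNNReal ≤ ‖f i x‖₊}.indicator (f i)) 1 P
      ≤ ∫⁻ x, ENNReal.ofReal M⁻¹ * ENNReal.ofReal (f i x ^ 2) ∂P :=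
        eLpNorm_one_eq_lintegral_enorm.trans_le (lintegral_mono h_pointwise)
    _ ≤ ENNReal.ofReal M⁻¹ * ENNReal.ofReal K := by
        rw [lintegral_const_mul' _ _ ENNReal.ofReal_ne_top]
        gcongr
        exact hK i
    _ ≤ ENNReal.ofReal δ := by
        rw [← ENNReal.ofReal_mul (by positivity)]
        refine ENNReal.ofReal_le_ofReal ?_
        rw [inv_mul_le_iff₀ hM, div_mul_cancel₀ _ hδ.ne']
        linarith [le_abs_self K]

lemma uniformIntegrable_exp_neg_of_hasDoubleExpLowerTail {A : Type*} [IsProbabilityMeasure P]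
    {V : A → Ω → ℝ} (hV : ∀ i, AEStronglyMeasurable (V i) P) (hc : 0 < c) (hC : 0 ≤ C)
    (h : ∀ i, HasDoubleExpLowerTail P (V i) c C) :
    UniformIntegrable (fun i x => Real.exp (-V i x)) 1 P := by
  refine uniformIntegrable_of_lintegral_sq_le
    (K := 1 + C * Real.exp (2 + 6 * (2 + 1) ^ 2 / c ^ 4) * (1 - Real.exp (-1))⁻¹)
    (fun i => Real.continuous_exp.comp_aestronglyMeasurable (hV i).neg) fun i => ?_
  have h_sq : ∀ x, Real.exp (-V i x) ^ 2 = Real.exp (-(2 * V i x)) := fun x => by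
    rw [← Real.exp_nat_mul, Nat.cast_two, mul_neg]
  simp only [h_sq]
  exact (h i).lintegral_exp_neg_mul_le (hV i).aemeasurable hc hC zero_le_two

end DoubleExpLowerTail

section Multiplier

variable {v : Plane → ℝ}

lemma IsPositiveType.isMultiplier (hv : IsPositiveType v) (hv_one : ∫ x, v x = 1) (ε : ℝ) :
    IsMultiplier (multiplier v ε) (∫ x, |v x|) where
  nonneg := hv.multiplier_nonneg ε
  le k := (le_abs_self _).trans (abs_multiplier_le v ε k)
  zero := by
    simp only [multiplier, toPlane_zero, smul_zero, Real.fourier_eq', inner_zero_right, mul_zero,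
      Complex.ofReal_zero, zero_mul, Complex.exp_zero, one_smul, integral_complex_ofReal, hv_one,
      Complex.ofReal_one, Complex.one_re]

lemma isMultiplier_one {B : ℝ} (hB : 1 ≤ B) : IsMultiplier (fun _ => 1) B where
  nonneg _ := zero_le_one
  le _ := hB
  zero := rfl

end Multiplier

end Phi42

end

theorem proposition4p1_general (κ : ℝ) (hκ : 0 < κ) (v : Phi42.Plane → ℝ)
    (hv : Phi42.IsPositiveType v) (hv_one : ∫ x, v x = 1) :
    (∀ ε : ℝ, 0 < ε → ∃ V, Phi42.IsNonlocalInteraction κ v ε V) ∧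
    (∃ V, Phi42.IsLocalInteraction κ V) ∧
    (∃ c : ℝ, 0 < c ∧ ∃ C : ℝ, 0 < C ∧
      (∀ ε : ℝ, 0 < ε → ∀ V, Phi42.IsNonlocalInteraction κ v ε V → ∀ t : ℝ, 1 ≤ t →
        Phi42.law.real {X | t < Real.exp (-V X)} ≤
          C * Real.exp (-Real.exp (c * √(Real.log t)))) ∧
      (∀ V, Phi42.IsLocalInteraction κ V → ∀ t : ℝ, 1 ≤ t →
        Phi42.law.real {X | t < Real.exp (-V X)} ≤
          C * Real.exp (-Real.exp (c * √(Real.log t))))) ∧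
    (∀ V : ℝ → Phi42.Sample → ℝ, (∀ ε : ℝ, 0 < ε → Phi42.IsNonlocalInteraction κ v ε (V ε)) →
      UniformIntegrable (fun (ε : Set.Ioi (0 : ℝ)) (X : Phi42.Sample) => Real.exp (-V ε X))
        1 Phi42.law) := by
  have hB := (hv.isMultiplier hv_one 0).one_le
  obtain ⟨c, hc, C, hC, h_tail⟩ := Phi42.exists_hasDoubleExpLowerTail_interaction hκ hB
  have h_nonlocal : ∀ ε, 0 < ε → ∀ V, Phi42.IsNonlocalInteraction κ v ε V →
      Phi42.HasDoubleExpLowerTail Phi42.law V c C := fun ε hε V hV =>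
    (h_tail _ (hv.isMultiplier hv_one ε)).congr (hV.ae_eq hκ hv hε)
  have h_local : ∀ V, Phi42.IsLocalInteraction κ V →
      Phi42.HasDoubleExpLowerTail Phi42.law V c C := fun V hV =>
    (h_tail _ (Phi42.isMultiplier_one hB)).congr (hV.ae_eq hκ)
  refine ⟨fun ε hε => ⟨_, Phi42.isNonlocalInteraction_interaction hκ hv hε⟩,
    ⟨_, Phi42.isLocalInteraction_interaction hκ⟩,
    ⟨c, hc, C, hC, fun ε hε V hV t ht => (h_nonlocal ε hε V hV).measureReal_lt_exp_neg_le ht,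
      fun V hV t ht => (h_local V hV).measureReal_lt_exp_neg_le ht⟩,
    fun V hV => Phi42.uniformIntegrable_exp_neg_of_hasDoubleExpLowerTail
      (fun ε => (hV ε ε.2).1.aestronglyMeasurable) hc hC.le
      fun ε => h_nonlocal ε ε.2 _ (hV ε ε.2)⟩

theorem proposition4p1 (κ : ℝ) (hκ : 0 < κ) (v : Phi42.Plane → ℝ) (hv : Phi42.IsPotential v) :
    -- the random variables `V^ε` and `V` exist
    (∀ ε : ℝ, 0 < ε → ∃ V, Phi42.IsNonlocalInteraction κ v ε V) ∧
    (∃ V, Phi42.IsLocalInteraction κ V) ∧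
    -- the tail estimate, with constants that depend only on `κ` and `v`
    (∃ c : ℝ, 0 < c ∧ ∃ C : ℝ, 0 < C ∧
      (∀ ε : ℝ, 0 < ε → ∀ V, Phi42.IsNonlocalInteraction κ v ε V → ∀ t : ℝ, 1 ≤ t →
        Phi42.law.real {X | t < Real.exp (-V X)} ≤
          C * Real.exp (-Real.exp (c * √(Real.log t)))) ∧
      (∀ V, Phi42.IsLocalInteraction κ V → ∀ t : ℝ, 1 ≤ t →
        Phi42.law.real {X | t < Real.exp (-V X)} ≤
          C * Real.exp (-Real.exp (c * √(Real.log t))))) ∧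
    -- uniform integrability
    (∀ V : ℝ → Phi42.Sample → ℝ, (∀ ε : ℝ, 0 < ε → Phi42.IsNonlocalInteraction κ v ε (V ε)) →
      UniformIntegrable (fun (ε : Set.Ioi (0 : ℝ)) (X : Phi42.Sample) => Real.exp (-V ε X))
        1 Phi42.law) :=
  proposition4p1_general κ hκ v hv.isPositiveType hv.integral_eq_one
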